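/- **Setting.** Let $\Sigma$ be a finite set, $(\Omega,\mathcal F,P)$ a probability space, and $\theta=(\theta(t))_{t\in\mathbb Z}$ an i.i.d. $\Sigma$-valued process with $P(\theta(t)=\sigma)=p_\sigma>0$ for all $\sigma\in\Sigma$. Put $u_\sigma(t)=\chi(\theta(t)=\sigma)$ and, for a word $w=\sigma_1\cdots\sigma_k$, $p_w=p_{\sigma_1}\cdots p_{\sigma_k}$ and $u_w(t)=u_{\sigma_1}(t-k+1)\cdots u_{\sigma_k}(t)$ (both equal to $1$ for the empty word $\epsilon$). For a process $r$ with values in a Euclidean space let $z^r_w(t)=r(t-|w|)\,u_w(t-1)/\sqrt{p_w}$, and say that *$r$ is non-anticipative* if for every $t$ the $\sigma$-algebra generated by $\{r(s)\}_{s\le t}\cup\{\theta(s)\}_{s<t}$ is independent of the one generated by $\{\theta(s)\}_{s\ge t}$. The "Hilbert space generated by" a family of square integrable random vectors is the closed linear span of their coordinates in $L^2(P)$, and $E_l[\,\cdot\mid\cdot\,]$ is the orthogonal projection onto it; random variables are identified when almost surely equal. A matrix is stable if all its eigenvalues have modulus $<1$. A *jump-Markov linear system with i.i.d. switching* (JMLSIID)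 of dimension $n$ consists of real matrices $A_\sigma\in\mathbb R^{n\times n}$, $K_\sigma\in\mathbb R^{n\times m}$ ($\sigma\in\Sigma$), $C\in\mathbb R^{d\times n}$, $D\in\mathbb R^{d\times m}$, and processes $x(t)\in\mathbb R^n$, $v(t)\in\mathbb R^m$ such that: $v$ is square integrable, zero-mean and wide-sense stationary; $E[v(t)u_w(l-1)v(l)^T]=0$ for all $t<l$ and all words $w$ with $|w|=l-t$; $v$ is non-anticipative; $x(t)$ belongs to the Hilbert space generated by $\{z^v_w(t): w\neq\epsilon\}$; and $\sum_\sigma p_\sigma A_\sigma^T\otimes A_\sigma^T$ is stable. It is a *realization* of a process $y(t)\in\mathbb R^d$ if for all $t$ $$x(t+1)=\sum_{\sigma\in\Sigma}\bigl(A_\sigma x(t)+K_\sigma v(t)\bigr)u_\sigma(t),\qquad y(t)=Cx(t)+Dv(t),$$ and a *minimal* one if no JMLSIID realization of $y$ (on the same probability space, with the same $\theta$) has smaller dimension. Write $z_w=z^y_w$. Let $\Psi_y=\{S_{(j,\sigma)}: 1\le j\le d,\ \sigma\in\Sigma\}$, where $S_{(j,\sigma)}(w)\in\mathbb R^d$ is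 the $j$th column of $E[y(t)z_{\sigma w}(t)^T]$ (taken at $t=0$). A *representation* of $\Psi_y$ of dimension $n$ is $R=(\{A_\sigma\},\{B_{j,\sigma}\},C)$ with $A_\sigma\in\mathbb R^{n\times n}$, $B_{j,\sigma}\in\mathbb R^n$, $C\in\mathbb R^{d\times n}$ and $S_{(j,\sigma)}(\sigma_1\cdots\sigma_k)=CA_{\sigma_k}\cdots A_{\sigma_1}B_{j,\sigma}$ for all words; it is minimal if $n$ is smallest possible. $\Psi_y$ is *rational* if it has a representation, and *square summable* if $\sum_w\|S_{(j,\sigma)}(w)\|^2<\infty$ for all $(j,\sigma)$. Two representations are isomorphic if a nonsingular $T$ satisfies $TA'_\sigma=A_\sigma T$, $TB'_{j,\sigma}=B_{j,\sigma}$, $C'=CT$ for all $\sigma,j$. The *forward innovation* of $y$ is $e(t)=y(t)-E_l[y(t)\mid\{z_w(t):w\ne\epsilon\}]$. **Theorem.** Let $y$ be an $\mathbb R^d$-valued process. 1. $y$ has a JMLSIID realization if and only if (i) $\{y,\,z_w: w\ne\epsilon\}$ is square integrable, zero-mean and jointly wide-sense stationary; (ii) $y$ is non-anticipative, that is, past outputs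 together with past discrete states are independent of the present and future discrete states; (iii) $\Psi_y$ is rational and square summable. 2. Assume (i)–(iii). Then $\Psi_y$ has a minimal representation $R$ whose observability matrix $O_R$ (stacking $CA_{\sigma_k}\cdots A_{\sigma_1}$ over all words of length $\le n-1$) has a left inverse, and for every such $R=(\{A_\sigma\},\{B_{j,\sigma}\},C)$, of dimension $n$, and every left inverse $O_R^{-1}$ there are matrices $K_\sigma$ such that $$x(t+1)=\sum_\sigma\Bigl(\tfrac1{\sqrt{p_\sigma}}A_\sigma x(t)+K_\sigma e(t)\Bigr)u_\sigma(t),\qquad y(t)=Cx(t)+e(t),$$ with $x(t)=E_l[O_R^{-1}Y_n(t)\mid\{z_w(t):w\neq\epsilon\}]$, $Y_n(t)$ stacking $y(t+|w|)u_w(t+|w|-1)/\sqrt{p_w}$ over $|w|\le n-1$, is a minimal JMLSIID realization of $y$. With $P_\sigma=E[x(t)x(t)^Tu_\sigma(t)^2]$, $T_{\sigma,\sigma}=E[z_\sigma(t)z_\sigma(t)^T]$ and $B_\sigma=[B_{1,\sigma},\dots,B_{d,\sigma}]$, the $K_\sigma$ satisfy $K_\sigma(p_\sigma T_{\sigma,\sigma}-CP_\sigma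 C^T)=\sqrt{p_\sigma}B_\sigma-\tfrac1{\sqrt{p_\sigma}}A_\sigma P_\sigma C^T$, where $p_\sigma T_{\sigma,\sigma}-CP_\sigma C^T$ is invertible for all $\sigma$ if all the matrices $E[e(t)e(t)^Tu_\sigma(t)^2]$ have rank $d$. This realization is in forward innovation form: its noise is $e$, $D=I$, and moreover $e$ has the recursive covariance property, i.e. $\{z^e_w\}_{w}$ (including $z^e_\epsilon=e$) is zero-mean jointly wide-sense stationary and, for nonempty $w,w'$ and $\sigma,\sigma'\in\Sigma$, $E[z^e_{\sigma}(z^e_{\sigma'})^T]=0$ if $\sigma\ne\sigma'$, $E[z^e_{w\sigma}(z^e_{w'\sigma'})^T]$ equals $E[z^e_w(z^e_{w'})^T]$ if $\sigma=\sigma'$ and $0$ otherwise, and $E[z^e_{w\sigma}(z^e_{\sigma'})^T]$ equals $E[z^e_w e^T]$ if $\sigma=\sigma'$ and $0$ otherwise; and $E[z^e_w(t)z^e_{w'}(t)^T]=0$ for all nonempty $w\ne w'$. 3. For every JMLSIID realization $\mathrm B$ of $y$ the equations $P_\sigma=p_\sigma\sum_{\tau\in\Sigma}(A_\tau P_\tau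 A_\tau^T+K_\tau Q_\tau K_\tau^T)$, $\sigma\in\Sigma$, with $Q_\tau=E[v(t)v(t)^Tu_\tau(t)^2]$, have a unique solution $\{P_\sigma\}$. Let $R_{\mathrm B}=(\{\sqrt{p_\sigma}A_\sigma\},\{B_{j,\sigma}\},C)$, $B_{j,\sigma}$ being the $j$th column of $\tfrac1{\sqrt{p_\sigma}}(A_\sigma P_\sigma C^T+K_\sigma Q_\sigma D^T)$. Then $\mathrm B$ is a minimal JMLSIID realization of $y$ if and only if $R_{\mathrm B}$ is a minimal representation of $\Psi_y$. If $\mathrm B_1$ and $\mathrm B_2$ are minimal JMLSIID realizations of $y$, then $R_{\mathrm B_1}$ and $R_{\mathrm B_2}$ are isomorphic. -/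

import Mathlib

open MeasureTheory ProbabilityTheory Matrix
open scoped Kronecker

noncomputable section

namespace JumpLinear

/-! ### Rational families of formal power series

Words over the finite alphabet `S` are lists; a family of formal power series with coefficients
in `ℝ^d`, indexed by `J`, is a map `J → List S → Fin d → ℝ`. -/

/-- `A_w = A_{σ_k} ⋯ A_{σ_1}` for `w = σ_1 ⋯ σ_k`, and `A_ε = 1`. -/
def wordProd {S : Type*} {n : ℕ} (A : S → Matrix (Fin n) (Fin n) ℝ) (w : List S) :
    Matrix (Fin n) (Fin n) ℝ :=
  w.foldl (fun M σ => A σ * M) 1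

/-- The data `(ℝ^n, {A_σ}, {B_j}, C)` of a representation of dimension `n`. -/
structure Rep (S J : Type*) (d n : ℕ) where
  A : S → Matrix (Fin n) (Fin n) ℝ
  B : J → Fin n → ℝ
  C : Matrix (Fin d) (Fin n) ℝ

/-- `R` is a representation of the family `Ψ`: `Ψ_j(w) = C A_w B_j`. -/
def Rep.Represents {S J : Type*} {d n : ℕ} (R : Rep S J d n) (Ψ : J → List S → Fin d → ℝ) : Prop :=
  ∀ j w, Ψ j w = (R.C * wordProd R.A w) *ᵥ R.B j

/-- `R` is a representation of `Ψ` of the smallest possible dimension. -/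
def Rep.IsMinimal {S J : Type*} {d n : ℕ} (R : Rep S J d n) (Ψ : J → List S → Fin d → ℝ) : Prop :=
  R.Represents Ψ ∧ ∀ (n' : ℕ) (R' : Rep S J d n'), R'.Represents Ψ → n ≤ n'

/-- Isomorphism of representations: a nonsingular `T` (with inverse `T'`) such that
`T A'_σ = A_σ T`, `T B'_j = B_j` and `C' = C T`. (Its existence forces `n = n'`.) -/
def Rep.Isomorphic {S J : Type*} {d n n' : ℕ} (R : Rep S J d n) (R' : Rep S J d n') : Prop :=
  ∃ (T : Matrix (Fin n) (Fin n') ℝ) (T' : Matrix (Fin n') (Fin n) ℝ),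
    T * T' = 1 ∧ T' * T = 1 ∧
    (∀ σ, T * R'.A σ = R.A σ * T) ∧ (∀ j, T *ᵥ R'.B j = R.B j) ∧ R'.C = R.C * T

/-- The family has a finite-dimensional representation. -/
def IsRational {S J : Type*} {d : ℕ} (Ψ : J → List S → Fin d → ℝ) : Prop :=
  ∃ (n : ℕ) (R : Rep S J d n), R.Represents Ψ

/-- `∑_w ‖Ψ_j(w)‖² < ∞` for every `j`. -/
def IsSquareSummable {S J : Type*} {d : ℕ} (Ψ : J → List S → Fin d → ℝ) : Prop :=
  ∀ j, Summable fun w : List S => ∑ i, Ψ j w i ^ 2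

/-- Index set of the words of length at most `n - 1`. -/
abbrev ShortWord (S : Type*) (n : ℕ) := Σ k : Fin n, (Fin k → S)

/-- The observability matrix `O_R`, stacking `C A_w` over the words `w` with `|w| ≤ n - 1`. -/
def Rep.obs {S J : Type*} {d n : ℕ} (R : Rep S J d n) :
    Matrix (ShortWord S n × Fin d) (Fin n) ℝ :=
  Matrix.of fun a j => (R.C * wordProd R.A (List.ofFn a.1.2)) a.2 j

/-- All complex eigenvalues lie in the open unit disk. -/
def IsStable {ι : Type*} [Fintype ι] [DecidableEq ι] (M : Matrix ι ι ℝ) : Prop :=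
  ∀ μ : ℂ, μ ∈ spectrum ℂ (M.map (algebraMap ℝ ℂ)) → ‖μ‖ < 1

section Processes

variable {Ω : Type*} [MeasurableSpace Ω] (P : Measure Ω) {S : Type*}

/-! ### Second-order notions -/

/-- `E[f gᵀ]`. -/
def cov {a b : ℕ} (f : Ω → Fin a → ℝ) (g : Ω → Fin b → ℝ) : Matrix (Fin a) (Fin b) ℝ :=
  Matrix.of fun i j => ∫ ω, f ω i * g ω j ∂P

/-- The family `(r_i)` of square integrable vector processes is zero-mean and jointly wide-sense
stationary. -/
structure IsZeroMeanWSS {ι : Type*} {a : ℕ} (r : ι → ℤ → Ω → Fin a → ℝ) : Prop where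
  memLp : ∀ i t c, MemLp (fun ω => r i t ω c) 2 P
  mean_zero : ∀ i t c, ∫ ω, r i t ω c ∂P = 0
  cov_shift : ∀ i j s t k, cov P (r i (t + k)) (r j (s + k)) = cov P (r i t) (r j s)

/-- The coordinates of the random vectors in a family. -/
def coords {ι : Type*} {a : ℕ} (f : ι → Ω → Fin a → ℝ) : Set (Ω → ℝ) :=
  {h | ∃ i c, h = fun ω => f i ω c}

/-- The closed subspace of `L²(P)` generated by a set of square integrable random variables. -/
def hilbertSpan (G : Set (Ω → ℝ)) : Submodule ℝ (Lp ℝ 2 P) :=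
  (Submodule.span ℝ {g : Lp ℝ 2 P | ∃ h ∈ G, g =ᵐ[P] h}).topologicalClosure

/-- The random variable `f` belongs to the Hilbert space generated by `G`. -/
def InHilbertSpan (G : Set (Ω → ℝ)) (f : Ω → ℝ) : Prop :=
  ∃ g ∈ hilbertSpan P G, g =ᵐ[P] f

instance (G : Set (Ω → ℝ)) : CompleteSpace (hilbertSpan P G) :=
  Submodule.topologicalClosure.completeSpace _

open Classical in
/-- The orthogonal projection `E_l[f | G]` of a square integrable `f` onto the Hilbert space
generated by `G` (only used for square integrable `f`). -/
def linProj (G : Set (Ω → ℝ)) (f : Ω → ℝ) : Ω → ℝ :=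
  if hf : MemLp f 2 P then ((hilbertSpan P G).starProjection (hf.toLp f) : Lp ℝ 2 P) else 0

/-! ### Products with the inputs -/

/-- `u_w(t) = u_{σ_1}(t-k+1) u_{σ_2}(t-k+2) ⋯ u_{σ_k}(t)` for `w = σ_1 ⋯ σ_k`; `u_ε = 1`. -/
def inputWord (u : S → ℤ → Ω → ℝ) (w : List S) (t : ℤ) (ω : Ω) : ℝ :=
  ∏ i : Fin w.length, u (w.get i) (t - w.length + 1 + ((i : ℕ) : ℤ)) ω

/-- `p_w = p_{σ_1} ⋯ p_{σ_k}`. -/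
def weight (p : S → ℝ) (w : List S) : ℝ := (w.map p).prod

/-- `z^r_w(t) = r(t-|w|) u_w(t-1) / √p_w`; in particular `z^r_ε = r`. -/
def zPast (u : S → ℤ → Ω → ℝ) (p : S → ℝ) {a : ℕ} (r : ℤ → Ω → Fin a → ℝ) (w : List S) (t : ℤ)
    (ω : Ω) : Fin a → ℝ :=
  (inputWord u w (t - 1) ω / √(weight p w)) • r (t - w.length) ω

/-- `z^f_w(t) = y(t+|w|) u_w(t+|w|-1) / √p_w`; in particular `z^f_ε = y`. -/
def zFuture (u : S → ℤ → Ω → ℝ) (p : S → ℝ) {a : ℕ} (y : ℤ → Ω → Fin a → ℝ) (w : List S) (t : ℤ)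
    (ω : Ω) : Fin a → ℝ :=
  (inputWord u w (t + w.length - 1) ω / √(weight p w)) • y (t + w.length) ω

/-- The coordinates of `z^r_w(t)`, over all nonempty words `w`. -/
def pastVars (u : S → ℤ → Ω → ℝ) (p : S → ℝ) {a : ℕ} (r : ℤ → Ω → Fin a → ℝ) (t : ℤ) :
    Set (Ω → ℝ) :=
  coords fun (w : {w : List S // w ≠ []}) => zPast u p r w.1 t

/-- The family `Ψ_y = {S_{(j,σ)}}`: `S_{(j,σ)}(w)` is the `j`th column of `E[y(t) z_{σw}(t)ᵀ]`
(independent of `t` for the processes of interest, hence taken at `t = 0`). -/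
def outputSeries (u : S → ℤ → Ω → ℝ) (p : S → ℝ) {d : ℕ} (y : ℤ → Ω → Fin d → ℝ) :
    Fin d × S → List S → Fin d → ℝ :=
  fun j w i => cov P (y 0) (zPast u p y (j.2 :: w) 0) i j.1

/-- The forward innovation `e(t) = y(t) - E_l[y(t) | {z_w(t) : w ≠ ε}]`. -/
def innovation (u : S → ℤ → Ω → ℝ) (p : S → ℝ) {d : ℕ} (y : ℤ → Ω → Fin d → ℝ) (t : ℤ) (ω : Ω) :
    Fin d → ℝ :=
  fun i => y t ω i - linProj P (pastVars u p y t) (fun ω' => y t ω' i) ω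

/-- `E[r(t) r(t)ᵀ u_σ(t)²]`, at `t = 0` (independent of `t` for the processes of interest). -/
def inputCov (u : S → ℤ → Ω → ℝ) {a : ℕ} (r : ℤ → Ω → Fin a → ℝ) (σ : S) :
    Matrix (Fin a) (Fin a) ℝ :=
  cov P (fun ω => u σ 0 ω • r 0 ω) (fun ω => u σ 0 ω • r 0 ω)

/-! ### Generalized bilinear systems -/

/-- The data of a generalized bilinear system with state dimension `n`, noise dimension `m` and
output dimension `d`: matrices, state process `x` and noise process `v`. -/
structure GBS (Ω S : Type*) (n m d : ℕ) where
  A : S → Matrix (Fin n) (Fin n) ℝ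
  K : S → Matrix (Fin n) (Fin m) ℝ
  C : Matrix (Fin d) (Fin n) ℝ
  D : Matrix (Fin d) (Fin m) ℝ
  x : ℤ → Ω → Fin n → ℝ
  v : ℤ → Ω → Fin m → ℝ

variable [Fintype S]

/-- The system with inputs `u` is a realization of `y`: almost surely, for all `t`,
`x(t+1) = ∑_σ (A_σ x(t) + K_σ v(t)) u_σ(t)` and `y(t) = C x(t) + D v(t)`. -/
structure GBS.Realizes {n m d : ℕ} (B : GBS Ω S n m d) (u : S → ℤ → Ω → ℝ)
    (y : ℤ → Ω → Fin d → ℝ) : Prop where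
  state_eq : ∀ t, ∀ᵐ ω ∂P, B.x (t + 1) ω = ∑ σ, u σ t ω • (B.A σ *ᵥ B.x t ω + B.K σ *ᵥ B.v t ω)
  output_eq : ∀ t, ∀ᵐ ω ∂P, y t ω = B.C *ᵥ B.x t ω + B.D *ᵥ B.v t ω

/-- The recursive covariance property, when all nonempty words are admissible. Here
`T_{w,v} = E[z_w(t) z_v(t)ᵀ]` and `Λ_w = E[r(t) z_w(t)ᵀ]`. -/
structure IsRC (u : S → ℤ → Ω → ℝ) (p : S → ℝ) {a : ℕ} (r : ℤ → Ω → Fin a → ℝ) : Prop where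
  wss : IsZeroMeanWSS P (zPast u p r)
  letters : ∀ t σ σ', σ ≠ σ' → cov P (zPast u p r [σ] t) (zPast u p r [σ'] t) = 0
  rec_same : ∀ t w v σ, w ≠ [] → v ≠ [] →
    cov P (zPast u p r (w ++ [σ]) t) (zPast u p r (v ++ [σ]) t)
      = cov P (zPast u p r w t) (zPast u p r v t)
  rec_ne : ∀ t w v σ σ', w ≠ [] → v ≠ [] → σ ≠ σ' →
    cov P (zPast u p r (w ++ [σ]) t) (zPast u p r (v ++ [σ']) t) = 0
  letter_same : ∀ t w σ, w ≠ [] →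
    cov P (zPast u p r (w ++ [σ]) t) (zPast u p r [σ] t) = (cov P (r t) (zPast u p r w t))ᵀ
  letter_ne : ∀ t w σ σ', w ≠ [] → σ ≠ σ' →
    cov P (zPast u p r (w ++ [σ]) t) (zPast u p r [σ'] t) = 0

/-- The regularity conditions on a generalized bilinear system, when all nonempty words are
admissible (the condition on the matrices at inadmissible words is then void). -/
structure GBS.IsRegular {n m d : ℕ} (B : GBS Ω S n m d) (u : S → ℤ → Ω → ℝ) (p : S → ℝ) :
    Prop where
  noise_rc : IsRC P u p B.v
  noise_orth : ∀ t w w', w ≠ [] → w' ≠ [] → w ≠ w' →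
    cov P (zPast u p B.v w t) (zPast u p B.v w' t) = 0
  state_mem : ∀ t i, InHilbertSpan P (pastVars u p B.v t) (fun ω => B.x t ω i)
  stable : IsStable (∑ σ, p σ • ((B.A σ)ᵀ ⊗ₖ (B.A σ)ᵀ))

/-- Forward innovation form: `D = I`, the noise is the forward innovation of `y`, and the
regularity conditions hold. -/
structure GBS.IsForwardInnovation {n d : ℕ} (B : GBS Ω S n d d) (u : S → ℤ → Ω → ℝ) (p : S → ℝ)
    (y : ℤ → Ω → Fin d → ℝ) : Prop where
  D_eq : B.D = 1
  noise_eq : ∀ t, B.v t =ᵐ[P] innovation P u p y t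
  regular : B.IsRegular P u p

/-- The equations `P_σ = p_σ ∑_τ (A_τ P_τ A_τᵀ + K_τ Q_τ K_τᵀ)`, `Q_τ = E[v vᵀ u_τ²]`, for the
unknown family of matrices `(P_σ)`. -/
def GBS.Lyapunov {n m d : ℕ} (B : GBS Ω S n m d) (u : S → ℤ → Ω → ℝ) (p : S → ℝ)
    (X : S → Matrix (Fin n) (Fin n) ℝ) : Prop :=
  ∀ σ, X σ = p σ • ∑ τ, (B.A τ * X τ * (B.A τ)ᵀ + B.K τ * inputCov P u B.v τ * (B.K τ)ᵀ)

/-- The representation `R_B = (ℝ^n, {√p_σ A_σ}, {B_{σ,j}}, C)` associated with a system and a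
solution `(P_σ)` of its Lyapunov equations: `B_{σ,j}` is the `j`th column of
`(A_σ P_σ Cᵀ + K_σ Q_σ Dᵀ) / √p_σ`. -/
def GBS.rep {n m d : ℕ} (B : GBS Ω S n m d) (u : S → ℤ → Ω → ℝ) (p : S → ℝ)
    (X : S → Matrix (Fin n) (Fin n) ℝ) : Rep S (Fin d × S) d n where
  A σ := √(p σ) • B.A σ
  B j i := ((1 / √(p j.2)) •
    (B.A j.2 * X j.2 * B.Cᵀ + B.K j.2 * inputCov P u B.v j.2 * B.Dᵀ)) i j.1
  C := B.C

/-! ### Jump-Markov linear systems with i.i.d. switching -/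

/-- The σ-algebra generated by `f(t)`, `t ∈ I`. -/
@[reducible] def sigmaGen {X : Type*} [MeasurableSpace X] (f : ℤ → Ω → X) (I : Set ℤ) : MeasurableSpace Ω :=
  ⨆ t ∈ I, MeasurableSpace.comap (f t) inferInstance

/-- For all `t`, the σ-algebra generated by `r(s)`, `s ≤ t`, and `θ(s)`, `s < t`, is independent of
the one generated by `θ(s)`, `s ≥ t`. -/
def IndepOfFuture [MeasurableSpace S] {a : ℕ} (θ : ℤ → Ω → S) (r : ℤ → Ω → Fin a → ℝ) : Prop :=
  ∀ t, Indep (sigmaGen r (Set.Iic t) ⊔ sigmaGen θ (Set.Iio t)) (sigmaGen θ (Set.Ici t)) P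

open Classical in
/-- The inputs `u_σ(t) = χ(θ(t) = σ)`. -/
def switch (θ : ℤ → Ω → S) (σ : S) (t : ℤ) (ω : Ω) : ℝ := if θ t ω = σ then 1 else 0

/-- `B` is a jump-Markov linear system with switching process `θ` (assumed i.i.d. with
`P(θ(t) = σ) = p_σ` elsewhere): a system with inputs `χ(θ(t) = σ)` whose noise is a zero-mean
wide-sense stationary coloured noise, such that past noise and past switching are independent of
future switching, and whose state is the stable stationary one driven by the noise. -/
structure GBS.IsJMLSIID [MeasurableSpace S] {n m d : ℕ} (B : GBS Ω S n m d) (θ : ℤ → Ω → S)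
    (p : S → ℝ) : Prop where
  state_meas : ∀ t, Measurable (B.x t)
  noise_meas : ∀ t, Measurable (B.v t)
  noise_wss : IsZeroMeanWSS P (fun _ : Unit => B.v)
  noise_white : ∀ t l (w : List S), t < l → (w.length : ℤ) = l - t →
    cov P (fun ω => inputWord (switch θ) w (l - 1) ω • B.v t ω) (B.v l) = 0
  noise_indep : IndepOfFuture P θ B.v
  state_mem : ∀ t i, InHilbertSpan P (pastVars (switch θ) p B.v t) (fun ω => B.x t ω i)
  stable : IsStable (∑ σ, p σ • ((B.A σ)ᵀ ⊗ₖ (B.A σ)ᵀ))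

/-- `B` is a realization of `y` by a jump-Markov linear system with i.i.d. switching. -/
def GBS.IsJMLSIIDRealization [MeasurableSpace S] {n m d : ℕ} (B : GBS Ω S n m d)
    (θ : ℤ → Ω → S) (p : S → ℝ) (y : ℤ → Ω → Fin d → ℝ) : Prop :=
  B.IsJMLSIID P θ p ∧ B.Realizes P (switch θ) y

/-- `B` is such a realization, of the smallest dimension among all of them. -/
def GBS.IsMinimalJMLSIID [MeasurableSpace S] {n m d : ℕ} (B : GBS Ω S n m d)
    (θ : ℤ → Ω → S) (p : S → ℝ) (y : ℤ → Ω → Fin d → ℝ) : Prop :=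
  B.IsJMLSIIDRealization P θ p y ∧
    ∀ (n' m' : ℕ) (B' : GBS Ω S n' m' d), B'.IsJMLSIIDRealization P θ p y → n ≤ n'

/-- The realizability conditions: `{y, z_w : w ≠ ε}` (this is `{z_w : w}` as `z_ε = y`) is zero-mean
jointly wide-sense stationary; past outputs and past switching are independent of future switching;
`Ψ_y` is rational and square summable. -/
structure RealizabilityConditions [MeasurableSpace S] (θ : ℤ → Ω → S) (p : S → ℝ) {d : ℕ}
    (y : ℤ → Ω → Fin d → ℝ) : Prop where
  wss : IsZeroMeanWSS P (zPast (switch θ) p y)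
  indep : IndepOfFuture P θ y
  rational : IsRational (outputSeries P (switch θ) p y)
  squareSummable : IsSquareSummable (outputSeries P (switch θ) p y)

/-- The matrix `p_σ T_{σ,σ} - C P_σ Cᵀ` with `T_{σ,σ} = E[z_σ z_σᵀ]` and `P_σ = E[x xᵀ u_σ²]`. -/
def GBS.gainDenom {n m d : ℕ} (B : GBS Ω S n m d) (u : S → ℤ → Ω → ℝ) (p : S → ℝ)
    (y : ℤ → Ω → Fin d → ℝ) (σ : S) : Matrix (Fin d) (Fin d) ℝ :=
  p σ • cov P (zPast u p y [σ] 0) (zPast u p y [σ] 0) - B.C * inputCov P u B.x σ * B.Cᵀ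

/-- The system is the one built from the representation `R` of `Ψ_y` and a left inverse `Oinv` of
its observability matrix: matrices `A_σ/√p_σ` and `C`; state
`x(t) = E_l[Oinv Y_n(t) | {z_w(t) : w ≠ ε}]`, where `Y_n(t)` stacks `z^f_w(t)`, `|w| ≤ n - 1`; gains
with `K_σ (p_σ T_{σ,σ} - C P_σ Cᵀ) = √p_σ B_σ - A_σ P_σ Cᵀ/√p_σ`, the matrix
`p_σ T_{σ,σ} - C P_σ Cᵀ` being invertible when `y` is full rank. -/
structure GBS.IsBuiltFrom {n d : ℕ} (B : GBS Ω S n d d) (u : S → ℤ → Ω → ℝ) (p : S → ℝ)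
    (y : ℤ → Ω → Fin d → ℝ) (R : Rep S (Fin d × S) d n)
    (Oinv : Matrix (Fin n) (ShortWord S n × Fin d) ℝ) : Prop where
  A_eq : ∀ σ, B.A σ = (1 / √(p σ)) • R.A σ
  C_eq : B.C = R.C
  state_eq : ∀ t i, (fun ω => B.x t ω i) =ᵐ[P] linProj P (pastVars u p y t)
    (fun ω => (Oinv *ᵥ fun a => zFuture u p y (List.ofFn a.1.2) t ω a.2) i)
  gain_eq : ∀ σ, B.K σ * B.gainDenom P u p y σ
    = √(p σ) • (Matrix.of fun i j => R.B (j, σ) i)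
      - (1 / √(p σ)) • (R.A σ * inputCov P u B.x σ * B.Cᵀ)
  fullRank : (∀ σ, (inputCov P u (innovation P u p y) σ).rank = d) →
    ∀ σ, IsUnit (B.gainDenom P u p y σ)

end Processes

end JumpLinear

end

open MeasureTheory ProbabilityTheory Matrix
open scoped Kronecker

noncomputable section

namespace JumpLinear

/-! ### Minimal representations -/

section Representations

variable {S J : Type*} {d n n' : ℕ}

/-! Everything rests on the operators of multiplication by `u_σ(t)/√p_σ` on `L²(P)`. Variables
measurable with respect to the past are independent of `θ(t)`, so on them each operator is an
isometry. Different letters have orthogonal ranges because `u_σ u_τ = 0`, and the operators weighted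
by `√p_σ` sum to the identity because `∑ u_σ = 1`. `ShiftSystem` records just these facts, and
`IsSwitching.shiftSystem` provides them. The problem becomes linear stochastic realization in a
Hilbert space, with `√p_σ A_σ` as transition matrices.

Algebra. The observability map of a representation sends `A_v B_j` to a column of the Hankel matrix,
so the smallest dimension is the Hankel rank. A minimal representation is a choice of coordinates on
the Hankel space, whence uniqueness up to isomorphism. Stability of `∑ A_σᵀ ⊗ A_σᵀ` means that the
entries of `A_w` are square summable over all words. It therefore makes `Ψ_y` square summable, and
conversely it follows from square summability when the representation is minimal
(`Rep.IsMinimal.isStable`).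

From a realization to the conditions. The noise is white and the state lies in its past, so the
state covariance is constant and solves a Lyapunov equation with only one solution. Peeling letters
off a word gives `E[y z_{σw}ᵀ] = C A_w B_σ`, so `R_B` represents `Ψ_y` in the dimension of the
system.

From the conditions to a realization. Projecting `O_R⁻¹ Y_n(t)` on the past of `y` gives a state `x`
with `E[x z_{σw}ᵀ] = A_w B_σ`. Then `e = y - C x` is the innovation, and the state equation holds
because both sides lie in the past of `y` and have the same covariances with it. The delicate point
is that `x` lies in the past of `e` alone (`ShiftSystem.IsStateFor.mem_pastSpan_innov`): its
projection there obeys the same state equation, so both covariances solve the same Lyapunov equation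
and no norm is lost in projecting.

The two passages preserve dimension, so minimality on one side is minimality on the other. -/

theorem wordProd_eq_foldr (A : S → Matrix (Fin n) (Fin n) ℝ) (w : List S)
    (M : Matrix (Fin n) (Fin n) ℝ) :
    w.foldl (fun M σ => A σ * M) M = wordProd A w * M := by
  induction w generalizing M with
  | nil => simp [wordProd]
  | cons σ w ih =>
    have h1 := ih (A σ * M)
    have h2 := ih (A σ * 1)
    simp only [wordProd, List.foldl_cons] at h1 h2 ⊢
    rw [h1, h2]
    simp [Matrix.mul_assoc]

@[simp] theorem wordProd_nil (A : S → Matrix (Fin n) (Fin n) ℝ) : wordProd A [] = 1 := rfl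

theorem wordProd_append (A : S → Matrix (Fin n) (Fin n) ℝ) (v w : List S) :
    wordProd A (v ++ w) = wordProd A w * wordProd A v := by
  rw [wordProd, List.foldl_append, wordProd_eq_foldr]
  rfl

theorem wordProd_cons (A : S → Matrix (Fin n) (Fin n) ℝ) (σ : S) (w : List S) :
    wordProd A (σ :: w) = wordProd A w * A σ := by
  have h := wordProd_append A [σ] w
  have h1 : wordProd A [σ] = A σ := by simp [wordProd]
  rwa [h1] at h

theorem wordProd_snoc (A : S → Matrix (Fin n) (Fin n) ℝ) (w : List S) (σ : S) :
    wordProd A (w ++ [σ]) = A σ * wordProd A w := by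
  rw [wordProd_append]
  simp [wordProd]

/-- The observability map `x ↦ (w ↦ C A_w x)`. -/
def Rep.obsMap (R : Rep S J d n) : (Fin n → ℝ) →ₗ[ℝ] (List S → Fin d → ℝ) where
  toFun x w := (R.C * wordProd R.A w) *ᵥ x
  map_add' x y := by ext; simp [Matrix.mulVec_add]
  map_smul' c x := by ext; simp [Matrix.mulVec_smul]

theorem Rep.obsMap_apply (R : Rep S J d n) (x : Fin n → ℝ) (w : List S) :
    R.obsMap x w = (R.C * wordProd R.A w) *ᵥ x := rfl

theorem Rep.obsMap_wordProd (R : Rep S J d n) (x : Fin n → ℝ) (v w : List S) :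
    R.obsMap (wordProd R.A v *ᵥ x) w = R.obsMap x (v ++ w) := by
  simp only [obsMap_apply, wordProd_append, Matrix.mulVec_mulVec, Matrix.mul_assoc]

theorem Rep.obsMap_A (R : Rep S J d n) (x : Fin n → ℝ) (σ : S) (w : List S) :
    R.obsMap (R.A σ *ᵥ x) w = R.obsMap x (σ :: w) := by
  simp only [obsMap_apply, wordProd_cons, Matrix.mulVec_mulVec, Matrix.mul_assoc]

/-- The column space of the Hankel matrix of a family of formal power series. -/
def hankel (Ψ : J → List S → Fin d → ℝ) : Submodule ℝ (List S → Fin d → ℝ) :=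
  Submodule.span ℝ (Set.range fun a : J × List S => fun w => Ψ a.1 (a.2 ++ w))

theorem Rep.Represents.obsMap_eq {R : Rep S J d n} {Ψ : J → List S → Fin d → ℝ}
    (h : R.Represents Ψ) (j : J) (v : List S) :
    R.obsMap (wordProd R.A v *ᵥ R.B j) = fun w => Ψ j (v ++ w) := by
  ext w : 1
  rw [Rep.obsMap_wordProd, h, Rep.obsMap_apply]

/-- A Hankel column is the image of the reachable vector `A_v B_j`. This bounds the dimension of any
representation below by the Hankel rank. -/
theorem Rep.Represents.hankel_le {R : Rep S J d n} {Ψ : J → List S → Fin d → ℝ}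
    (h : R.Represents Ψ) : hankel Ψ ≤ LinearMap.range R.obsMap := by
  rw [hankel, Submodule.span_le]
  rintro _ ⟨⟨j, v⟩, rfl⟩
  exact ⟨_, h.obsMap_eq j v⟩

/-- The shift of a formal power series by one letter. -/
def seriesShift (S : Type*) (d : ℕ) (σ : S) :
    (List S → Fin d → ℝ) →ₗ[ℝ] (List S → Fin d → ℝ) where
  toFun f w := f (σ :: w)
  map_add' _ _ := rfl
  map_smul' _ _ := rfl

theorem seriesShift_mem_hankel {Ψ : J → List S → Fin d → ℝ} (σ : S) {f : List S → Fin d → ℝ}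
    (hf : f ∈ hankel Ψ) : seriesShift S d σ f ∈ hankel Ψ := by
  have : hankel Ψ ≤ (hankel Ψ).comap (seriesShift S d σ) := by
    conv_lhs => rw [hankel]
    rw [Submodule.span_le]
    rintro _ ⟨⟨j, v⟩, rfl⟩
    refine Submodule.subset_span ⟨(j, v ++ [σ]), ?_⟩
    ext w : 1
    simp [seriesShift]
  exact this hf

/-- A representation on an abstract finite-dimensional space gives one in coordinates. -/
theorem exists_rep_of_module {V : Type*} [AddCommGroup V] [Module ℝ V] [FiniteDimensional ℝ V]
    (A : S → V →ₗ[ℝ] V) (B : J → V) (C : V →ₗ[ℝ] (Fin d → ℝ)) :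
    ∃ R : Rep S J d (Module.finrank ℝ V), ∀ j w,
      (R.C * wordProd R.A w) *ᵥ R.B j = C (w.foldl (fun x σ => A σ x) (B j)) := by
  let b := Module.finBasis ℝ V
  let R : Rep S J d (Module.finrank ℝ V) :=
    ⟨fun σ => LinearMap.toMatrix b b (A σ), fun j => b.repr (B j),
      LinearMap.toMatrix b (Pi.basisFun ℝ (Fin d)) C⟩
  have key : ∀ (w : List S) (x : V),
      wordProd R.A w *ᵥ b.repr x = b.repr (w.foldl (fun x σ => A σ x) x) := by
    intro w
    induction w with
    | nil => simp
    | cons σ w ih =>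
      intro x
      rw [wordProd_cons, ← Matrix.mulVec_mulVec, List.foldl_cons, ← ih]
      congr 1
      exact LinearMap.toMatrix_mulVec_repr b b (A σ) x
  refine ⟨R, fun j w => ?_⟩
  rw [← Matrix.mulVec_mulVec, key]
  have := LinearMap.toMatrix_mulVec_repr b (Pi.basisFun ℝ (Fin d)) C
    (w.foldl (fun x σ => A σ x) (B j))
  rw [this]
  ext i
  simp

/-- The Hankel space serves as its own state space: letters act by the shift, the input vectors are
the series `Ψ_j`, and the output is evaluation at the empty word. The Hankel rank is thus attained.
-/
theorem exists_rep_finrank_hankel (Ψ : J → List S → Fin d → ℝ)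
    [FiniteDimensional ℝ (hankel Ψ)] :
    ∃ R : Rep S J d (Module.finrank ℝ (hankel Ψ)), R.Represents Ψ := by
  have hΨ : ∀ j, Ψ j ∈ hankel Ψ := fun j => Submodule.subset_span ⟨(j, []), rfl⟩
  let A : S → hankel Ψ →ₗ[ℝ] hankel Ψ := fun σ =>
    (seriesShift S d σ).restrict fun f hf => seriesShift_mem_hankel σ hf
  obtain ⟨R, hR⟩ := exists_rep_of_module A (fun j => ⟨Ψ j, hΨ j⟩)
    ((LinearMap.proj ([] : List S)).comp (hankel Ψ).subtype)
  refine ⟨R, fun j w => ?_⟩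
  rw [hR]
  have key : ∀ (w v : List S) (f : hankel Ψ),
      ((w.foldl (fun x σ => A σ x) f : hankel Ψ) : List S → Fin d → ℝ) v
        = (f : List S → Fin d → ℝ) (w ++ v) := by
    intro w
    induction w with
    | nil => simp
    | cons σ w ih =>
      intro v f
      rw [List.foldl_cons, ih]
      rfl
  simpa using (key w [] ⟨Ψ j, hΨ j⟩).symm

theorem Rep.Represents.finiteDimensional_hankel {R : Rep S J d n} {Ψ : J → List S → Fin d → ℝ}
    (h : R.Represents Ψ) : FiniteDimensional ℝ (hankel Ψ) :=
  Submodule.finiteDimensional_of_le h.hankel_le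

/-- The chain `n ≤ dim hankel ≤ dim range ≤ n` consists of equalities, and rank-nullity leaves no
kernel. -/
theorem Rep.IsMinimal.obsMap_injective_and_range {R : Rep S J d n} {Ψ : J → List S → Fin d → ℝ}
    (h : R.IsMinimal Ψ) :
    Function.Injective R.obsMap ∧ LinearMap.range R.obsMap = hankel Ψ := by
  have := h.1.finiteDimensional_hankel
  obtain ⟨R', hR'⟩ := exists_rep_finrank_hankel Ψ
  have h1 : n ≤ Module.finrank ℝ (hankel Ψ) := h.2 _ R' hR'
  have h2 := Submodule.finrank_mono h.1.hankel_le
  have h3 := LinearMap.finrank_range_add_finrank_ker R.obsMap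
  rw [Module.finrank_fin_fun] at h3
  refine ⟨?_, (Submodule.eq_of_le_of_finrank_le h.1.hankel_le (by omega)).symm⟩
  rw [← LinearMap.ker_eq_bot]
  exact Submodule.finrank_eq_zero.1 (by omega)

/-- Both observability maps are isomorphisms onto the Hankel space. The change of basis is one
followed by the inverse of the other, and the required identities can be tested after applying an
injective observability map. -/
theorem Rep.IsMinimal.isomorphic {R : Rep S J d n} {R' : Rep S J d n'}
    {Ψ : J → List S → Fin d → ℝ} (h : R.IsMinimal Ψ) (h' : R'.IsMinimal Ψ) :
    R.Isomorphic R' := by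
  obtain ⟨hinj, hrange⟩ := h.obsMap_injective_and_range
  obtain ⟨hinj', hrange'⟩ := h'.obsMap_injective_and_range
  let e : (Fin n' → ℝ) ≃ₗ[ℝ] (Fin n → ℝ) := (LinearEquiv.ofInjective R'.obsMap hinj').trans
    ((LinearEquiv.ofEq _ _ (hrange'.trans hrange.symm)).trans
      (LinearEquiv.ofInjective R.obsMap hinj).symm)
  have he : ∀ x, R.obsMap (e x) = R'.obsMap x := by
    intro x
    have := LinearEquiv.ofInjective_apply (f := R.obsMap) (h := hinj) (e x)
    rw [← this]
    simp [e]
  have hmul : ∀ x, LinearMap.toMatrix' (e : (Fin n' → ℝ) →ₗ[ℝ] (Fin n → ℝ)) *ᵥ x = e x := by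
    intro x
    rw [LinearMap.toMatrix'_mulVec]
    rfl
  refine ⟨LinearMap.toMatrix' e.toLinearMap, LinearMap.toMatrix' e.symm.toLinearMap, ?_, ?_,
    fun σ => ?_, fun j => ?_, ?_⟩
  · rw [← LinearMap.toMatrix'_comp]
    simp
  · rw [← LinearMap.toMatrix'_comp]
    simp
  · refine Matrix.ext_of_mulVec_single fun i => ?_
    rw [← Matrix.mulVec_mulVec, ← Matrix.mulVec_mulVec, hmul, hmul]
    apply hinj
    ext w : 1
    rw [he, Rep.obsMap_A, Rep.obsMap_A, he]
  · rw [hmul]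
    apply hinj
    rw [he]
    have h1 := h.1.obsMap_eq j []
    have h2 := h'.1.obsMap_eq j []
    rw [wordProd_nil, Matrix.one_mulVec] at h1 h2
    rw [h1, h2]
  · refine Matrix.ext_of_mulVec_single fun i => ?_
    rw [← Matrix.mulVec_mulVec, hmul]
    have := congrFun (he (Pi.single i 1)) []
    simpa [Rep.obsMap_apply] using this.symm

/-- The vectors that cannot be distinguished from `0` by words of length less than `k`. -/
def Rep.unobs (R : Rep S J d n) (k : ℕ) : Submodule ℝ (Fin n → ℝ) where
  carrier := {x | ∀ w : List S, w.length < k → R.obsMap x w = 0}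
  add_mem' hx hy w hw := by simp [hx w hw, hy w hw]
  zero_mem' w _ := by simp
  smul_mem' c x hx w hw := by simp [hx w hw]

theorem Rep.mem_unobs {R : Rep S J d n} {k : ℕ} {x : Fin n → ℝ} :
    x ∈ R.unobs k ↔ ∀ w : List S, w.length < k → R.obsMap x w = 0 := Iff.rfl

theorem Rep.mem_unobs_succ {R : Rep S J d n} {k : ℕ} {x : Fin n → ℝ} :
    x ∈ R.unobs (k + 1) ↔ R.obsMap x [] = 0 ∧ ∀ σ, R.A σ *ᵥ x ∈ R.unobs k := by
  simp only [mem_unobs, obsMap_A]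
  constructor
  · intro h
    exact ⟨h [] (by simp), fun σ w hw => h (σ :: w) (by simpa using hw)⟩
  · rintro ⟨h0, h1⟩ (_ | ⟨σ, w⟩) hw
    · exact h0
    · exact h1 σ w (by simpa using hw)

theorem Rep.unobs_antitone (R : Rep S J d n) : Antitone R.unobs :=
  fun _ _ hkl _ hx w hw => hx w (hw.trans_le hkl)

/-- By `Rep.mem_unobs_succ` each term of the chain determines the next by a fixed rule, so the chain
is constant once it repeats. -/
theorem Rep.unobs_stable {R : Rep S J d n} {k : ℕ} (h : R.unobs k = R.unobs (k + 1)) (m : ℕ) :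
    R.unobs k = R.unobs (k + m) := by
  have hs : ∀ m, R.unobs (k + m) = R.unobs (k + m + 1) := by
    intro m
    induction m with
    | zero => exact h
    | succ m ih =>
      ext x
      rw [show k + (m + 1) = k + m + 1 by ring, mem_unobs_succ, mem_unobs_succ (k := k + m + 1),
        ← ih]
  induction m with
  | zero => rfl
  | succ m ih => rw [ih, hs m]; rfl

/-- Distinguishable states are distinguished by words of length at most `n - 1`. -/
theorem Rep.unobs_eq_bot {R : Rep S J d n} (h : Function.Injective R.obsMap) :
    R.unobs n = ⊥ := by
  -- Each strict inclusion costs a dimension, so before step `k` the chain has either lost `k`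
  -- dimensions or stalled.
  have key : ∀ k, (Module.finrank ℝ (R.unobs k) + k ≤ n) ∨
      ∃ j < k, R.unobs j = R.unobs (j + 1) := by
    intro k
    induction k with
    | zero =>
      left
      simpa using Submodule.finrank_le (R.unobs 0)
    | succ k ih =>
      rcases ih with ih | ⟨j, hj, hj'⟩
      · by_cases hk : R.unobs k = R.unobs (k + 1)
        · exact Or.inr ⟨k, by omega, hk⟩
        · left
          have := Submodule.finrank_lt_finrank_of_lt
            (lt_of_le_of_ne (R.unobs_antitone (Nat.le_succ k)) (Ne.symm hk))
          simp only [Nat.succ_eq_add_one] at this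
          omega
      · exact Or.inr ⟨j, by omega, hj'⟩
  rcases key n with hn | ⟨j, hj, hj'⟩
  · exact Submodule.finrank_eq_zero.1 (by omega)
  · rw [eq_bot_iff]
    intro x hx
    have hxj : x ∈ R.unobs j := by
      rw [unobs_stable hj' (n - j), Nat.add_sub_cancel' hj.le]
      exact hx
    apply h
    ext w : 1
    rw [unobs_stable hj' (w.length + 1)] at hxj
    rw [hxj w (by omega)]
    simp

/-- `M` factors through the quotient by `ker Q`, that is, through the range of `Q`; the factor is
then extended to the whole space. This yields the left inverse of the observability matrix, and also
the gains when the innovation covariance is singular. -/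
theorem exists_mul_eq_of_ker_le {a b c : Type*} [Fintype a] [Fintype b] [Fintype c]
    [DecidableEq a] [DecidableEq b] [DecidableEq c] (Q : Matrix a b ℝ) (M : Matrix c b ℝ)
    (h : ∀ x, Q *ᵥ x = 0 → M *ᵥ x = 0) : ∃ K : Matrix c a ℝ, K * Q = M := by
  let g := Q.mulVecLin
  obtain ⟨f, hf⟩ := LinearMap.exists_extend
    (((LinearMap.ker g).liftQ M.mulVecLin h).comp g.quotKerEquivRange.symm.toLinearMap)
  refine ⟨LinearMap.toMatrix' f, Matrix.ext_of_mulVec_single fun i => ?_⟩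
  rw [← Matrix.mulVec_mulVec, LinearMap.toMatrix'_mulVec]
  have h1 := LinearMap.congr_fun hf ⟨g (Pi.single i 1), ⟨_, rfl⟩⟩
  have h2 : g.quotKerEquivRange.symm ⟨g (Pi.single i 1), ⟨_, rfl⟩⟩
      = (LinearMap.ker g).mkQ (Pi.single i 1) :=
    g.quotKerEquivRange_symm_apply_image (Pi.single i 1) ⟨_, rfl⟩
  simp only [LinearMap.comp_apply, LinearEquiv.coe_coe, h2, Submodule.subtype_apply] at h1
  exact h1

theorem Rep.obs_mulVec [Fintype S] (R : Rep S J d n) (x : Fin n → ℝ) (a : ShortWord S n × Fin d) :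
    (R.obs *ᵥ x) a = R.obsMap x (List.ofFn a.1.2) a.2 := rfl

theorem Rep.exists_leftInverse_obs [Fintype S] {R : Rep S J d n}
    (h : Function.Injective R.obsMap) :
    ∃ Oinv : Matrix (Fin n) (ShortWord S n × Fin d) ℝ, Oinv * R.obs = 1 := by
  classical
  refine exists_mul_eq_of_ker_le _ _ fun x hx => ?_
  have : x ∈ R.unobs n := by
    intro w hw
    ext i
    have := congrFun hx (⟨⟨w.length, hw⟩, w.get⟩, i)
    rw [obs_mulVec] at this
    simpa using this
  rw [unobs_eq_bot h] at this
  rw [this, Matrix.mulVec_zero]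

theorem IsRational.exists_minimal {Ψ : J → List S → Fin d → ℝ} (h : IsRational Ψ) :
    ∃ (n : ℕ) (R : Rep S J d n), R.IsMinimal Ψ := by
  classical
  obtain ⟨R, hR⟩ := Nat.find_spec h
  exact ⟨_, R, hR, fun n' R' hR' => Nat.find_min' h ⟨R', hR'⟩⟩

end Representations

/-! ### Stability -/

section Stability

variable {ι : Type*} [Fintype ι] [DecidableEq ι]

/-- By Gelfand's formula the powers are eventually dominated by `r ^ k`, for any `r` strictly
between the spectral radius and `1`. The operator norm is the row-sum norm, which bounds every
entry. -/
theorem IsStable.summable_pow {M : Matrix ι ι ℝ} (h : IsStable M) (i j : ι) :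
    Summable fun k : ℕ => (M ^ k) i j := by
  let _ : NormedRing (Matrix ι ι ℂ) := Matrix.linftyOpNormedRing
  let _ : NormedAlgebra ℂ (Matrix ι ι ℂ) := Matrix.linftyOpNormedAlgebra
  have : Nonempty ι := ⟨i⟩
  have : CompleteSpace (Matrix ι ι ℂ) := FiniteDimensional.complete ℂ _
  set N : Matrix ι ι ℂ := M.map (algebraMap ℝ ℂ) with hN
  obtain ⟨z, hz, hz'⟩ := spectrum.exists_nnnorm_eq_spectralRadius N
  have hr : spectralRadius ℂ N < 1 := by
    rw [← hz']
    exact_mod_cast h z hz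
  obtain ⟨r, hr1, hr2⟩ := ENNReal.lt_iff_exists_nnreal_btwn.1 hr
  have hr2' : r < 1 := by exact_mod_cast hr2
  have hev := (spectrum.pow_nnnorm_pow_one_div_tendsto_nhds_spectralRadius N).eventually_lt_const
    hr1
  have hsum : Summable fun k : ℕ => (r : ℝ) ^ k :=
    summable_geometric_of_lt_one r.2 (by exact_mod_cast hr2')
  refine Summable.of_norm_bounded_eventually_nat hsum ?_
  filter_upwards [hev, Filter.eventually_gt_atTop 0] with k hk hk0
  have h1 : (‖N ^ k‖₊ : ENNReal) < (r : ENNReal) ^ k := by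
    have hk0' : (0 : ℝ) < k := by exact_mod_cast hk0
    have := ENNReal.rpow_lt_rpow hk hk0'
    rw [← ENNReal.rpow_mul, one_div_mul_cancel hk0'.ne', ENNReal.rpow_one,
      ENNReal.rpow_natCast] at this
    exact this
  have h2 : ‖N ^ k‖₊ < r ^ k := by exact_mod_cast h1
  have h3 : (N ^ k) i j = ((M ^ k) i j : ℂ) := by
    have : N ^ k = (M ^ k).map (algebraMap ℝ ℂ) := by
      rw [hN, Matrix.map_pow]
    rw [this]
    rfl
  have h4 : ‖(N ^ k) i j‖₊ ≤ ‖N ^ k‖₊ := by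
    rw [Matrix.linfty_opNNNorm_def]
    refine le_trans ?_ (Finset.le_sup (f := fun i => ∑ j, ‖(N ^ k) i j‖₊) (Finset.mem_univ i))
    exact Finset.single_le_sum (f := fun j => ‖(N ^ k) i j‖₊) (fun _ _ => zero_le)
      (Finset.mem_univ j)
  have h5 : ‖(N ^ k) i j‖₊ ≤ r ^ k := h4.trans h2.le
  rw [h3] at h5
  have h6 : ‖((M ^ k) i j : ℂ)‖ ≤ (r : ℝ) ^ k := by exact_mod_cast h5
  rwa [Complex.norm_real] at h6

/-- On an eigenvector the powers act as `μ ^ k`; reading off a nonzero coordinate forces `μ ^ k →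
0`. -/
theorem isStable_of_tendsto_pow {M : Matrix ι ι ℝ}
    (h : ∀ i j, Filter.Tendsto (fun k : ℕ => (M ^ k) i j) Filter.atTop (nhds 0)) :
    IsStable M := by
  intro μ hμ
  rw [← Matrix.spectrum_toLin' , ← Module.End.hasEigenvalue_iff_mem_spectrum] at hμ
  obtain ⟨v, hv⟩ := hμ.exists_hasEigenvector
  obtain ⟨i, hi⟩ := Function.ne_iff.1 hv.2
  have hpow : ∀ k : ℕ, ((M ^ k).map (algebraMap ℝ ℂ)) *ᵥ v = μ ^ k • v := by
    intro k
    have := hv.pow_apply k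
    rw [← Matrix.toLin'_pow, Matrix.toLin'_apply] at this
    rw [← this, Matrix.map_pow]
  have hlim : Filter.Tendsto (fun k : ℕ => μ ^ k * v i) Filter.atTop (nhds 0) := by
    have h1 : Filter.Tendsto (fun k : ℕ => ∑ j, ((M ^ k) i j : ℂ) * v j) Filter.atTop
        (nhds (∑ j, ((0 : ℝ) : ℂ) * v j)) :=
      tendsto_finsetSum _ fun j _ =>
        ((Complex.continuous_ofReal.tendsto 0).comp (h i j)).mul_const _
    simp only [Complex.ofReal_zero, zero_mul, Finset.sum_const_zero] at h1
    refine h1.congr fun k => ?_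
    exact congrFun (hpow k) i
  have h2 : Filter.Tendsto (fun k : ℕ => μ ^ k) Filter.atTop (nhds 0) := by
    have := hlim.mul_const (v i)⁻¹
    rw [zero_mul] at this
    refine this.congr fun k => ?_
    rw [mul_assoc, mul_inv_cancel₀ hi, mul_one]
  exact tendsto_pow_atTop_nhds_zero_iff_norm_lt_one.1 h2

variable {S : Type*} [Fintype S] {n : ℕ}

/-- By the mixed-product rule, expanding the power of the sum enumerates the words of length `k`.
This is what ties sums over words to stability. -/
theorem sum_wordProd_kronecker (A : S → Matrix (Fin n) (Fin n) ℝ) (k : ℕ) :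
    ∑ f : Fin k → S, wordProd A (List.ofFn f) ⊗ₖ wordProd A (List.ofFn f)
      = (∑ σ, A σ ⊗ₖ A σ) ^ k := by
  induction k with
  | zero => simp
  | succ k ih =>
    rw [pow_succ, ← ih, Finset.sum_mul_sum, ← Fintype.sum_prod_type',
      ← (Fin.consEquiv fun _ => S).sum_comp, ← (Equiv.prodComm (Fin k → S) S).sum_comp]
    refine Finset.sum_congr rfl fun a _ => ?_
    simp [Fin.consEquiv, List.ofFn_succ, wordProd_cons, Matrix.mul_kronecker_mul]

theorem sum_kronecker_transpose (A : S → Matrix (Fin n) (Fin n) ℝ) :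
    ∑ σ, (A σ)ᵀ ⊗ₖ (A σ)ᵀ = (∑ σ, A σ ⊗ₖ A σ)ᵀ := by
  rw [Matrix.transpose_sum]
  rfl

theorem sum_wordProd_mul (A : S → Matrix (Fin n) (Fin n) ℝ) (k : ℕ) (i j i' j' : Fin n) :
    ∑ f : Fin k → S, wordProd A (List.ofFn f) i j * wordProd A (List.ofFn f) i' j'
      = ((∑ σ, (A σ)ᵀ ⊗ₖ (A σ)ᵀ) ^ k) (j, j') (i, i') := by
  rw [sum_kronecker_transpose, ← Matrix.transpose_pow, ← sum_wordProd_kronecker,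
    Matrix.transpose_apply, Matrix.sum_apply]
  rfl

theorem memlp_two_iff {α : Type*} {f : α → ℝ} : Memℓp f 2 ↔ Summable fun a => f a ^ 2 := by
  rw [memℓp_gen_iff (by norm_num)]
  simp

/-- Grouped by length, the sum of squares becomes a series of entries of the powers of the Kronecker
sum. -/
theorem IsStable.memlp_wordProd {A : S → Matrix (Fin n) (Fin n) ℝ}
    (h : IsStable (∑ σ, (A σ)ᵀ ⊗ₖ (A σ)ᵀ)) (i j : Fin n) :
    Memℓp (fun w => wordProd A w i j) 2 := by
  rw [memlp_two_iff, ← List.equivSigmaTuple.symm.summable_iff]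
  refine (summable_sigma_of_nonneg fun _ => sq_nonneg _).2 ⟨fun k => ?_, ?_⟩
  · exact (hasSum_fintype _).summable
  · refine (h.summable_pow (j, j) (i, i)).congr fun k => ?_
    rw [← sum_wordProd_mul, tsum_fintype]
    simp [List.equivSigmaTuple, sq]

/-- An entry of the `k`th power is the sum over words of length `k` of a product of two square
summable functions. That product is summable, so its sums over the successive lengths tend to zero.
-/
theorem isStable_of_memlp_wordProd {A : S → Matrix (Fin n) (Fin n) ℝ}
    (h : ∀ i j, Memℓp (fun w => wordProd A w i j) 2) :
    IsStable (∑ σ, (A σ)ᵀ ⊗ₖ (A σ)ᵀ) := by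
  refine isStable_of_tendsto_pow fun a b => ?_
  obtain ⟨j, j'⟩ := a
  obtain ⟨i, i'⟩ := b
  simp only [memlp_two_iff] at h
  have h1 : Summable fun w => wordProd A w i j * wordProd A w i' j' := by
    refine Summable.of_norm_bounded (((h i j).add (h i' j'))) fun w => ?_
    rw [Real.norm_eq_abs, abs_le]
    constructor <;> nlinarith [sq_nonneg (wordProd A w i j + wordProd A w i' j'),
      sq_nonneg (wordProd A w i j - wordProd A w i' j'), sq_nonneg (wordProd A w i j),
      sq_nonneg (wordProd A w i' j')]
  rw [← List.equivSigmaTuple.symm.summable_iff] at h1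
  refine h1.sigma.tendsto_atTop_zero.congr fun k => ?_
  rw [← sum_wordProd_mul, tsum_fintype]
  rfl

/-- After vectorization `Z` is fixed by every power of the Kronecker sum, and these powers tend to
zero. -/
theorem IsStable.eq_zero_of_fixed {A : S → Matrix (Fin n) (Fin n) ℝ}
    (h : IsStable (∑ σ, (A σ)ᵀ ⊗ₖ (A σ)ᵀ)) {Z : Matrix (Fin n) (Fin n) ℝ}
    (hZ : Z = ∑ σ, A σ * Z * (A σ)ᵀ) : Z = 0 := by
  rw [← Matrix.vec_eq_zero_iff]
  set M := ∑ σ, (A σ)ᵀ ⊗ₖ (A σ)ᵀ with hM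
  have h1 : Z.vec ᵥ* M = Z.vec := by
    rw [hM, sum_kronecker_transpose, Matrix.vecMul_transpose]
    conv_rhs => rw [hZ]
    rw [Matrix.vec_sum, Matrix.sum_mulVec]
    exact Finset.sum_congr rfl fun σ _ => by rw [Matrix.kronecker_mulVec_vec]
  have h2 : ∀ k : ℕ, Z.vec ᵥ* (M ^ k) = Z.vec := by
    intro k
    induction k with
    | zero => simp
    | succ k ih => rw [pow_succ, ← Matrix.vecMul_vecMul, ih, h1]
  ext b
  have h3 : Filter.Tendsto (fun k : ℕ => ∑ a, Z.vec a * (M ^ k) a b) Filter.atTop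
      (nhds (∑ a, Z.vec a * 0)) :=
    tendsto_finsetSum _ fun a _ => (h.summable_pow a b).tendsto_atTop_zero.const_mul _
  have h4 : (fun k : ℕ => ∑ a, Z.vec a * (M ^ k) a b) = fun _ => Z.vec b := by
    ext k
    exact congrFun (h2 k) b
  rw [h4] at h3
  simpa using tendsto_nhds_unique tendsto_const_nhds h3

theorem IsStable.existsUnique_lyapunov {A : S → Matrix (Fin n) (Fin n) ℝ}
    (h : IsStable (∑ σ, (A σ)ᵀ ⊗ₖ (A σ)ᵀ)) (G : Matrix (Fin n) (Fin n) ℝ) :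
    ∃! Z, Z = ∑ σ, A σ * Z * (A σ)ᵀ + G := by
  let f : Matrix (Fin n) (Fin n) ℝ →ₗ[ℝ] Matrix (Fin n) (Fin n) ℝ :=
    { toFun := fun Z => Z - ∑ σ, A σ * Z * (A σ)ᵀ
      map_add' := fun X Y => by
        simp only [Matrix.mul_add, Matrix.add_mul, Finset.sum_add_distrib]
        abel
      map_smul' := fun c X => by
        simp [Finset.smul_sum, smul_sub] }
  have hinj : Function.Injective f := by
    rw [← LinearMap.ker_eq_bot, LinearMap.ker_eq_bot']
    exact fun Z hZ => h.eq_zero_of_fixed (sub_eq_zero.1 hZ)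
  have hiff : ∀ Z, (Z = ∑ σ, A σ * Z * (A σ)ᵀ + G) ↔ f Z = G := fun Z => by
    rw [add_comm]
    exact sub_eq_iff_eq_add.symm
  simp only [hiff]
  exact (Function.bijective_iff_existsUnique f).1
    ⟨hinj, LinearMap.injective_iff_surjective.1 hinj⟩ G

theorem memlp_sum_mul {α β : Type*} [Fintype β] (c : β → ℝ) {f : β → α → ℝ}
    (hf : ∀ b, Memℓp (f b) 2) : Memℓp (fun a => ∑ b, c b * f b a) 2 :=
  Memℓp.finsetSum _ (f := fun b a => c b * f b a) fun b _ => (hf b).const_mul (c b)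

theorem isSquareSummable_iff {S J : Type*} {d : ℕ} {Ψ : J → List S → Fin d → ℝ} :
    IsSquareSummable Ψ ↔ ∀ j i, Memℓp (fun w => Ψ j w i) 2 := by
  simp only [IsSquareSummable, memlp_two_iff]
  refine forall_congr' fun j => ⟨fun h i => ?_, fun h => summable_sum fun i _ => h i⟩
  exact h.of_nonneg_of_le (fun _ => sq_nonneg _) fun w =>
    Finset.single_le_sum (f := fun i => Ψ j w i ^ 2) (fun _ _ => sq_nonneg _) (Finset.mem_univ i)

theorem Rep.Represents.isSquareSummable {J : Type*} {d : ℕ} {R : Rep S J d n}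
    {Ψ : J → List S → Fin d → ℝ} (h : R.Represents Ψ)
    (hs : IsStable (∑ σ, (R.A σ)ᵀ ⊗ₖ (R.A σ)ᵀ)) : IsSquareSummable Ψ := by
  rw [isSquareSummable_iff]
  intro j i
  have h1 : (fun w => Ψ j w i) = fun w => ∑ l : Fin n, R.B j l *
      ∑ k : Fin n, R.C i k * wordProd R.A w k l := by
    ext w
    rw [h]
    simp [Matrix.mulVec, dotProduct, Matrix.mul_apply, mul_comm]
  rw [h1]
  exact memlp_sum_mul _ fun l => memlp_sum_mul _ fun k => hs.memlp_wordProd k l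

theorem memlp_comp_injective {α β : Type*} {f : α → ℝ} (hf : Memℓp f 2) {g : β → α}
    (hg : Function.Injective g) : Memℓp (fun b => f (g b)) 2 := by
  rw [memlp_two_iff] at hf ⊢
  exact hf.comp_injective hg

/-- Square summability passes from `Ψ` to the Hankel space, which is the range of the observability
map. Through the left inverse of `O_R`, each entry of `A_w` is a fixed finite combination of values
of such series at the words `w` followed by a short word. -/
theorem Rep.IsMinimal.isStable {J : Type*} {d : ℕ} {R : Rep S J d n}
    {Ψ : J → List S → Fin d → ℝ} (h : R.IsMinimal Ψ) (hs : IsSquareSummable Ψ) :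
    IsStable (∑ σ, (R.A σ)ᵀ ⊗ₖ (R.A σ)ᵀ) := by
  rw [isSquareSummable_iff] at hs
  obtain ⟨hinj, hrange⟩ := h.obsMap_injective_and_range
  have hmem : ∀ f ∈ hankel Ψ, ∀ i, Memℓp (fun w => f w i) 2 := by
    intro f hf
    induction hf using Submodule.span_induction with
    | mem f hf =>
      obtain ⟨⟨j, v⟩, rfl⟩ := hf
      exact fun i => memlp_comp_injective (hs j i) (List.append_right_injective v)
    | zero => exact fun i => zero_memℓp
    | add f g _ _ hf hg => exact fun i => (hf i).add (hg i)
    | smul c f _ hf => exact fun i => (hf i).const_mul c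
  obtain ⟨Oinv, hO⟩ := Rep.exists_leftInverse_obs hinj
  refine isStable_of_memlp_wordProd fun i j => ?_
  have h1 : (fun w => wordProd R.A w i j) = fun w => ∑ a : ShortWord S n × Fin d, Oinv i a *
      R.obsMap (Pi.single j 1) (w ++ List.ofFn a.1.2) a.2 := by
    ext w
    have : wordProd R.A w *ᵥ Pi.single j 1
        = Oinv *ᵥ (R.obs *ᵥ (wordProd R.A w *ᵥ Pi.single j 1)) := by
      rw [Matrix.mulVec_mulVec, hO, Matrix.one_mulVec]
    have := congrFun this i
    rw [Matrix.mulVec_single_one] at this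
    simp only [Matrix.col_apply] at this
    rw [this]
    refine Finset.sum_congr rfl fun a _ => ?_
    rw [Rep.obs_mulVec, ← Matrix.mulVec_single_one, Rep.obsMap_wordProd]
  rw [h1]
  exact memlp_sum_mul _ fun a => memlp_comp_injective
    (hmem _ (hrange ▸ LinearMap.mem_range_self _ _) a.2)
    (List.append_left_injective (List.ofFn a.1.2))

end Stability

/-! ### Closed spans in Hilbert spaces -/

section ClosedSpan

variable {H : Type*} [NormedAddCommGroup H] [InnerProductSpace ℝ H]

local notation "⟪" x ", " y "⟫" => inner ℝ x y

theorem clm_eq_zero_of_mem_closure_span {E : Type*} [NormedAddCommGroup E] [NormedSpace ℝ E]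
    {s : Set H} (f : H →L[ℝ] E) (hf : ∀ z ∈ s, f z = 0) {x : H}
    (hx : x ∈ (Submodule.span ℝ s).topologicalClosure) : f x = 0 := by
  have h : (Submodule.span ℝ s).topologicalClosure ≤ LinearMap.ker (f : H →ₗ[ℝ] E) :=
    Submodule.topologicalClosure_minimal _ (Submodule.span_le.2 hf) f.isClosed_ker
  exact h hx

theorem clm_mem_of_mem_closure_span {E : Type*} [NormedAddCommGroup E] [NormedSpace ℝ E]
    {s : Set H} (f : H →L[ℝ] E) {V : Submodule ℝ E} (hV : IsClosed (V : Set E))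
    (hf : ∀ z ∈ s, f z ∈ V) {x : H}
    (hx : x ∈ (Submodule.span ℝ s).topologicalClosure) : f x ∈ V := by
  have h : (Submodule.span ℝ s).topologicalClosure ≤ V.comap (f : H →ₗ[ℝ] E) :=
    Submodule.topologicalClosure_minimal _ (Submodule.span_le.2 hf) (hV.preimage f.continuous)
  exact h hx

theorem inner_eq_zero_of_mem_closure_span {s : Set H} {a : H} (ha : ∀ z ∈ s, ⟪a, z⟫ = 0) {x : H}
    (hx : x ∈ (Submodule.span ℝ s).topologicalClosure) : ⟪a, x⟫ = 0 :=
  clm_eq_zero_of_mem_closure_span (innerSL ℝ a) ha hx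

theorem eq_of_inner_eq_of_mem_closure_span {s : Set H} {a b : H}
    (ha : a ∈ (Submodule.span ℝ s).topologicalClosure)
    (hb : b ∈ (Submodule.span ℝ s).topologicalClosure) (h : ∀ z ∈ s, ⟪a, z⟫ = ⟪b, z⟫) : a = b := by
  rw [← sub_eq_zero, ← inner_self_eq_zero (𝕜 := ℝ)]
  refine inner_eq_zero_of_mem_closure_span (fun z hz => ?_) (Submodule.sub_mem _ ha hb)
  rw [inner_sub_left, h z hz, sub_self]

/-- Two families of vectors with the same Gram matrix: elements of the closed spans with the same
inner products with the generators have the same inner products. -/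
theorem inner_eq_of_gram_eq [CompleteSpace H] {ι : Type*} {z z' : ι → H}
    (hz : ∀ i j, ⟪z i, z j⟫ = ⟪z' i, z' j⟫) {x y x' y' : H}
    (hx : x ∈ (Submodule.span ℝ (Set.range z)).topologicalClosure)
    (hx' : x' ∈ (Submodule.span ℝ (Set.range z')).topologicalClosure)
    (hy : y ∈ (Submodule.span ℝ (Set.range z)).topologicalClosure)
    (hy' : y' ∈ (Submodule.span ℝ (Set.range z')).topologicalClosure)
    (h : ∀ i, ⟪x, z i⟫ = ⟪x', z' i⟫) (h' : ∀ i, ⟪y, z i⟫ = ⟪y', z' i⟫) :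
    ⟪x, y⟫ = ⟪x', y'⟫ := by
  -- The correspondence `z i ↦ z' i` is handled through its closed graph `G` in `H × H`; equality of
  -- the Gram matrices makes it isometric.
  let s : Set (WithLp 2 (H × H)) := Set.range fun i => WithLp.toLp 2 (z i, z' i)
  let G := (Submodule.span ℝ s).topologicalClosure
  let f1 : WithLp 2 (H × H) →L[ℝ] H := WithLp.fstL 2 ℝ H H
  let f2 : WithLp 2 (H × H) →L[ℝ] H := WithLp.sndL 2 ℝ H H
  have hG1 : ∀ i, ∀ a ∈ G, ⟪z i, f1 a⟫ = ⟪z' i, f2 a⟫ := by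
    intro i a ha
    rw [← sub_eq_zero]
    refine clm_eq_zero_of_mem_closure_span
      ((innerSL ℝ (z i)).comp f1 - (innerSL ℝ (z' i)).comp f2) ?_ ha
    rintro _ ⟨j, rfl⟩
    exact sub_eq_zero.2 (hz i j)
  have hG : ∀ a ∈ G, ∀ b ∈ G, ⟪f1 a, f1 b⟫ = ⟪f2 a, f2 b⟫ := by
    intro a ha b hb
    rw [← sub_eq_zero]
    refine clm_eq_zero_of_mem_closure_span
      ((innerSL ℝ (f1 a)).comp f1 - (innerSL ℝ (f2 a)).comp f2) ?_ hb
    rintro _ ⟨j, rfl⟩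
    refine sub_eq_zero.2 ?_
    have := hG1 j a ha
    rwa [real_inner_comm, real_inner_comm (f2 a)] at this
  have hsnd : ∀ a ∈ G, f2 a ∈ (Submodule.span ℝ (Set.range z')).topologicalClosure := by
    intro a ha
    refine clm_mem_of_mem_closure_span f2 (Submodule.isClosed_topologicalClosure _) ?_ ha
    rintro _ ⟨j, rfl⟩
    exact Submodule.le_topologicalClosure _ (Submodule.subset_span ⟨j, rfl⟩)
  -- On `G` both components have the same norm, so the first projection is bounded below and its
  -- range is closed. The exact constant is `√2`; `2` is enough.
  have hcl : IsClosed (Set.range fun a : G => f1 a) := by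
    have : CompleteSpace G := Submodule.topologicalClosure.completeSpace _
    refine AntilipschitzWith.isClosed_range (K := 2) ?_
      (f1.uniformContinuous.comp uniformContinuous_subtype_val)
    refine AddMonoidHomClass.antilipschitz_of_bound (f1.comp G.subtypeL) fun a => ?_
    have h1 : ‖f1 a‖ = ‖f2 a‖ := by
      rw [norm_eq_sqrt_real_inner, norm_eq_sqrt_real_inner, hG a a.2 a a.2]
    have h2 : ‖(a : WithLp 2 (H × H))‖ ^ 2 = ‖f1 a‖ ^ 2 + ‖f2 a‖ ^ 2 :=
      WithLp.prod_norm_sq_eq_of_L2 _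
    rw [← h1] at h2
    change ‖(a : WithLp 2 (H × H))‖ ≤ 2 * ‖f1 a‖
    refine abs_le_of_sq_le_sq' ?_ (by positivity) |>.2
    nlinarith [sq_nonneg ‖f1 a‖]
  have hfst : ∀ x ∈ (Submodule.span ℝ (Set.range z)).topologicalClosure, ∃ a ∈ G, f1 a = x := by
    intro x hx
    have hle : (Submodule.span ℝ (Set.range z)).topologicalClosure
        ≤ LinearMap.range ((f1.comp G.subtypeL : G →L[ℝ] H) : G →ₗ[ℝ] H) := by
      refine Submodule.topologicalClosure_minimal _ (Submodule.span_le.2 ?_) hcl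
      rintro _ ⟨j, rfl⟩
      exact ⟨⟨WithLp.toLp 2 (z j, z' j),
        Submodule.le_topologicalClosure _ (Submodule.subset_span ⟨j, rfl⟩)⟩, rfl⟩
    obtain ⟨a, ha⟩ := hle hx
    exact ⟨a, a.2, ha⟩
  have key : ∀ {x x' : H}, x ∈ (Submodule.span ℝ (Set.range z)).topologicalClosure →
      x' ∈ (Submodule.span ℝ (Set.range z')).topologicalClosure →
      (∀ i, ⟪x, z i⟫ = ⟪x', z' i⟫) → ∃ a ∈ G, f1 a = x ∧ f2 a = x' := by
    intro x x' hx hx' h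
    obtain ⟨a, ha, rfl⟩ := hfst x hx
    refine ⟨a, ha, rfl, eq_of_inner_eq_of_mem_closure_span (hsnd a ha) hx' ?_⟩
    rintro _ ⟨j, rfl⟩
    rw [← h j, real_inner_comm, ← hG1 j a ha, real_inner_comm]
  obtain ⟨a, ha, rfl, rfl⟩ := key hx hx' h
  obtain ⟨b, hb, rfl, rfl⟩ := key hy hy' h'
  exact hG a ha b hb

end ClosedSpan

/-! ### Gram matrices -/

section Gram

variable {H : Type*} [NormedAddCommGroup H] [InnerProductSpace ℝ H]
variable {ι κ ν : Type*}

/-- The action of a matrix on a tuple of vectors. -/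
def act [Fintype κ] (M : Matrix ι κ ℝ) (x : κ → H) : ι → H := fun i => ∑ j, M i j • x j

/-- The matrix of inner products of two tuples of vectors. -/
def gram (x : ι → H) (y : κ → H) : Matrix ι κ ℝ := Matrix.of fun i j => inner ℝ (x i) (y j)

theorem gram_apply (x : ι → H) (y : κ → H) (i : ι) (j : κ) : gram x y i j = inner ℝ (x i) (y j) :=
  rfl

theorem gram_transpose (x : ι → H) (y : κ → H) : (gram x y)ᵀ = gram y x := by
  ext i j
  exact real_inner_comm _ _

theorem gram_act_left [Fintype κ] (M : Matrix ι κ ℝ) (x : κ → H) (y : ν → H) :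
    gram (act M x) y = M * gram x y := by
  ext i j
  simp [gram_apply, act, Matrix.mul_apply, sum_inner, real_inner_smul_left]

theorem gram_act_right [Fintype κ] (M : Matrix ι κ ℝ) (x : κ → H) (y : ν → H) :
    gram y (act M x) = gram y x * Mᵀ := by
  rw [← gram_transpose, gram_act_left, Matrix.transpose_mul, gram_transpose]

theorem gram_add_left (x x' : ι → H) (y : κ → H) : gram (x + x') y = gram x y + gram x' y := by
  ext i j
  exact inner_add_left _ _ _

theorem gram_add_right (x x' : ι → H) (y : κ → H) : gram y (x + x') = gram y x + gram y x' := by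
  ext i j
  exact inner_add_right _ _ _

theorem gram_sub_left (x x' : ι → H) (y : κ → H) : gram (x - x') y = gram x y - gram x' y := by
  ext i j
  exact inner_sub_left _ _ _

theorem gram_sub_right (x x' : ι → H) (y : κ → H) : gram y (x - x') = gram y x - gram y x' := by
  ext i j
  exact inner_sub_right _ _ _

theorem gram_sum_left {S : Type*} [Fintype S] (x : S → ι → H) (y : κ → H) :
    gram (fun i => ∑ σ, x σ i) y = ∑ σ, gram (x σ) y := by
  ext i j
  simp [gram_apply, sum_inner, Matrix.sum_apply]

theorem gram_smul_left (c : ℝ) (x : ι → H) (y : κ → H) :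
    gram (fun i => c • x i) y = c • gram x y := by
  ext i j
  exact real_inner_smul_left _ _ _

theorem eq_of_gram_sub_eq_zero {x y : ι → H} (h : gram (x - y) (x - y) = 0) : x = y := by
  ext i
  have : inner ℝ ((x - y) i) ((x - y) i) = 0 := congrFun (congrFun h i) i
  rw [inner_self_eq_zero] at this
  exact sub_eq_zero.1 this

end Gram

/-! ### Shift systems -/

/-- A Hilbert space with closed subspaces `past t` and operators `op σ t`, which map `past t`
isometrically to mutually orthogonal subspaces of `past (t + 1)`, such that
`∑_σ √p_σ op σ t = 1`. -/
structure ShiftSystem (S H : Type*) [Fintype S] [NormedAddCommGroup H] [InnerProductSpace ℝ H]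
    (p : S → ℝ) where
  past : ℤ → Submodule ℝ H
  isClosed_past : ∀ t, IsClosed (past t : Set H)
  op : S → ℤ → H →L[ℝ] H
  op_mem : ∀ σ t f, f ∈ past t → op σ t f ∈ past (t + 1)
  inner_op_same : ∀ σ t f g, f ∈ past t → g ∈ past t →
    inner ℝ (op σ t f) (op σ t g) = inner ℝ f g
  inner_op_ne : ∀ σ τ t f g, σ ≠ τ → f ∈ past t → g ∈ past t →
    inner ℝ (op σ t f) (op τ t g) = 0
  sum_op : ∀ t f, ∑ σ, √(p σ) • op σ t f = f

namespace ShiftSystem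

variable {S H : Type*} [Fintype S] [NormedAddCommGroup H] [InnerProductSpace ℝ H]
  {p : S → ℝ} (Φ : ShiftSystem S H p) {a b c d n : ℕ}

/-- `r(t-1) u_σ(t-1) / √p_σ`. -/
def step (σ : S) (r : ℤ → Fin a → H) (t : ℤ) (i : Fin a) : H := Φ.op σ (t - 1) (r (t - 1) i)

/-- `r(t-|w|) u_w(t-1) / √p_w`. -/
def word (r : ℤ → Fin a → H) (w : List S) : ℤ → Fin a → H := w.foldl (fun r σ => Φ.step σ r) r

@[simp] theorem word_nil (r : ℤ → Fin a → H) : Φ.word r [] = r := rfl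

theorem word_snoc (r : ℤ → Fin a → H) (w : List S) (σ : S) :
    Φ.word r (w ++ [σ]) = Φ.step σ (Φ.word r w) := by
  simp [word, List.foldl_append]

theorem step_succ (r : ℤ → Fin a → H) (σ : S) (t : ℤ) :
    Φ.step σ r (t + 1) = fun i => Φ.op σ t (r t i) := by
  ext i
  simp [step]

theorem word_snoc_succ (r : ℤ → Fin a → H) (w : List S) (σ : S) (t : ℤ) :
    Φ.word r (w ++ [σ]) (t + 1) = fun i => Φ.op σ t (Φ.word r w t i) := by
  rw [word_snoc, step_succ]

/-- The process `r` is in the past at every time. -/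
def Adapted (r : ℤ → Fin a → H) : Prop := ∀ t i, r t i ∈ Φ.past t

/-- The closed span of the `z^r_w(t)`, `w ≠ ε`. -/
def pastSpan (r : ℤ → Fin a → H) (t : ℤ) : Submodule ℝ H :=
  (Submodule.span ℝ {h | ∃ w : List S, w ≠ [] ∧ ∃ i, h = Φ.word r w t i}).topologicalClosure

instance [CompleteSpace H] (r : ℤ → Fin a → H) (t : ℤ) : CompleteSpace (Φ.pastSpan r t) :=
  Submodule.topologicalClosure.completeSpace _

variable {Φ}
variable {r : ℤ → Fin a → H} {s : ℤ → Fin b → H}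

theorem Adapted.step (hr : Φ.Adapted r) (σ : S) : Φ.Adapted (Φ.step σ r) := by
  intro t i
  have := Φ.op_mem σ (t - 1) _ (hr (t - 1) i)
  rwa [sub_add_cancel] at this

theorem Adapted.word (hr : Φ.Adapted r) (w : List S) : Φ.Adapted (Φ.word r w) := by
  induction w using List.reverseRecOn with
  | nil => exact hr
  | append_singleton w σ ih =>
    rw [word_snoc]
    exact ih.step σ

theorem gram_op_same (σ : S) (t : ℤ) {f : Fin a → H} {g : Fin b → H} (hf : ∀ i, f i ∈ Φ.past t)
    (hg : ∀ i, g i ∈ Φ.past t) :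
    gram (fun i => Φ.op σ t (f i)) (fun i => Φ.op σ t (g i)) = gram f g := by
  ext i j
  exact Φ.inner_op_same σ t _ _ (hf i) (hg j)

theorem gram_op_ne {σ τ : S} (h : σ ≠ τ) (t : ℤ) {f : Fin a → H} {g : Fin b → H}
    (hf : ∀ i, f i ∈ Φ.past t) (hg : ∀ i, g i ∈ Φ.past t) :
    gram (fun i => Φ.op σ t (f i)) (fun i => Φ.op τ t (g i)) = 0 := by
  ext i j
  exact Φ.inner_op_ne σ τ t _ _ h (hf i) (hg j)

theorem gram_word_snoc_same (hr : Φ.Adapted r) (hs : Φ.Adapted s) (w v : List S) (σ : S) (t : ℤ) :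
    gram (Φ.word r (w ++ [σ]) (t + 1)) (Φ.word s (v ++ [σ]) (t + 1))
      = gram (Φ.word r w t) (Φ.word s v t) := by
  rw [word_snoc_succ, word_snoc_succ, gram_op_same σ t (hr.word w t) (hs.word v t)]

theorem gram_word_snoc_ne (hr : Φ.Adapted r) (hs : Φ.Adapted s) (w v : List S) {σ τ : S}
    (h : σ ≠ τ) (t : ℤ) :
    gram (Φ.word r (w ++ [σ]) (t + 1)) (Φ.word s (v ++ [τ]) (t + 1)) = 0 := by
  rw [word_snoc_succ, word_snoc_succ, gram_op_ne h t (hr.word w t) (hs.word v t)]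

theorem word_mem_pastSpan {w : List S} (hw : w ≠ []) (t : ℤ) (i : Fin a) :
    Φ.word r w t i ∈ Φ.pastSpan r t :=
  Submodule.le_topologicalClosure _ (Submodule.subset_span ⟨w, hw, i, rfl⟩)

theorem pastSpan_le {t : ℤ} {V : Submodule ℝ H} (hV : IsClosed (V : Set H))
    (h : ∀ w : List S, w ≠ [] → ∀ i, Φ.word r w t i ∈ V) : Φ.pastSpan r t ≤ V := by
  refine Submodule.topologicalClosure_minimal _ (Submodule.span_le.2 ?_) hV
  rintro _ ⟨w, hw, i, rfl⟩
  exact h w hw i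

theorem isClosed_pastSpan (t : ℤ) : IsClosed (Φ.pastSpan r t : Set H) :=
  Submodule.isClosed_topologicalClosure _

theorem Adapted.pastSpan_le_past (hr : Φ.Adapted r) (t : ℤ) : Φ.pastSpan r t ≤ Φ.past t :=
  pastSpan_le (Φ.isClosed_past t) fun w _ => hr.word w t

theorem op_self_mem_pastSpan (σ : S) (t : ℤ) (i : Fin a) :
    Φ.op σ t (r t i) ∈ Φ.pastSpan r (t + 1) := by
  have := word_mem_pastSpan (Φ := Φ) (r := r) (w := [] ++ [σ]) (by simp) (t + 1) i
  rwa [word_snoc_succ] at this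

theorem op_mem_pastSpan (σ : S) (t : ℤ) {f : H} (hf : f ∈ Φ.pastSpan r t) :
    Φ.op σ t f ∈ Φ.pastSpan r (t + 1) := by
  refine clm_mem_of_mem_closure_span (Φ.op σ t) (isClosed_pastSpan _) ?_ hf
  rintro _ ⟨w, _, i, rfl⟩
  have := word_mem_pastSpan (Φ := Φ) (r := r) (w := w ++ [σ]) (by simp) (t + 1) i
  rwa [word_snoc_succ] at this

/-- One step suffices: the operators carry each past span into the next, so further letters are
absorbed. -/
theorem pastSpan_le_pastSpan (h : ∀ σ t i, Φ.op σ t (s t i) ∈ Φ.pastSpan r (t + 1)) (t : ℤ) :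
    Φ.pastSpan s t ≤ Φ.pastSpan r t := by
  refine pastSpan_le (isClosed_pastSpan _) fun w hw i => ?_
  induction w using List.reverseRecOn generalizing t with
  | nil => exact absurd rfl hw
  | append_singleton w σ ih =>
    rw [← sub_add_cancel t 1, word_snoc_succ]
    by_cases h0 : w = []
    · subst h0
      exact h σ _ i
    · exact op_mem_pastSpan σ _ (ih _ h0)

theorem act_mem {V : Submodule ℝ H} (M : Matrix (Fin a) (Fin b) ℝ) {x : Fin b → H}
    (hx : ∀ i, x i ∈ V) (i : Fin a) : act M x i ∈ V :=
  Submodule.sum_mem _ fun j _ => Submodule.smul_mem _ _ (hx j)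

theorem gram_eq_zero_of_mem_pastSpan {f : Fin b → H} {g : Fin c → H} {t : ℤ}
    (hg : ∀ j, g j ∈ Φ.pastSpan r t) (h : ∀ w : List S, w ≠ [] → gram f (Φ.word r w t) = 0) :
    gram f g = 0 := by
  ext i j
  refine inner_eq_zero_of_mem_closure_span ?_ (hg j)
  rintro _ ⟨w, hw, k, rfl⟩
  exact congrFun (congrFun (h w hw) i) k

theorem eq_of_gram_eq_of_mem_pastSpan {f g : Fin b → H} {t : ℤ}
    (hf : ∀ j, f j ∈ Φ.pastSpan r t) (hg : ∀ j, g j ∈ Φ.pastSpan r t)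
    (h : ∀ w : List S, w ≠ [] → gram f (Φ.word r w t) = gram g (Φ.word r w t)) : f = g := by
  ext i
  refine eq_of_inner_eq_of_mem_closure_span (hf i) (hg i) ?_
  rintro _ ⟨w, hw, k, rfl⟩
  exact congrFun (congrFun (h w hw) i) k

/-! #### Stationarity -/

/-- `E[r(t) z^r_w(t)ᵀ]` does not depend on `t`. -/
def Stationary (Φ : ShiftSystem S H p) (r : ℤ → Fin a → H) : Prop :=
  ∀ w t t', gram (r t) (Φ.word r w t) = gram (r t') (Φ.word r w t')

/-- Words are compared from their last letters: equal letters cancel by isometry, different ones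
give zero, and when one word is exhausted the definition of stationarity applies. -/
theorem Stationary.gram_word (h : Φ.Stationary r) (hr : Φ.Adapted r) (w v : List S) (t t' : ℤ) :
    gram (Φ.word r w t) (Φ.word r v t) = gram (Φ.word r w t') (Φ.word r v t') := by
  induction w using List.reverseRecOn generalizing v t t' with
  | nil => exact h v t t'
  | append_singleton w σ ih =>
    induction v using List.reverseRecOn with
    | nil =>
      have := congrArg Matrix.transpose (h (w ++ [σ]) t t')
      rwa [gram_transpose, gram_transpose] at this
    | append_singleton v τ _ =>
      rw [← sub_add_cancel t 1, ← sub_add_cancel t' 1]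
      by_cases hστ : σ = τ
      · subst hστ
        rw [gram_word_snoc_same hr hr, gram_word_snoc_same hr hr]
        exact ih _ _ _
      · rw [gram_word_snoc_ne hr hr _ _ hστ, gram_word_snoc_ne hr hr _ _ hστ]

/-- The resolution of the identity rewrites a vector at time `t` through words at time `t + 1`,
which brings vectors taken at different times to a common time. -/
theorem word_eq_sum (w : List S) (t : ℤ) :
    Φ.word r w t = fun i => ∑ σ, √(p σ) • Φ.word r (w ++ [σ]) (t + 1) i := by
  ext i
  conv_lhs => rw [← Φ.sum_op t (Φ.word r w t i)]
  simp only [word_snoc_succ]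

theorem Stationary.gram_word_shift (h : Φ.Stationary r) (hr : Φ.Adapted r) (w v : List S)
    (s t k : ℤ) :
    gram (Φ.word r w (t + k)) (Φ.word r v (s + k)) = gram (Φ.word r w t) (Φ.word r v s) := by
  -- Induction on the time gap `m`: expanding the earlier vector one step forward shortens it.
  have key : ∀ (m : ℕ) (w v : List S) (t : ℤ),
      gram (Φ.word r w (t + k)) (Φ.word r v (t + m + k))
        = gram (Φ.word r w t) (Φ.word r v (t + m)) := by
    intro m
    induction m with
    | zero =>
      intro w v t
      simpa using h.gram_word hr w v (t + k) t
    | succ m ih =>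
      intro w v t
      rw [word_eq_sum w (t + k), word_eq_sum w t, gram_sum_left, gram_sum_left]
      refine Finset.sum_congr rfl fun σ _ => ?_
      rw [gram_smul_left, gram_smul_left]
      have := ih (w ++ [σ]) v (t + 1)
      push_cast
      rw [show t + k + 1 = t + 1 + k by ring, show t + (m + 1 : ℤ) = t + 1 + m by ring, this]
  rcases le_total t s with hts | hts
  · have := key (s - t).toNat w v t
    rwa [Int.toNat_of_nonneg (by omega), add_sub_cancel] at this
  · have := congrArg Matrix.transpose (key (t - s).toNat v w s)
    rwa [Int.toNat_of_nonneg (by omega), add_sub_cancel, gram_transpose, gram_transpose] at this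

/-- The generators have the same Gram matrix at `t` and at `t'`, and an element of the closed span
is determined by its inner products with them, so `inner_eq_of_gram_eq` applies. -/
theorem Stationary.gram_self_eq [CompleteSpace H] (h : Φ.Stationary r) (hr : Φ.Adapted r)
    {x : ℤ → Fin n → H}
    (hx : ∀ t i, x t i ∈ Φ.pastSpan r t)
    (hxr : ∀ w : List S, w ≠ [] → ∀ t t', gram (x t) (Φ.word r w t) = gram (x t') (Φ.word r w t'))
    (t t' : ℤ) : gram (x t) (x t) = gram (x t') (x t') := by
  let z : ℤ → {w : List S // w ≠ []} × Fin a → H := fun t k => Φ.word r k.1 t k.2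
  have hz : ∀ t, Φ.pastSpan r t = (Submodule.span ℝ (Set.range (z t))).topologicalClosure := by
    intro t
    rw [pastSpan]
    congr 2
    ext h
    constructor
    · rintro ⟨w, hw, i, rfl⟩
      exact ⟨(⟨w, hw⟩, i), rfl⟩
    · rintro ⟨⟨⟨w, hw⟩, i⟩, rfl⟩
      exact ⟨w, hw, i, rfl⟩
  ext i j
  refine inner_eq_of_gram_eq (z := z t) (z' := z t') ?_ (hz t ▸ hx t i) (hz t' ▸ hx t' i)
    (hz t ▸ hx t j) (hz t' ▸ hx t' j) ?_ ?_
  · exact fun k l => congrFun (congrFun (h.gram_word hr k.1 l.1 t t') k.2) l.2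
  · exact fun k => congrFun (congrFun (hxr k.1 k.1.2 t t') i) k.2
  · exact fun k => congrFun (congrFun (hxr k.1 k.1.2 t t') j) k.2

/-! #### State equations -/

/-- `∑_σ (A_σ x + K_σ v) u_σ(t) / √p_σ`. -/
def next (Φ : ShiftSystem S H p) (A : S → Matrix (Fin n) (Fin n) ℝ)
    (K : S → Matrix (Fin n) (Fin a) ℝ) (t : ℤ) (x : Fin n → H) (v : Fin a → H) : Fin n → H :=
  fun i => ∑ σ, Φ.op σ t ((act (A σ) x + act (K σ) v) i)

variable {A : S → Matrix (Fin n) (Fin n) ℝ} {K : S → Matrix (Fin n) (Fin a) ℝ} {t : ℤ}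

/-- Testing against the range of `op σ` keeps only the term of the letter `σ`, where the isometry
removes the operator. -/
theorem gram_next {x : Fin n → H} {v : Fin a → H} (hx : ∀ i, x i ∈ Φ.past t)
    (hv : ∀ i, v i ∈ Φ.past t) (σ : S) {f : Fin b → H} (hf : ∀ i, f i ∈ Φ.past t) :
    gram (Φ.next A K t x v) (fun i => Φ.op σ t (f i))
      = A σ * gram x f + K σ * gram v f := by
  have hm : ∀ τ i, (act (A τ) x + act (K τ) v) i ∈ Φ.past t := fun τ i =>
    Submodule.add_mem _ (act_mem _ hx i) (act_mem _ hv i)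
  unfold next
  rw [gram_sum_left, Finset.sum_eq_single σ]
  · rw [gram_op_same σ t (hm σ) hf, gram_add_left, gram_act_left, gram_act_left]
  · exact fun τ _ hτ => gram_op_ne hτ t (hm τ) hf
  · simp

theorem gram_next_self {x : Fin n → H} {v : Fin a → H} (hx : ∀ i, x i ∈ Φ.past t)
    (hv : ∀ i, v i ∈ Φ.past t) (hxv : gram x v = 0) :
    gram (Φ.next A K t x v) (Φ.next A K t x v)
      = ∑ σ, A σ * gram x x * (A σ)ᵀ + ∑ σ, K σ * gram v v * (K σ)ᵀ := by
  have hm : ∀ τ i, (act (A τ) x + act (K τ) v) i ∈ Φ.past t := fun τ i =>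
    Submodule.add_mem _ (act_mem _ hx i) (act_mem _ hv i)
  have hvx : gram v x = 0 := by rw [← gram_transpose, hxv, Matrix.transpose_zero]
  conv_lhs => arg 2; unfold next
  rw [← gram_transpose, gram_sum_left, Matrix.transpose_sum, ← Finset.sum_add_distrib]
  refine Finset.sum_congr rfl fun σ _ => ?_
  rw [gram_transpose, gram_next hx hv σ (hm σ), gram_add_right, gram_add_right, gram_act_right,
    gram_act_right, gram_act_right, gram_act_right, hxv, hvx]
  simp [Matrix.mul_assoc]

theorem next_mem_pastSpan {x : Fin n → H} {v : Fin b → H} {K : S → Matrix (Fin n) (Fin b) ℝ}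
    (hx : ∀ i, x i ∈ Φ.pastSpan r t)
    (hv : ∀ σ i, Φ.op σ t (v i) ∈ Φ.pastSpan r (t + 1)) (i : Fin n) :
    Φ.next A K t x v i ∈ Φ.pastSpan r (t + 1) := by
  refine Submodule.sum_mem _ fun σ _ => ?_
  rw [Pi.add_apply, map_add]
  refine Submodule.add_mem _ (op_mem_pastSpan σ t (act_mem _ hx i)) ?_
  rw [act, map_sum]
  exact Submodule.sum_mem _ fun j _ => by
    rw [map_smul]
    exact Submodule.smul_mem _ _ (hv σ j)

/-- Orthogonality of noise and past noise. -/
def White (Φ : ShiftSystem S H p) (r : ℤ → Fin a → H) : Prop :=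
  ∀ w : List S, w ≠ [] → ∀ t, gram (r t) (Φ.word r w t) = 0

theorem White.stationary {Q : Matrix (Fin a) (Fin a) ℝ} (h : Φ.White r)
    (hQ : ∀ t, gram (r t) (r t) = Q) : Φ.Stationary r := by
  intro w t t'
  by_cases hw : w = []
  · subst hw
    exact (hQ t).trans (hQ t').symm
  · rw [h w hw, h w hw]

theorem White.gram_eq_zero (h : Φ.White r) {f : Fin b → H} (hf : ∀ i, f i ∈ Φ.pastSpan r t) :
    gram (r t) f = 0 :=
  gram_eq_zero_of_mem_pastSpan hf fun w hw => h w hw t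

theorem White.gram_eq_zero' (h : Φ.White r) {f : Fin b → H} (hf : ∀ i, f i ∈ Φ.pastSpan r t) :
    gram f (r t) = 0 := by
  rw [← gram_transpose, h.gram_eq_zero hf, Matrix.transpose_zero]

theorem White.gram_word_ne (h : Φ.White r) (hr : Φ.Adapted r) (w v : List S) (hwv : w ≠ v)
    (t : ℤ) : gram (Φ.word r w t) (Φ.word r v t) = 0 := by
  induction w using List.reverseRecOn generalizing v t with
  | nil => exact h v hwv.symm t
  | append_singleton w σ ih =>
    induction v using List.reverseRecOn with
    | nil =>
      rw [← gram_transpose]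
      exact (congrArg _ (h _ hwv t)).trans Matrix.transpose_zero
    | append_singleton v τ _ =>
      rw [← sub_add_cancel t 1]
      by_cases hστ : σ = τ
      · subst hστ
        rw [gram_word_snoc_same hr hr]
        exact ih _ (fun h => hwv (by rw [h])) _
      · rw [gram_word_snoc_ne hr hr _ _ hστ]

/-! ### Covariances of a state driven by white noise, and of its output. -/

section Forward

variable {v : ℤ → Fin a → H} {x : ℤ → Fin n → H} {Q : Matrix (Fin a) (Fin a) ℝ}

theorem White.gram_state_word (hw : Φ.White v) (hv : Φ.Adapted v)
    (hQ : ∀ t, gram (v t) (v t) = Q) (hx : ∀ t i, x t i ∈ Φ.past t)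
    (hxv : ∀ t, gram (x t) (v t) = 0) (hstate : ∀ t, x (t + 1) = Φ.next A K t (x t) (v t))
    (w : List S) (t t' : ℤ) :
    gram (x t) (Φ.word v w t) = gram (x t') (Φ.word v w t') := by
  induction w using List.reverseRecOn generalizing t t' with
  | nil => exact (hxv t).trans (hxv t').symm
  | append_singleton w σ ih =>
    have key : ∀ t, gram (x t) (Φ.word v (w ++ [σ]) t)
        = A σ * gram (x (t - 1)) (Φ.word v w (t - 1))
          + K σ * gram (v (t - 1)) (Φ.word v w (t - 1)) := by
      intro t
      have h1 := hstate (t - 1)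
      have h2 := word_snoc_succ Φ v w σ (t - 1)
      rw [sub_add_cancel] at h1 h2
      rw [h1, h2, gram_next (hx _) (hv _) σ (hv.word w _)]
    rw [key, key, ih (t - 1) (t' - 1), hw.stationary hQ w (t - 1) (t' - 1)]

variable [CompleteSpace H]

/-- Stability plays no role here: membership of the state in the past of the noise, and the
constancy of its covariances with the noise words, are enough. -/
theorem White.gram_state_self (hw : Φ.White v) (hv : Φ.Adapted v)
    (hQ : ∀ t, gram (v t) (v t) = Q) (hx : ∀ t i, x t i ∈ Φ.pastSpan v t)
    (hstate : ∀ t, x (t + 1) = Φ.next A K t (x t) (v t)) (t t' : ℤ) :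
    gram (x t) (x t) = gram (x t') (x t') :=
  (hw.stationary hQ).gram_self_eq hv hx (fun w _ => hw.gram_state_word hv hQ
    (fun t i => hv.pastSpan_le_past t (hx t i)) (fun t => hw.gram_eq_zero' (hx t)) hstate w) t t'

/-- Since the covariance is constant, the one-step update formula is a fixed-point equation for it.
-/
theorem White.gram_state_lyapunov (hw : Φ.White v) (hv : Φ.Adapted v)
    (hQ : ∀ t, gram (v t) (v t) = Q) (hx : ∀ t i, x t i ∈ Φ.pastSpan v t)
    (hstate : ∀ t, x (t + 1) = Φ.next A K t (x t) (v t)) (t : ℤ) :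
    gram (x t) (x t)
      = ∑ σ, A σ * gram (x t) (x t) * (A σ)ᵀ + ∑ σ, K σ * Q * (K σ)ᵀ := by
  conv_lhs => rw [hw.gram_state_self hv hQ hx hstate t (t + 1), hstate t]
  rw [gram_next_self (fun i => hv.pastSpan_le_past t (hx t i)) (hv t) (hw.gram_eq_zero' (hx t)),
    hQ t]

variable {C : Matrix (Fin d) (Fin n) ℝ} {D : Matrix (Fin d) (Fin a) ℝ} {y : ℤ → Fin d → H}

omit [CompleteSpace H] in
theorem pastSpan_output_le (hx : ∀ t i, x t i ∈ Φ.pastSpan v t)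
    (hy : ∀ t, y t = act C (x t) + act D (v t)) (t : ℤ) : Φ.pastSpan y t ≤ Φ.pastSpan v t := by
  refine pastSpan_le_pastSpan (fun σ t i => ?_) t
  rw [hy, Pi.add_apply, map_add]
  refine Submodule.add_mem _ (op_mem_pastSpan σ t (act_mem _ (hx t) i)) ?_
  rw [act, map_sum]
  exact Submodule.sum_mem _ fun j _ => by
    rw [map_smul]
    exact Submodule.smul_mem _ _ (op_self_mem_pastSpan σ t j)

omit [CompleteSpace H] in
theorem Adapted.output (hv : Φ.Adapted v) (hx : ∀ t i, x t i ∈ Φ.pastSpan v t)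
    (hy : ∀ t, y t = act C (x t) + act D (v t)) : Φ.Adapted y := by
  intro t i
  rw [hy]
  exact Submodule.add_mem _ (act_mem _ (fun j => hv.pastSpan_le_past t (hx t j)) i)
    (act_mem _ (hv t) i)

/-- Each last letter removed contributes a factor `A τ`. The noise is orthogonal to the past
outputs, so it enters only at the first letter `σ`, where it meets the output at the same time. -/
theorem White.gram_state_output_word (hw : Φ.White v) (hv : Φ.Adapted v)
    (hQ : ∀ t, gram (v t) (v t) = Q) (hx : ∀ t i, x t i ∈ Φ.pastSpan v t)
    (hstate : ∀ t, x (t + 1) = Φ.next A K t (x t) (v t))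
    (hy : ∀ t, y t = act C (x t) + act D (v t)) {X : Matrix (Fin n) (Fin n) ℝ}
    (hX : gram (x 0) (x 0) = X) (σ : S) (w : List S) (t : ℤ) :
    gram (x t) (Φ.word y (σ :: w) t)
      = wordProd A w * (A σ * X * Cᵀ + K σ * Q * Dᵀ) := by
  have hya := hv.output hx hy
  have hxp : ∀ t i, x t i ∈ Φ.past t := fun t i => hv.pastSpan_le_past t (hx t i)
  induction w using List.reverseRecOn generalizing t with
  | nil =>
    have h1 := hstate (t - 1)
    have h2 := word_snoc_succ Φ y [] σ (t - 1)
    rw [sub_add_cancel] at h1 h2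
    rw [List.nil_append] at h2
    rw [h1, h2, gram_next (hxp _) (hv _) σ (hya.word [] _), word_nil, hy, gram_add_right,
      gram_add_right, gram_act_right, gram_act_right, gram_act_right, gram_act_right,
      hw.gram_eq_zero (hx _), hw.gram_eq_zero' (hx _), hQ,
      hw.gram_state_self hv hQ hx hstate (t - 1) 0, hX]
    simp [Matrix.mul_assoc]
  | append_singleton w τ ih =>
    have h1 := hstate (t - 1)
    have h2 := word_snoc_succ Φ y (σ :: w) τ (t - 1)
    rw [sub_add_cancel] at h1 h2
    rw [← List.cons_append, h1, h2, gram_next (hxp _) (hv _) τ (hya.word _ _), ih,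
      hw.gram_eq_zero fun i => pastSpan_output_le hx hy _ (word_mem_pastSpan (by simp) _ i),
      wordProd_snoc]
    simp [Matrix.mul_assoc]

theorem White.gram_output_word (hw : Φ.White v) (hv : Φ.Adapted v)
    (hQ : ∀ t, gram (v t) (v t) = Q) (hx : ∀ t i, x t i ∈ Φ.pastSpan v t)
    (hstate : ∀ t, x (t + 1) = Φ.next A K t (x t) (v t))
    (hy : ∀ t, y t = act C (x t) + act D (v t)) {X : Matrix (Fin n) (Fin n) ℝ}
    (hX : gram (x 0) (x 0) = X) (σ : S) (w : List S) (t : ℤ) :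
    gram (y t) (Φ.word y (σ :: w) t)
      = C * (wordProd A w * (A σ * X * Cᵀ + K σ * Q * Dᵀ)) := by
  conv_lhs => rw [hy t]
  rw [gram_add_left, gram_act_left, gram_act_left,
    hw.gram_state_output_word hv hQ hx hstate hy hX,
    hw.gram_eq_zero fun i => pastSpan_output_le hx hy _ (word_mem_pastSpan (by simp) _ i)]
  simp

theorem White.stationary_output (hw : Φ.White v) (hv : Φ.Adapted v)
    (hQ : ∀ t, gram (v t) (v t) = Q) (hx : ∀ t i, x t i ∈ Φ.pastSpan v t)
    (hstate : ∀ t, x (t + 1) = Φ.next A K t (x t) (v t))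
    (hy : ∀ t, y t = act C (x t) + act D (v t)) : Φ.Stationary y := by
  rintro (_ | ⟨σ, w⟩) t t'
  · have key : ∀ t, gram (y t) (y t) = C * (gram (x 0) (x 0) * Cᵀ) + D * (Q * Dᵀ) := by
      intro t
      rw [hy, gram_add_left, gram_add_right, gram_add_right]
      simp only [gram_act_left, gram_act_right]
      rw [hw.gram_eq_zero (hx _), hw.gram_eq_zero' (hx _), hQ,
        hw.gram_state_self hv hQ hx hstate t 0]
      simp [Matrix.mul_assoc]
    exact (key t).trans (key t').symm
  · rw [hw.gram_output_word hv hQ hx hstate hy rfl, hw.gram_output_word hv hQ hx hstate hy rfl]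

end Forward

end ShiftSystem

namespace ShiftSystem

/-! #### Construction of a realization in forward innovation form -/

variable {S H : Type*} [Fintype S] [NormedAddCommGroup H] [InnerProductSpace ℝ H]
  {p : S → ℝ} {Φ : ShiftSystem S H p} {a b d n : ℕ}
  {y : ℤ → Fin d → H} {x : ℤ → Fin n → H} {A : S → Matrix (Fin n) (Fin n) ℝ}
  {B : S → Matrix (Fin n) (Fin d) ℝ} {C : Matrix (Fin d) (Fin n) ℝ}

/-- `x` is a state process for the output `y` with covariances `E[x(t) z_{σw}(t)ᵀ] = A_w B_σ` and
`E[y(t) z_{σw}(t)ᵀ] = C A_w B_σ`. -/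
structure IsStateFor (Φ : ShiftSystem S H p) (y : ℤ → Fin d → H) (x : ℤ → Fin n → H)
    (A : S → Matrix (Fin n) (Fin n) ℝ) (B : S → Matrix (Fin n) (Fin d) ℝ)
    (C : Matrix (Fin d) (Fin n) ℝ) : Prop where
  adapted : Φ.Adapted y
  stationary : Φ.Stationary y
  mem : ∀ t i, x t i ∈ Φ.pastSpan y t
  gram_state : ∀ σ w t, gram (x t) (Φ.word y (σ :: w) t) = wordProd A w * B σ
  gram_output : ∀ σ w t, gram (y t) (Φ.word y (σ :: w) t) = C * (wordProd A w * B σ)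

namespace IsStateFor

variable (h : Φ.IsStateFor y x A B C)

/-- The innovation `y(t) - C x(t)`. -/
def innov (_ : Φ.IsStateFor y x A B C) (t : ℤ) : Fin d → H := y t - act C (x t)

include h

theorem gram_innov_word {w : List S} (hw : w ≠ []) (t : ℤ) :
    gram (h.innov t) (Φ.word y w t) = 0 := by
  obtain ⟨σ, w, rfl⟩ := List.exists_cons_of_ne_nil hw
  rw [innov, gram_sub_left, gram_act_left, h.gram_state, h.gram_output, sub_self]

theorem gram_innov_eq_zero {f : Fin b → H} {t : ℤ} (hf : ∀ i, f i ∈ Φ.pastSpan y t) :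
    gram (h.innov t) f = 0 :=
  gram_eq_zero_of_mem_pastSpan hf fun _ hw => h.gram_innov_word hw t

theorem gram_innov_eq_zero' {f : Fin b → H} {t : ℤ} (hf : ∀ i, f i ∈ Φ.pastSpan y t) :
    gram f (h.innov t) = 0 := by
  rw [← gram_transpose, h.gram_innov_eq_zero hf, Matrix.transpose_zero]

theorem output_eq (t : ℤ) : y t = act C (x t) + h.innov t := by
  rw [innov, add_sub_cancel]

theorem state_mem_past (t : ℤ) (i : Fin n) : x t i ∈ Φ.past t :=
  h.adapted.pastSpan_le_past t (h.mem t i)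

theorem innov_adapted : Φ.Adapted h.innov := fun t i =>
  Submodule.sub_mem _ (h.adapted t i) (act_mem _ (h.state_mem_past t) i)

theorem op_innov_mem (σ : S) (t : ℤ) (i : Fin d) :
    Φ.op σ t (h.innov t i) ∈ Φ.pastSpan y (t + 1) := by
  rw [innov, Pi.sub_apply, map_sub]
  exact Submodule.sub_mem _ (op_self_mem_pastSpan σ t i)
    (op_mem_pastSpan σ t (act_mem _ (h.mem t) i))

theorem pastSpan_innov_le (t : ℤ) : Φ.pastSpan h.innov t ≤ Φ.pastSpan y t :=
  pastSpan_le_pastSpan h.op_innov_mem t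

/-- The past of the innovation is contained in the past of `y`, to which the innovation is
orthogonal. -/
theorem innov_white : Φ.White h.innov := fun _ hw t =>
  h.gram_innov_eq_zero fun i => h.pastSpan_innov_le t (word_mem_pastSpan hw t i)

theorem gram_state_output (t : ℤ) : gram (x t) (y t) = gram (x t) (x t) * Cᵀ := by
  conv_lhs => rw [h.output_eq t]
  rw [gram_add_right, gram_act_right, h.gram_innov_eq_zero' (h.mem t), add_zero]

theorem gram_innov_output (t : ℤ) : gram (h.innov t) (y t) = gram (h.innov t) (h.innov t) := by
  conv_lhs => rw [h.output_eq t]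
  rw [gram_add_right, gram_act_right, h.gram_innov_eq_zero (h.mem t), Matrix.zero_mul, zero_add]

theorem gram_innov_self (t : ℤ) :
    gram (h.innov t) (h.innov t) = gram (y t) (y t) - C * gram (x t) (x t) * Cᵀ := by
  rw [← gram_innov_output, innov, gram_sub_left, gram_act_left, gram_state_output h,
    Matrix.mul_assoc]

variable [CompleteSpace H]

theorem gram_state_self (t t' : ℤ) : gram (x t) (x t) = gram (x t') (x t') := by
  refine h.stationary.gram_self_eq h.adapted h.mem (fun w hw t t' => ?_) t t'
  obtain ⟨σ, w, rfl⟩ := List.exists_cons_of_ne_nil hw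
  rw [h.gram_state, h.gram_state]

theorem gram_innov_const (t : ℤ) :
    gram (h.innov t) (h.innov t) = gram (h.innov 0) (h.innov 0) := by
  rw [gram_innov_self, gram_innov_self, h.gram_state_self t 0]
  congr 1
  exact h.stationary [] t 0

omit [CompleteSpace H] in
theorem gram_state_op (σ : S) (t : ℤ) {f : Fin b → H} (hf : ∀ i, f i ∈ Φ.pastSpan y t) :
    gram (x (t + 1)) (fun i => Φ.op σ t (f i)) = A σ * gram (x t) f := by
  rw [← gram_act_left]
  ext i j
  rw [← sub_eq_zero]
  refine clm_eq_zero_of_mem_closure_span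
    ((innerSL ℝ (x (t + 1) i)).comp (Φ.op σ t) - innerSL ℝ (act (A σ) (x t) i)) ?_ (hf j)
  rintro _ ⟨w, hw, k, rfl⟩
  refine sub_eq_zero.2 ?_
  obtain ⟨τ, w, rfl⟩ := List.exists_cons_of_ne_nil hw
  have h1 := h.gram_state τ (w ++ [σ]) (t + 1)
  rw [← List.cons_append, word_snoc_succ, wordProd_snoc, Matrix.mul_assoc, ← h.gram_state τ w t,
    ← gram_act_left] at h1
  exact congrFun (congrFun h1 i) k

omit [CompleteSpace H] in
-- The innovation covariance may be singular. The equation is still solvable because its right-hand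
-- side is the covariance of `x 1` with `op σ 0` applied to the innovation, which vanishes on the
-- kernel.
theorem exists_gain (σ : S) :
    ∃ K : Matrix (Fin n) (Fin d) ℝ,
      K * gram (h.innov 0) (h.innov 0) = B σ - A σ * gram (x 0) (x 0) * Cᵀ := by
  refine exists_mul_eq_of_ker_le _ _ fun c hc => ?_
  -- A vector in the kernel of a Gram matrix is a linear relation between the vectors themselves.
  have h0 : ∑ i, c i • h.innov 0 i = 0 := by
    rw [← inner_self_eq_zero (𝕜 := ℝ), sum_inner]
    refine Finset.sum_eq_zero fun i _ => ?_
    rw [real_inner_smul_left, inner_sum]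
    have := congrFun hc i
    simp only [Matrix.mulVec, dotProduct, gram_apply, Pi.zero_apply] at this
    simp only [real_inner_smul_right, mul_comm (c _)]
    simp [this]
  have h1 : gram (x (0 + 1)) (fun i => Φ.op σ 0 (y 0 i)) = B σ := by
    have := h.gram_state σ [] (0 + 1)
    have h2 := Φ.word_snoc_succ y [] σ 0
    rw [List.nil_append] at h2
    rw [h2, word_nil, wordProd_nil, Matrix.one_mul] at this
    exact this
  have h2 : B σ - A σ * gram (x 0) (x 0) * Cᵀ
      = gram (x (0 + 1)) (fun i => Φ.op σ 0 (h.innov 0 i)) := by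
    have h3 : (fun i => Φ.op σ 0 (y 0 i))
        = (fun i => Φ.op σ 0 (act C (x 0) i)) + fun i => Φ.op σ 0 (h.innov 0 i) := by
      ext i
      conv_lhs => rw [h.output_eq 0]
      simp
    rw [← h1, h3, gram_add_right, h.gram_state_op σ 0 (act_mem _ (h.mem 0)), gram_act_right,
      Matrix.mul_assoc, add_sub_cancel_left]
  rw [h2]
  ext i
  have h4 : inner ℝ (x (0 + 1) i) (Φ.op σ 0 (∑ j, c j • h.innov 0 j)) = 0 := by
    rw [h0, map_zero, inner_zero_right]
  rw [map_sum, inner_sum] at h4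
  simpa [Matrix.mulVec, dotProduct, gram_apply, real_inner_smul_right, mul_comm] using h4

variable {K : S → Matrix (Fin n) (Fin d) ℝ}
  (hK : ∀ σ, K σ * gram (h.innov 0) (h.innov 0) = B σ - A σ * gram (x 0) (x 0) * Cᵀ)

include hK

/-- Both sides lie in the past of `y` at time `t + 1`, so it suffices to compare their covariances
with the words of `y`. -/
theorem state_eq (t : ℤ) : x (t + 1) = Φ.next A K t (x t) (h.innov t) := by
  refine eq_of_gram_eq_of_mem_pastSpan (h.mem (t + 1))
    (next_mem_pastSpan (h.mem t) fun σ i => h.op_innov_mem σ t i) fun w hw => ?_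
  obtain ⟨w, σ, rfl⟩ : ∃ v σ, w = v ++ [σ] :=
    ⟨w.dropLast, w.getLast hw, (List.dropLast_append_getLast hw).symm⟩
  rw [word_snoc_succ, gram_next (h.state_mem_past t) (h.innov_adapted t) σ
    (h.adapted.word w t)]
  -- The gain equation is what a single letter requires. For longer words the innovation term
  -- vanishes and the recursion of the state covariances remains.
  by_cases h0 : w = []
  · subst h0
    rw [word_nil, gram_state_output h, h.gram_innov_output, gram_innov_const h, hK,
      h.gram_state_self t 0, ← Matrix.mul_assoc, add_sub_cancel]
    have h1 := h.gram_state σ [] (t + 1)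
    have h2 := Φ.word_snoc_succ y [] σ t
    rw [List.nil_append] at h2
    rw [h2, word_nil, wordProd_nil, Matrix.one_mul] at h1
    exact h1
  · rw [h.gram_state_op σ t fun i => word_mem_pastSpan h0 t i,
      h.gram_innov_word h0, Matrix.mul_zero, add_zero]

/-- The past of the innovation is a priori smaller than the past of `y`. Stability closes the gap:
the state and its projection on the smaller space have covariances solving the same Lyapunov
equation, and a projection that preserves the covariance changes nothing. -/
theorem mem_pastSpan_innov (hA : IsStable (∑ σ, (A σ)ᵀ ⊗ₖ (A σ)ᵀ)) (t : ℤ) (i : Fin n) :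
    x t i ∈ Φ.pastSpan h.innov t := by
  let xh : ℤ → Fin n → H := fun t i => (Φ.pastSpan h.innov t).starProjection (x t i)
  have hxh : ∀ t i, xh t i ∈ Φ.pastSpan h.innov t := fun t i =>
    Submodule.starProjection_apply_mem _ _
  have horth : ∀ {b : ℕ} (t) (f : Fin b → H), (∀ i, f i ∈ Φ.pastSpan h.innov t) →
      gram (x t) f = gram (xh t) f := by
    intro b t f hf
    rw [← sub_eq_zero, ← gram_sub_left]
    ext i j
    exact Submodule.starProjection_inner_eq_zero _ _ (hf j)
  have hw := h.innov_white
  have hQ := h.gram_innov_const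
  have hxh' : ∀ t i, xh t i ∈ Φ.pastSpan y t := fun t i => h.pastSpan_innov_le t (hxh t i)
  have hxhp : ∀ t i, xh t i ∈ Φ.past t := fun t i => h.adapted.pastSpan_le_past t (hxh' t i)
  -- The projection obeys the same recursion: projecting leaves covariances with past innovation
  -- words unchanged, and both states are orthogonal to the current innovation.
  have hstate : ∀ t, xh (t + 1) = Φ.next A K t (xh t) (h.innov t) := by
    intro t
    refine eq_of_gram_eq_of_mem_pastSpan (hxh (t + 1))
      (next_mem_pastSpan (hxh t) fun σ i => op_self_mem_pastSpan σ t i) fun w hw => ?_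
    rw [← horth _ _ fun i => word_mem_pastSpan hw _ i, h.state_eq hK t]
    obtain ⟨v, σ, rfl⟩ : ∃ v σ, w = v ++ [σ] :=
      ⟨w.dropLast, w.getLast hw, (List.dropLast_append_getLast hw).symm⟩
    rw [word_snoc_succ, gram_next (h.state_mem_past t) (h.innov_adapted t) σ
      (h.innov_adapted.word v t), gram_next (hxhp t) (h.innov_adapted t) σ
      (h.innov_adapted.word v t)]
    congr 2
    by_cases h0 : v = []
    · subst h0
      rw [word_nil, h.gram_innov_eq_zero' (h.mem t), h.gram_innov_eq_zero' (hxh' t)]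
    · exact horth t _ fun i => word_mem_pastSpan h0 t i
  have h1 := hw.gram_state_lyapunov h.innov_adapted hQ hxh hstate t
  have h2 : gram (x t) (x t) = ∑ σ, A σ * gram (x t) (x t) * (A σ)ᵀ
      + ∑ σ, K σ * gram (h.innov 0) (h.innov 0) * (K σ)ᵀ := by
    conv_lhs => rw [h.gram_state_self t (t + 1), h.state_eq hK t]
    rw [gram_next_self (h.state_mem_past t) (h.innov_adapted t)
      (h.gram_innov_eq_zero' (h.mem t)), hQ t]
  have h3 : gram (x t) (x t) = gram (xh t) (xh t) :=
    (hA.existsUnique_lyapunov _).unique h2 h1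
  have h4 : x t = xh t := by
    refine eq_of_gram_sub_eq_zero ?_
    have h5 : gram (xh t) (x t) = gram (xh t) (xh t) := by
      rw [← gram_transpose, horth t (xh t) (hxh t), gram_transpose]
    rw [gram_sub_left, gram_sub_right, gram_sub_right, horth t (xh t) (hxh t), h3, h5]
    simp
  rw [h4]
  exact hxh t i

end IsStateFor

end ShiftSystem

/-! ### Square integrable random variables -/

section SquareIntegrable

variable {Ω : Type*} [MeasurableSpace Ω] (P : Measure Ω)

open Classical in
/-- The class in `L²(P)` of a square integrable random variable. -/
def toL2 (f : Ω → ℝ) : Lp ℝ 2 P := if h : MemLp f 2 P then h.toLp f else 0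

variable {P} {f g : Ω → ℝ}

theorem toL2_eq (h : MemLp f 2 P) : toL2 P f = h.toLp f := dif_pos h

theorem coeFn_toL2 (h : MemLp f 2 P) : toL2 P f =ᵐ[P] f := by
  rw [toL2_eq h]
  exact h.coeFn_toLp

theorem toL2_coeFn (f : Lp ℝ 2 P) : toL2 P f = f := by
  rw [toL2_eq (Lp.memLp f)]
  exact Lp.toLp_coeFn f _

theorem eq_toL2_iff (h : MemLp f 2 P) {x : Lp ℝ 2 P} : x = toL2 P f ↔ x =ᵐ[P] f := by
  constructor
  · rintro rfl
    exact coeFn_toL2 h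
  · exact fun hx => Lp.ext (hx.trans (coeFn_toL2 h).symm)

theorem toL2_eq_toL2_iff (hf : MemLp f 2 P) (hg : MemLp g 2 P) :
    toL2 P f = toL2 P g ↔ f =ᵐ[P] g := by
  rw [eq_toL2_iff hg]
  exact ⟨fun h => (coeFn_toL2 hf).symm.trans h, fun h => (coeFn_toL2 hf).trans h⟩

theorem toL2_add (hf : MemLp f 2 P) (hg : MemLp g 2 P) :
    toL2 P (fun ω => f ω + g ω) = toL2 P f + toL2 P g := by
  rw [toL2_eq hf, toL2_eq hg, toL2_eq (f := fun ω => f ω + g ω) (hf.add hg)]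
  rfl

theorem toL2_smul (c : ℝ) (hf : MemLp f 2 P) : toL2 P (fun ω => c * f ω) = c • toL2 P f := by
  rw [toL2_eq hf, toL2_eq (f := fun ω => c * f ω) (hf.const_mul c)]
  rfl

theorem toL2_sum {ι : Type*} (s : Finset ι) {F : ι → Ω → ℝ} (hF : ∀ i, MemLp (F i) 2 P) :
    toL2 P (fun ω => ∑ i ∈ s, F i ω) = ∑ i ∈ s, toL2 P (F i) := by
  classical
  induction s using Finset.induction_on with
  | empty =>
    simp only [Finset.sum_empty]
    rw [toL2_eq (f := fun _ => (0 : ℝ)) MemLp.zero]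
    rfl
  | insert i s hi ih =>
    simp only [Finset.sum_insert hi]
    rw [toL2_add (hF i) (memLp_finsetSum s fun i _ => hF i), ih]

theorem inner_toL2 (hf : MemLp f 2 P) (hg : MemLp g 2 P) :
    inner ℝ (toL2 P f) (toL2 P g) = ∫ ω, f ω * g ω ∂P := by
  rw [L2.inner_def]
  refine integral_congr_ae ?_
  filter_upwards [coeFn_toL2 hf, coeFn_toL2 hg] with ω h1 h2
  rw [h1, h2]
  simp [mul_comm]

/-- The coordinates of a square integrable random vector in `L²(P)`. -/
def vecL2 {ι : Type*} (P : Measure Ω) (f : Ω → ι → ℝ) : ι → Lp ℝ 2 P :=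
  fun i => toL2 P fun ω => f ω i

/-- Square integrability of all coordinates. -/
def IsL2 {ι : Type*} (P : Measure Ω) (f : Ω → ι → ℝ) : Prop := ∀ i, MemLp (fun ω => f ω i) 2 P

theorem gram_vecL2 {a b : ℕ} {f : Ω → Fin a → ℝ} {g : Ω → Fin b → ℝ} (hf : IsL2 P f)
    (hg : IsL2 P g) : gram (vecL2 P f) (vecL2 P g) = cov P f g := by
  ext i j
  exact inner_toL2 (hf i) (hg j)

theorem IsL2.mulVec {ι κ : Type*} [Fintype κ] {f : Ω → κ → ℝ} (hf : IsL2 P f) (M : Matrix ι κ ℝ) :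
    IsL2 P fun ω => M *ᵥ f ω := by
  intro i
  change MemLp (fun ω => ∑ j, M i j * f ω j) 2 P
  exact memLp_finsetSum _ fun j _ => (hf j).const_mul (M i j)

theorem IsL2.add {a : ℕ} {f g : Ω → Fin a → ℝ} (hf : IsL2 P f) (hg : IsL2 P g) :
    IsL2 P fun ω => f ω + g ω := fun i => (hf i).add (hg i)

theorem vecL2_mulVec {ι κ : Type*} [Fintype κ] {f : Ω → κ → ℝ} (hf : IsL2 P f)
    (M : Matrix ι κ ℝ) : vecL2 P (fun ω => M *ᵥ f ω) = act M (vecL2 P f) := by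
  ext1 i
  refine (toL2_sum (F := fun j ω => M i j * f ω j) Finset.univ fun j => (hf j).const_mul _).trans ?_
  exact Finset.sum_congr rfl fun j _ => toL2_smul _ (hf j)

theorem vecL2_add {a : ℕ} {f g : Ω → Fin a → ℝ} (hf : IsL2 P f) (hg : IsL2 P g) :
    vecL2 P (fun ω => f ω + g ω) = vecL2 P f + vecL2 P g := by
  ext1 i
  exact toL2_add (hf i) (hg i)

theorem vecL2_eq_iff {a : ℕ} {f g : Ω → Fin a → ℝ} (hf : IsL2 P f) (hg : IsL2 P g) :
    vecL2 P f = vecL2 P g ↔ f =ᵐ[P] g := by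
  rw [funext_iff]
  simp only [vecL2, toL2_eq_toL2_iff (hf _) (hg _)]
  constructor
  · intro h
    filter_upwards [ae_all_iff.2 h] with ω hω
    exact funext hω
  · intro h i
    filter_upwards [h] with ω hω
    rw [hω]

theorem IsL2.congr {a : ℕ} {f g : Ω → Fin a → ℝ} (hf : IsL2 P f) (h : f =ᵐ[P] g) : IsL2 P g :=
  fun i => (memLp_congr_ae (by filter_upwards [h] with ω hω; rw [hω])).1 (hf i)

/-- Multiplication by a bounded random variable, on `L²(P)`. -/
theorem exists_mulL2 {k : Ω → ℝ} (hk : Measurable k) {c : ℝ} (hc : ∀ ω, |k ω| ≤ c) :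
    ∃ T : Lp ℝ 2 P →L[ℝ] Lp ℝ 2 P, ∀ f : Ω → ℝ, MemLp f 2 P →
      T (toL2 P f) = toL2 P fun ω => k ω * f ω := by
  have hm : ∀ f : Ω → ℝ, MemLp f 2 P → MemLp (fun ω => k ω * f ω) 2 P := fun f hf =>
    hf.of_le_mul (hk.aestronglyMeasurable.mul hf.1) (c := c) (ae_of_all _ fun ω => by
      rw [norm_mul, Real.norm_eq_abs]
      exact mul_le_mul_of_nonneg_right (hc ω) (norm_nonneg _))
  have hcongr : ∀ f g : Ω → ℝ, f =ᵐ[P] g → MemLp f 2 P → MemLp g 2 P →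
      toL2 P (fun ω => k ω * f ω) = toL2 P fun ω => k ω * g ω := fun f g h hf hg => by
    rw [toL2_eq_toL2_iff (hm f hf) (hm g hg)]
    filter_upwards [h] with ω hω
    rw [hω]
  let T0 : Lp ℝ 2 P →ₗ[ℝ] Lp ℝ 2 P :=
    { toFun := fun f => toL2 P fun ω => k ω * f ω
      map_add' := fun f g => by
        rw [hcongr _ _ (Lp.coeFn_add f g) (Lp.memLp _) ((Lp.memLp f).add (Lp.memLp g)),
          ← toL2_add (hm _ (Lp.memLp f)) (hm _ (Lp.memLp g))]
        simp only [Pi.add_apply, mul_add]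
      map_smul' := fun a f => by
        rw [hcongr _ _ (Lp.coeFn_smul a f) (Lp.memLp _) ((Lp.memLp f).const_smul a),
          RingHom.id_apply, ← toL2_smul _ (hm _ (Lp.memLp f))]
        simp only [Pi.smul_apply, smul_eq_mul, mul_left_comm] }
  refine ⟨T0.mkContinuous c fun f => ?_, fun f hf =>
    hcongr _ _ (coeFn_toL2 hf) (Lp.memLp _) hf⟩
  refine Lp.norm_le_mul_norm_of_ae_le_mul ?_
  filter_upwards [coeFn_toL2 (hm f (Lp.memLp f))] with ω hω
  refine (le_of_eq (congrArg _ hω)).trans ?_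
  rw [norm_mul, Real.norm_eq_abs]
  exact mul_le_mul_of_nonneg_right (hc ω) (norm_nonneg _)

end SquareIntegrable

/-! ### Products with the inputs -/

section Words

variable {Ω S : Type*} {u : S → ℤ → Ω → ℝ} {p : S → ℝ} {a : ℕ}

theorem inputWord_nil (t : ℤ) (ω : Ω) : inputWord u [] t ω = 1 := rfl

theorem inputWord_cons (σ : S) (w : List S) (t : ℤ) (ω : Ω) :
    inputWord u (σ :: w) t ω = u σ (t - w.length) ω * inputWord u w t ω := by
  unfold inputWord
  refine (Fin.prod_univ_succ (n := w.length) _).trans ?_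
  congr 1
  · simp only [List.length_cons, Fin.val_zero]
    push_cast
    rw [add_zero, sub_add_eq_sub_sub, sub_add_cancel]
    rfl
  · refine Finset.prod_congr rfl fun i _ => ?_
    have : t - ((σ :: w).length : ℤ) + 1 + ((i.succ : ℕ) : ℤ)
        = t - w.length + 1 + ((i : ℕ) : ℤ) := by
      simp only [List.length_cons, Fin.val_succ]
      push_cast
      ring
    exact congrArg (fun s => u (w.get i) s ω) this

theorem inputWord_append (v w : List S) (t : ℤ) (ω : Ω) :
    inputWord u (v ++ w) t ω = inputWord u v (t - w.length) ω * inputWord u w t ω := by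
  induction v with
  | nil => simp [inputWord_nil]
  | cons σ v ih =>
    rw [List.cons_append, inputWord_cons, inputWord_cons, ih, mul_assoc]
    congr 2
    simp only [List.length_append]
    push_cast
    ring

theorem inputWord_singleton (σ : S) (t : ℤ) (ω : Ω) : inputWord u [σ] t ω = u σ t ω := by
  rw [inputWord_cons]
  simp [inputWord_nil]

theorem weight_append (v w : List S) : weight p (v ++ w) = weight p v * weight p w := by
  simp [weight]

theorem weight_pos (hp : ∀ σ, 0 < p σ) (w : List S) : 0 < weight p w := by
  induction w with
  | nil => simp [weight]
  | cons σ w ih =>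
    rw [← List.singleton_append, weight_append]
    exact mul_pos (by simpa [weight] using hp σ) ih

theorem sqrt_weight_append (hp : ∀ σ, 0 < p σ) (v w : List S) :
    √(weight p (v ++ w)) = √(weight p v) * √(weight p w) := by
  rw [weight_append, Real.sqrt_mul (weight_pos hp v).le]

theorem zPast_nil (r : ℤ → Ω → Fin a → ℝ) (t : ℤ) : zPast u p r [] t = r t := by
  ext ω
  simp [zPast, inputWord_nil, weight]

theorem zPast_snoc_succ (hp : ∀ σ, 0 < p σ) (r : ℤ → Ω → Fin a → ℝ) (w : List S) (σ : S) (t : ℤ)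
    (ω : Ω) (i : Fin a) :
    zPast u p r (w ++ [σ]) (t + 1) ω i = u σ t ω / √(p σ) * zPast u p r w t ω i := by
  have h1 : weight p [σ] = p σ := by simp [weight]
  have h2 : t + 1 - ((w ++ [σ]).length : ℤ) = t - w.length := by
    simp only [List.length_append, List.length_singleton]
    push_cast
    ring
  simp only [zPast, inputWord_append, inputWord_singleton, sqrt_weight_append hp, h1, h2,
    Pi.smul_apply, smul_eq_mul, add_sub_cancel_right, List.length_singleton, Nat.cast_one]
  ring

theorem zFuture_mul_zPast (hp : ∀ σ, 0 < p σ) {b : ℕ} (y : ℤ → Ω → Fin a → ℝ)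
    (r : ℤ → Ω → Fin b → ℝ)
    (v w : List S) (t : ℤ) (ω : Ω) (i : Fin a) (j : Fin b) :
    zFuture u p y w t ω i * zPast u p r v t ω j
      = y (t + w.length) ω i * zPast u p r (v ++ w) (t + w.length) ω j := by
  have h1 : t + w.length - 1 - (w.length : ℤ) = t - 1 := by ring
  have h2 : t + w.length - ((v ++ w).length : ℤ) = t - v.length := by
    simp only [List.length_append]
    push_cast
    ring
  simp only [zPast, zFuture, inputWord_append, sqrt_weight_append hp, h1, h2, Pi.smul_apply,
    smul_eq_mul]
  ring

end Words

/-! ### The shift system of a switching process -/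

section Switching

set_option linter.unusedSectionVars false

variable {Ω : Type*} [mΩ : MeasurableSpace Ω] {P : Measure Ω} [IsProbabilityMeasure P]
  {S : Type*} [Fintype S] [MeasurableSpace S] [MeasurableSingletonClass S]
  {θ : ℤ → Ω → S} {p : S → ℝ} {a b d n : ℕ}

/-- The i.i.d. switching process `θ` with law `p`. -/
structure IsSwitching (P : Measure Ω) (θ : ℤ → Ω → S) (p : S → ℝ) : Prop where
  meas : ∀ t, Measurable (θ t)
  pos : ∀ σ, 0 < p σ
  law : ∀ t σ, P.real {ω | θ t ω = σ} = p σ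

/-- The past `r(s)`, `s ≤ t`, `θ(s)`, `s < t`. -/
@[reducible] def pastSigma (θ : ℤ → Ω → S) (r : ℤ → Ω → Fin a → ℝ) (t : ℤ) : MeasurableSpace Ω :=
  sigmaGen r (Set.Iic t) ⊔ sigmaGen θ (Set.Iio t)

/-- A filtration for which `θ` is predictable, independent of the future of `θ`. -/
structure IsPast (P : Measure Ω) (θ : ℤ → Ω → S) (m : ℤ → MeasurableSpace Ω) : Prop where
  le : ∀ t, m t ≤ mΩ
  mono : Monotone m
  switch_le : ∀ t, sigmaGen θ (Set.Iio t) ≤ m t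
  indep : ∀ t, Indep (m t) (sigmaGen θ (Set.Ici t)) P

theorem comap_le_sigmaGen {X : Type*} [MeasurableSpace X] (f : ℤ → Ω → X) {I : Set ℤ} {t : ℤ}
    (ht : t ∈ I) : MeasurableSpace.comap (f t) inferInstance ≤ sigmaGen f I :=
  le_iSup₂_of_le t ht le_rfl

theorem sigmaGen_mono {X : Type*} [MeasurableSpace X] (f : ℤ → Ω → X) {I J : Set ℤ} (h : I ⊆ J) :
    sigmaGen f I ≤ sigmaGen f J :=
  biSup_mono h

theorem sigmaGen_le {X : Type*} [MeasurableSpace X] {f : ℤ → Ω → X} {m : MeasurableSpace Ω}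
    {I : Set ℤ} (h : ∀ t ∈ I, Measurable[m] (f t)) : sigmaGen f I ≤ m :=
  iSup₂_le fun t ht => (h t ht).comap_le

theorem IndepOfFuture.isPast (hθ : IsSwitching P θ p) {r : ℤ → Ω → Fin a → ℝ}
    (hr : ∀ t, Measurable (r t)) (h : IndepOfFuture P θ r) : IsPast P θ (pastSigma θ r) where
  le _ := sup_le (sigmaGen_le fun s _ => hr s) (sigmaGen_le fun s _ => hθ.meas s)
  mono _ _ hst := sup_le_sup (sigmaGen_mono r (Set.Iic_subset_Iic.2 hst))
    (sigmaGen_mono θ (Set.Iio_subset_Iio hst))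
  switch_le _ := le_sup_right
  indep := h

theorem aestronglyMeasurable_pastSigma (r : ℤ → Ω → Fin a → ℝ) (t : ℤ) (i : Fin a) :
    AEStronglyMeasurable[pastSigma θ r t] (fun ω => r t ω i) P := by
  have h1 : Measurable[pastSigma θ r t] (r t) :=
    Measurable.of_comap_le ((comap_le_sigmaGen r Set.self_mem_Iic).trans le_sup_left)
  have h2 : Measurable[pastSigma θ r t] fun ω => r t ω i := (measurable_pi_apply i).comp h1
  exact h2.aestronglyMeasurable

/-- Independence of the future only depends on almost sure equality classes. -/
theorem IsPast.indepOfFuture {m : ℤ → MeasurableSpace Ω} (hm : IsPast P θ m)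
    {r : ℤ → Ω → Fin a → ℝ}
    (hr : ∀ t i, AEStronglyMeasurable[m t] (fun ω => r t ω i) P) : IndepOfFuture P θ r := by
  intro t
  -- Enlarging the past by null sets preserves independence and makes almost everywhere measurable
  -- variables measurable.
  have h1 : Indep (eventuallyMeasurableSpace (m t) (ae P)) (sigmaGen θ (Set.Ici t)) P := by
    rw [Indep_iff]
    rintro s s' ⟨s₀, hs₀, hs⟩ hs'
    rw [measure_congr hs, ← (Indep_iff _ _ P).1 (hm.indep t) s₀ s' hs₀ hs']
    exact measure_congr (hs.inter (ae_eq_refl s'))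
  refine indep_of_indep_of_le_left h1 (sup_le (sigmaGen_le fun s hs => ?_)
    ((hm.switch_le t).trans le_eventuallyMeasurableSpace))
  refine (@measurable_pi_iff _ _ _ (eventuallyMeasurableSpace (m t) (ae P)) _ _).2 fun i => ?_
  have h2 : Measurable[m t] (hr s i).mk :=
    (hr s i).stronglyMeasurable_mk.measurable.mono (hm.mono hs) le_rfl
  exact h2.eventuallyMeasurable_of_eventuallyEq (hr s i).ae_eq_mk

theorem switch_eq_indicator (σ : S) (t : ℤ) :
    switch θ σ t = Set.indicator {ω | θ t ω = σ} fun _ => (1 : ℝ) := by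
  ext ω
  simp [switch, Set.indicator]

theorem switch_mul_self (σ : S) (t : ℤ) (ω : Ω) :
    switch θ σ t ω * switch θ σ t ω = switch θ σ t ω := by
  unfold switch
  split_ifs <;> simp

theorem switch_mul_ne {σ τ : S} (h : σ ≠ τ) (t : ℤ) (ω : Ω) :
    switch θ σ t ω * switch θ τ t ω = 0 := by
  unfold switch
  split_ifs with h1 h2
  · exact absurd (h1.symm.trans h2) h
  all_goals simp

theorem sum_switch (t : ℤ) (ω : Ω) : ∑ σ, switch θ σ t ω = 1 := by
  classical
  unfold switch
  rw [Finset.sum_eq_single (θ t ω)]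
  · simp
  · exact fun σ _ h => if_neg (Ne.symm h)
  · simp

theorem abs_switch_le (σ : S) (t : ℤ) (ω : Ω) : |switch θ σ t ω| ≤ 1 := by
  unfold switch
  split_ifs <;> simp

theorem measurable_switch_comap (σ : S) (t : ℤ) :
    Measurable[MeasurableSpace.comap (θ t) inferInstance] (switch θ σ t) := by
  classical
  have h : switch θ σ t = (fun s => if s = σ then (1 : ℝ) else 0) ∘ θ t := by
    ext ω
    simp [switch]
  rw [h]
  exact (measurable_of_countable _).comp (comap_measurable (θ t))

theorem IsSwitching.measurable_switch (hθ : IsSwitching P θ p) (σ : S) (t : ℤ) :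
    Measurable (switch θ σ t) :=
  (measurable_switch_comap σ t).mono (hθ.meas t).comap_le le_rfl

theorem IsSwitching.integral_switch (hθ : IsSwitching P θ p) (σ : S) (t : ℤ) :
    ∫ ω, switch θ σ t ω ∂P = p σ := by
  rw [← hθ.law t σ, switch_eq_indicator, integral_indicator_const _
    (measurableSet_eq_fun (hθ.meas t) measurable_const)]
  simp

/-- Independence of the past and the present switch enters the covariance computations here; it is
what makes the normalized operators isometric on the past. -/
theorem IsSwitching.integral_switch_mul (hθ : IsSwitching P θ p) {m : ℤ → MeasurableSpace Ω}
    (hm : IsPast P θ m) (σ : S) (t : ℤ) {f : Ω → ℝ} (hf : AEStronglyMeasurable[m t] f P) :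
    ∫ ω, switch θ σ t ω * f ω ∂P = p σ * ∫ ω, f ω ∂P := by
  have h1 : IndepFun (hf.mk f) (switch θ σ t) P := by
    rw [IndepFun_iff_Indep]
    exact indep_of_indep_of_le_left (indep_of_indep_of_le_right (hm.indep t)
      ((measurable_switch_comap σ t).comap_le.trans (comap_le_sigmaGen θ Set.self_mem_Ici)))
      hf.stronglyMeasurable_mk.measurable.comap_le
  have h2 := h1.integral_fun_mul_eq_mul_integral
    (hf.stronglyMeasurable_mk.mono (hm.le t)).aestronglyMeasurable
    (hθ.measurable_switch σ t).aestronglyMeasurable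
  rw [hθ.integral_switch, ← integral_congr_ae hf.ae_eq_mk] at h2
  rw [mul_comm (p σ), ← h2]
  refine integral_congr_ae ?_
  filter_upwards [hf.ae_eq_mk] with ω hω
  rw [hω, mul_comm]

theorem IsSwitching.abs_switch_div_le (hθ : IsSwitching P θ p) (σ : S) (t : ℤ) (ω : Ω) :
    |switch θ σ t ω / √(p σ)| ≤ 1 / √(p σ) := by
  rw [abs_div, abs_of_pos (Real.sqrt_pos.2 (hθ.pos σ))]
  gcongr
  exact abs_switch_le σ t ω

theorem IsSwitching.memLp_switch_mul (hθ : IsSwitching P θ p) (σ : S) (t : ℤ) {f : Ω → ℝ}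
    (hf : MemLp f 2 P) : MemLp (fun ω => switch θ σ t ω / √(p σ) * f ω) 2 P :=
  hf.of_le_mul (((hθ.measurable_switch σ t).div_const _).aestronglyMeasurable.mul hf.1)
    (c := 1 / √(p σ)) (ae_of_all _ fun ω => by
      rw [norm_mul, Real.norm_eq_abs]
      exact mul_le_mul_of_nonneg_right (hθ.abs_switch_div_le σ t ω) (norm_nonneg _))

/-- Multiplication by `u_σ(t) / √p_σ`. -/
def IsSwitching.mulSwitch (hθ : IsSwitching P θ p) (σ : S) (t : ℤ) : Lp ℝ 2 P →L[ℝ] Lp ℝ 2 P :=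
  (exists_mulL2 ((hθ.measurable_switch σ t).div_const (√(p σ)))
    (hθ.abs_switch_div_le σ t)).choose

theorem IsSwitching.mulSwitch_toL2 (hθ : IsSwitching P θ p) (σ : S) (t : ℤ) {f : Ω → ℝ}
    (hf : MemLp f 2 P) :
    hθ.mulSwitch σ t (toL2 P f) = toL2 P fun ω => switch θ σ t ω / √(p σ) * f ω :=
  (exists_mulL2 ((hθ.measurable_switch σ t).div_const (√(p σ)))
    (hθ.abs_switch_div_le σ t)).choose_spec f hf

theorem IsPast.measurable_switch {m : ℤ → MeasurableSpace Ω} (hm : IsPast P θ m) (σ : S) (t : ℤ) :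
    Measurable[m (t + 1)] (switch θ σ t) :=
  (measurable_switch_comap σ t).mono ((comap_le_sigmaGen θ (Set.mem_Iio.2 (lt_add_one t))).trans
    (hm.switch_le (t + 1))) le_rfl

/-- The shift system on `L²(P)`. -/
def IsSwitching.shiftSystem (hθ : IsSwitching P θ p) {m : ℤ → MeasurableSpace Ω}
    (hm : IsPast P θ m) : ShiftSystem S (Lp ℝ 2 P) p where
  past t := lpMeas ℝ ℝ (m t) 2 P
  isClosed_past t := isClosed_aestronglyMeasurable (hm.le t)
  op := hθ.mulSwitch
  op_mem σ t f hf := by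
    rw [mem_lpMeas_iff_aestronglyMeasurable] at hf ⊢
    rw [← toL2_coeFn f, hθ.mulSwitch_toL2 σ t (Lp.memLp f)]
    refine AEStronglyMeasurable.congr ?_
      (coeFn_toL2 (hθ.memLp_switch_mul σ t (Lp.memLp f))).symm
    have h1 : Measurable[m (t + 1)] fun ω => switch θ σ t ω / √(p σ) :=
      (hm.measurable_switch σ t).div_const _
    exact h1.aestronglyMeasurable.mul (hf.mono (hm.mono (by omega)))
  inner_op_same σ t f g hf hg := by
    rw [mem_lpMeas_iff_aestronglyMeasurable] at hf hg
    rw [← toL2_coeFn f, ← toL2_coeFn g, hθ.mulSwitch_toL2 σ t (Lp.memLp f),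
      hθ.mulSwitch_toL2 σ t (Lp.memLp g), inner_toL2 (Lp.memLp f) (Lp.memLp g),
      inner_toL2 (hθ.memLp_switch_mul σ t (Lp.memLp f)) (hθ.memLp_switch_mul σ t (Lp.memLp g))]
    have h1 : ∀ ω, switch θ σ t ω / √(p σ) * f ω * (switch θ σ t ω / √(p σ) * g ω)
        = (p σ)⁻¹ * (switch θ σ t ω * (f ω * g ω)) := by
      intro ω
      have h2 : √(p σ) * √(p σ) = p σ := Real.mul_self_sqrt (hθ.pos σ).le
      rw [← switch_mul_self σ t ω]
      conv_rhs => rw [← h2]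
      rw [switch_mul_self]
      field_simp
      rw [sq, switch_mul_self]
    have h3 := hθ.integral_switch_mul hm σ t (f := fun ω => f ω * g ω) (hf.mul hg)
    simp only [h1]
    rw [integral_const_mul, h3, ← mul_assoc, inv_mul_cancel₀ (hθ.pos σ).ne', one_mul]
  inner_op_ne σ τ t f g hστ hf hg := by
    rw [← toL2_coeFn f, ← toL2_coeFn g, hθ.mulSwitch_toL2 σ t (Lp.memLp f),
      hθ.mulSwitch_toL2 τ t (Lp.memLp g),
      inner_toL2 (hθ.memLp_switch_mul σ t (Lp.memLp f)) (hθ.memLp_switch_mul τ t (Lp.memLp g))]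
    have h1 : ∀ ω, switch θ σ t ω / √(p σ) * f ω * (switch θ τ t ω / √(p τ) * g ω) = 0 := by
      intro ω
      calc _ = (switch θ σ t ω * switch θ τ t ω) * (f ω * g ω / (√(p σ) * √(p τ))) := by
            field_simp
        _ = 0 := by rw [switch_mul_ne hστ, zero_mul]
    simp [h1]
  sum_op t f := by
    rw [← toL2_coeFn f]
    simp only [hθ.mulSwitch_toL2 _ t (Lp.memLp f)]
    have h1 : ∀ σ, √(p σ) • toL2 P (fun ω => switch θ σ t ω / √(p σ) * f ω)
        = toL2 P fun ω => √(p σ) * (switch θ σ t ω / √(p σ) * f ω) := fun σ =>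
      (toL2_smul _ (hθ.memLp_switch_mul σ t (Lp.memLp f))).symm
    simp only [h1]
    rw [← toL2_sum (F := fun σ ω => √(p σ) * (switch θ σ t ω / √(p σ) * f ω)) Finset.univ
      fun σ => (hθ.memLp_switch_mul σ t (Lp.memLp f)).const_mul _]
    congr 1
    ext ω
    have h2 : ∀ σ, √(p σ) * (switch θ σ t ω / √(p σ) * f ω) = switch θ σ t ω * f ω := by
      intro σ
      have := (Real.sqrt_pos.2 (hθ.pos σ)).ne'
      field_simp
    simp only [h2]
    rw [← Finset.sum_mul, sum_switch, one_mul]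

end Switching

/-! ### Processes as elements of the shift system -/

section Processes

set_option linter.unusedSectionVars false

variable {Ω : Type*} [mΩ : MeasurableSpace Ω] {P : Measure Ω} [IsProbabilityMeasure P]
  {S : Type*} [Fintype S] [MeasurableSpace S] [MeasurableSingletonClass S]
  {θ : ℤ → Ω → S} {p : S → ℝ} {a b d n : ℕ} {m : ℤ → MeasurableSpace Ω}
  {r : ℤ → Ω → Fin a → ℝ}

/-- A vector process as a process in `L²(P)`. -/
def lift (P : Measure Ω) (r : ℤ → Ω → Fin a → ℝ) : ℤ → Fin a → Lp ℝ 2 P := fun t => vecL2 P (r t)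

/-! ### Dictionary between random vectors and the shift system. -/

namespace IsSwitching

variable (hθ : IsSwitching P θ p) (hm : IsPast P θ m)

theorem adapted_iff (hr : ∀ t, IsL2 P (r t)) :
    (hθ.shiftSystem hm).Adapted (lift P r)
      ↔ ∀ t i, AEStronglyMeasurable[m t] (fun ω => r t ω i) P := by
  refine forall₂_congr fun t i => ?_
  refine (mem_lpMeas_iff_aestronglyMeasurable (𝕜 := ℝ)).trans ?_
  exact ⟨fun h => h.congr (coeFn_toL2 (hr t i)), fun h => h.congr (coeFn_toL2 (hr t i)).symm⟩

/-- The two claims are proved together, since applying the operator to the class of the shorter word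
needs that word to be square integrable. -/
theorem isL2_zPast_and_word (hr : ∀ t, IsL2 P (r t)) (w : List S) (t : ℤ) :
    IsL2 P (zPast (switch θ) p r w t) ∧
      (hθ.shiftSystem hm).word (lift P r) w t = vecL2 P (zPast (switch θ) p r w t) := by
  induction w using List.reverseRecOn generalizing t with
  | nil =>
    rw [zPast_nil]
    exact ⟨hr t, rfl⟩
  | append_singleton w σ ih =>
    obtain ⟨h1, h2⟩ := ih (t - 1)
    rw [← sub_add_cancel t 1, ShiftSystem.word_snoc_succ, h2]
    have h3 : ∀ i, (fun ω => zPast (switch θ) p r (w ++ [σ]) (t - 1 + 1) ω i)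
        = fun ω => switch θ σ (t - 1) ω / √(p σ) * zPast (switch θ) p r w (t - 1) ω i := fun i => by
      ext ω
      exact zPast_snoc_succ hθ.pos r w σ (t - 1) ω i
    constructor
    · intro i
      rw [h3]
      exact hθ.memLp_switch_mul σ _ (h1 i)
    · ext1 i
      refine (hθ.mulSwitch_toL2 σ (t - 1) (h1 i)).trans ?_
      rw [vecL2, h3]

theorem word_lift (hr : ∀ t, IsL2 P (r t)) (w : List S) (t : ℤ) :
    (hθ.shiftSystem hm).word (lift P r) w t = vecL2 P (zPast (switch θ) p r w t) :=
  (hθ.isL2_zPast_and_word hm hr w t).2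

include hθ hm in
theorem isL2_zPast (hr : ∀ t, IsL2 P (r t)) (w : List S) (t : ℤ) :
    IsL2 P (zPast (switch θ) p r w t) :=
  (hθ.isL2_zPast_and_word hm hr w t).1

theorem hilbertSpan_pastVars (hr : ∀ t, IsL2 P (r t)) (t : ℤ) :
    hilbertSpan P (pastVars (switch θ) p r t) = (hθ.shiftSystem hm).pastSpan (lift P r) t := by
  unfold hilbertSpan ShiftSystem.pastSpan
  congr 2
  ext g
  constructor
  · rintro ⟨_, ⟨⟨w, hw⟩, i, rfl⟩, hg⟩
    refine ⟨w, hw, i, ?_⟩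
    rw [hθ.word_lift hm hr]
    exact (eq_toL2_iff (hθ.isL2_zPast hm hr w t i)).2 hg
  · rintro ⟨w, hw, i, rfl⟩
    refine ⟨_, ⟨⟨w, hw⟩, i, rfl⟩, ?_⟩
    rw [hθ.word_lift hm hr]
    exact coeFn_toL2 (hθ.isL2_zPast hm hr w t i)

theorem inHilbertSpan_iff (hr : ∀ t, IsL2 P (r t)) (t : ℤ) {f : Ω → ℝ} (hf : MemLp f 2 P) :
    InHilbertSpan P (pastVars (switch θ) p r t) f
      ↔ toL2 P f ∈ (hθ.shiftSystem hm).pastSpan (lift P r) t := by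
  rw [InHilbertSpan, hθ.hilbertSpan_pastVars hm hr]
  constructor
  · rintro ⟨g, hg, hgf⟩
    rwa [← (eq_toL2_iff hf).2 hgf]
  · exact fun h => ⟨_, h, coeFn_toL2 hf⟩

theorem gram_word_lift {s : ℤ → Ω → Fin b → ℝ} (hr : ∀ t, IsL2 P (r t)) (hs : ∀ t, IsL2 P (s t))
    (w v : List S) (t t' : ℤ) :
    gram ((hθ.shiftSystem hm).word (lift P r) w t) ((hθ.shiftSystem hm).word (lift P s) v t')
      = cov P (zPast (switch θ) p r w t) (zPast (switch θ) p s v t') := by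
  rw [hθ.word_lift hm hr, hθ.word_lift hm hs,
    gram_vecL2 (hθ.isL2_zPast hm hr w t) (hθ.isL2_zPast hm hs v t')]

theorem gram_lift_word {s : ℤ → Ω → Fin b → ℝ} (hr : ∀ t, IsL2 P (r t)) (hs : ∀ t, IsL2 P (s t))
    (v : List S) (t t' : ℤ) :
    gram (lift P r t) ((hθ.shiftSystem hm).word (lift P s) v t')
      = cov P (r t) (zPast (switch θ) p s v t') := by
  have := hθ.gram_word_lift hm hr hs [] v t t'
  rwa [zPast_nil] at this

include hθ in
theorem isL2_next {x : Ω → Fin n → ℝ} {v : Ω → Fin a → ℝ} (hx : IsL2 P x) (hv : IsL2 P v)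
    (A : S → Matrix (Fin n) (Fin n) ℝ) (K : S → Matrix (Fin n) (Fin a) ℝ) (t : ℤ) :
    IsL2 P fun ω => ∑ σ, switch θ σ t ω • (A σ *ᵥ x ω + K σ *ᵥ v ω) := by
  intro i
  simp only [Finset.sum_apply, Pi.smul_apply, smul_eq_mul]
  refine memLp_finsetSum _ fun σ _ => ?_
  refine (((hx.mulVec (A σ)).add (hv.mulVec (K σ))) i).of_le_mul
    ((hθ.measurable_switch σ t).aestronglyMeasurable.mul
      (((hx.mulVec (A σ)).add (hv.mulVec (K σ))) i).1) (c := 1) (ae_of_all _ fun ω => ?_)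
  rw [norm_mul, Real.norm_eq_abs]
  exact mul_le_mul_of_nonneg_right (abs_switch_le σ t ω) (norm_nonneg _)

/-- The factors `√(p σ)` on the matrices cancel the normalization `1 / √(p σ)` of the operators. -/
theorem next_vecL2 {x : Ω → Fin n → ℝ} {v : Ω → Fin a → ℝ} (hx : IsL2 P x) (hv : IsL2 P v)
    (A : S → Matrix (Fin n) (Fin n) ℝ) (K : S → Matrix (Fin n) (Fin a) ℝ) (t : ℤ) :
    (hθ.shiftSystem hm).next (fun σ => √(p σ) • A σ) (fun σ => √(p σ) • K σ) t (vecL2 P x)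
        (vecL2 P v)
      = vecL2 P fun ω => ∑ σ, switch θ σ t ω • (A σ *ᵥ x ω + K σ *ᵥ v ω) := by
  ext1 i
  have h1 : ∀ σ, IsL2 P fun ω => (√(p σ) • A σ) *ᵥ x ω + (√(p σ) • K σ) *ᵥ v ω := fun σ =>
    (hx.mulVec _).add (hv.mulVec _)
  have h2 : ∀ σ, act (√(p σ) • A σ) (vecL2 P x) + act (√(p σ) • K σ) (vecL2 P v)
      = vecL2 P fun ω => (√(p σ) • A σ) *ᵥ x ω + (√(p σ) • K σ) *ᵥ v ω := fun σ => by
    rw [vecL2_add (hx.mulVec _) (hv.mulVec _), vecL2_mulVec hx, vecL2_mulVec hv]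
  unfold ShiftSystem.next
  simp only [h2]
  have h3 : ∀ σ, (hθ.shiftSystem hm).op σ t
      (vecL2 P (fun ω => (√(p σ) • A σ) *ᵥ x ω + (√(p σ) • K σ) *ᵥ v ω) i)
        = toL2 P fun ω => switch θ σ t ω / √(p σ)
          * ((√(p σ) • A σ) *ᵥ x ω + (√(p σ) • K σ) *ᵥ v ω) i := fun σ =>
    hθ.mulSwitch_toL2 σ t (h1 σ i)
  simp only [h3]
  rw [← toL2_sum (F := fun σ ω => switch θ σ t ω / √(p σ)
          * ((√(p σ) • A σ) *ᵥ x ω + (√(p σ) • K σ) *ᵥ v ω) i) Finset.univ fun σ =>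
    hθ.memLp_switch_mul σ t (h1 σ i), vecL2]
  congr 1
  ext ω
  rw [Finset.sum_apply]
  refine Finset.sum_congr rfl fun σ _ => ?_
  have := (Real.sqrt_pos.2 (hθ.pos σ)).ne'
  simp only [Matrix.smul_mulVec, Pi.add_apply, Pi.smul_apply, smul_eq_mul]
  field_simp

theorem inputCov_eq (hr : ∀ t, IsL2 P (r t)) (ha : (hθ.shiftSystem hm).Adapted (lift P r)) (σ : S) :
    inputCov P (switch θ) r σ = p σ • gram (lift P r 0) (lift P r 0) := by
  rw [hθ.adapted_iff hm hr] at ha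
  rw [lift, gram_vecL2 (hr 0) (hr 0)]
  ext i j
  have h1 := hθ.integral_switch_mul hm σ 0 (f := fun ω => r 0 ω i * r 0 ω j)
    ((ha 0 i).mul (ha 0 j))
  simp only [inputCov, cov, Matrix.of_apply, Pi.smul_apply, smul_eq_mul, Matrix.smul_apply, ← h1]
  refine integral_congr_ae (ae_of_all _ fun ω => ?_)
  change _ = switch θ σ 0 ω * (r 0 ω i * r 0 ω j)
  rw [← switch_mul_self]
  ring

theorem integral_zPast (hr : ∀ t, IsL2 P (r t)) (ha : (hθ.shiftSystem hm).Adapted (lift P r))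
    (h0 : ∀ t i, ∫ ω, r t ω i ∂P = 0) (w : List S) (t : ℤ) (i : Fin a) :
    ∫ ω, zPast (switch θ) p r w t ω i ∂P = 0 := by
  induction w using List.reverseRecOn generalizing t with
  | nil =>
    rw [zPast_nil]
    exact h0 t i
  | append_singleton w σ ih =>
    have h1 : AEStronglyMeasurable[m (t - 1)]
        (fun ω => zPast (switch θ) p r w (t - 1) ω i) P := by
      have h2 := ha.word w (t - 1) i
      rw [hθ.word_lift hm hr] at h2
      exact (mem_lpMeas_iff_aestronglyMeasurable.1 h2).congr
        (coeFn_toL2 (hθ.isL2_zPast hm hr w (t - 1) i))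
    have h2 := hθ.integral_switch_mul hm σ (t - 1) h1
    rw [ih, mul_zero] at h2
    conv_lhs => rw [← sub_add_cancel t 1]
    simp only [zPast_snoc_succ hθ.pos, div_mul_eq_mul_div]
    rw [integral_div, h2, zero_div]

theorem integral_eq_zero_of_mem_pastSpan (hr : ∀ t, IsL2 P (r t))
    (ha : (hθ.shiftSystem hm).Adapted (lift P r)) (h0 : ∀ t i, ∫ ω, r t ω i ∂P = 0) {t : ℤ}
    {f : Ω → ℝ} (hf : MemLp f 2 P)
    (hmem : toL2 P f ∈ (hθ.shiftSystem hm).pastSpan (lift P r) t) : ∫ ω, f ω ∂P = 0 := by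
  have h1 : MemLp (fun _ : Ω => (1 : ℝ)) 2 P := memLp_const 1
  -- Having mean zero is orthogonality to the constant `1`, hence inherited by closed spans.
  have h2 : inner ℝ (toL2 P fun _ => (1 : ℝ)) (toL2 P f) = 0 := by
    refine inner_eq_zero_of_mem_closure_span ?_ hmem
    rintro _ ⟨w, _, i, rfl⟩
    rw [hθ.word_lift hm hr, vecL2, inner_toL2 h1 (hθ.isL2_zPast hm hr w t i)]
    simpa using hθ.integral_zPast hm hr ha h0 w t i
  rw [inner_toL2 h1 hf] at h2
  simpa using h2

theorem isZeroMeanWSS_zPast (hr : ∀ t, IsL2 P (r t))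
    (ha : (hθ.shiftSystem hm).Adapted (lift P r)) (h0 : ∀ t i, ∫ ω, r t ω i ∂P = 0)
    (hst : (hθ.shiftSystem hm).Stationary (lift P r)) :
    IsZeroMeanWSS P (zPast (switch θ) p r) where
  memLp w t i := hθ.isL2_zPast hm hr w t i
  mean_zero w t i := hθ.integral_zPast hm hr ha h0 w t i
  cov_shift w v s t k := by
    have := hst.gram_word_shift ha w v s t k
    rwa [hθ.gram_word_lift hm hr hr, hθ.gram_word_lift hm hr hr] at this

theorem stationary_of_isZeroMeanWSS (hr : ∀ t, IsL2 P (r t))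
    (h : IsZeroMeanWSS P (zPast (switch θ) p r)) :
    (hθ.shiftSystem hm).Stationary (lift P r) := by
  intro w t t'
  rw [hθ.gram_lift_word hm hr hr, hθ.gram_lift_word hm hr hr]
  have := h.cov_shift [] w t' t' (t - t')
  rwa [add_sub_cancel, zPast_nil, zPast_nil] at this

theorem isRC_of_white (hr : ∀ t, IsL2 P (r t))
    (ha : (hθ.shiftSystem hm).Adapted (lift P r)) (h0 : ∀ t i, ∫ ω, r t ω i ∂P = 0)
    (hst : (hθ.shiftSystem hm).Stationary (lift P r)) :
    IsRC P (switch θ) p r where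
  wss := hθ.isZeroMeanWSS_zPast hm hr ha h0 hst
  letters t σ σ' hσ := by
    rw [← hθ.gram_word_lift hm hr hr, ← sub_add_cancel t 1]
    exact ShiftSystem.gram_word_snoc_ne ha ha [] [] hσ (t - 1)
  rec_same t w v σ _ _ := by
    have h1 := hst.gram_word ha w v (t - 1) t
    rw [← ShiftSystem.gram_word_snoc_same ha ha w v σ, sub_add_cancel,
      hθ.gram_word_lift hm hr hr, hθ.gram_word_lift hm hr hr] at h1
    exact h1
  rec_ne t w v σ σ' _ _ hσ := by
    rw [← hθ.gram_word_lift hm hr hr, ← sub_add_cancel t 1]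
    exact ShiftSystem.gram_word_snoc_ne ha ha w v hσ (t - 1)
  letter_same t w σ _ := by
    have h1 := hst.gram_word ha w [] (t - 1) t
    rw [← ShiftSystem.gram_word_snoc_same ha ha w [] σ, sub_add_cancel,
      hθ.gram_word_lift hm hr hr, ← gram_transpose, ShiftSystem.word_nil,
      hθ.gram_lift_word hm hr hr] at h1
    exact h1
  letter_ne t w σ σ' _ hσ := by
    rw [← hθ.gram_word_lift hm hr hr, ← sub_add_cancel t 1]
    exact ShiftSystem.gram_word_snoc_ne ha ha w [] hσ (t - 1)

theorem cov_zPast_eq_smul (w : List S) (t : ℤ) :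
    cov P (r t) (zPast (switch θ) p r w t)
      = (1 / √(weight p w)) •
        (cov P (fun ω => inputWord (switch θ) w (t - 1) ω • r (t - w.length) ω) (r t))ᵀ := by
  ext i j
  simp only [cov, zPast, Matrix.of_apply, Matrix.smul_apply, Matrix.transpose_apply,
    Pi.smul_apply, smul_eq_mul, ← integral_const_mul]
  refine integral_congr_ae (ae_of_all _ fun ω => ?_)
  ring

theorem white_iff (hr : ∀ t, IsL2 P (r t)) :
    (hθ.shiftSystem hm).White (lift P r) ↔
      ∀ t l (w : List S), t < l → (w.length : ℤ) = l - t →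
        cov P (fun ω => inputWord (switch θ) w (l - 1) ω • r t ω) (r l) = 0 := by
  have h1 : ∀ (w : List S) (t : ℤ), gram (lift P r t)
      ((hθ.shiftSystem hm).word (lift P r) w t) = 0 ↔
        cov P (fun ω => inputWord (switch θ) w (t - 1) ω • r (t - w.length) ω) (r t) = 0 := by
    intro w t
    rw [hθ.gram_lift_word hm hr hr, cov_zPast_eq_smul, smul_eq_zero_iff_right
      (one_div_ne_zero (Real.sqrt_pos.2 (weight_pos hθ.pos w)).ne'),
      Matrix.transpose_eq_zero]
  constructor
  · intro h t l w htl hw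
    have hw0 : w ≠ [] := by
      rintro rfl
      simp at hw
      omega
    have := (h1 w l).1 (h w hw0 l)
    rwa [show l - (w.length : ℤ) = t by omega] at this
  · intro h w hw t
    have hlen : 0 < w.length := List.length_pos_of_ne_nil hw
    exact (h1 w t).2 (h _ _ w (by omega) (by omega))

theorem outputSeries_eq {y : ℤ → Ω → Fin d → ℝ} (hy : ∀ t, IsL2 P (y t)) (j : Fin d × S)
    (w : List S) (i : Fin d) :
    outputSeries P (switch θ) p y j w i
      = gram (lift P y 0) ((hθ.shiftSystem hm).word (lift P y) (j.2 :: w) 0) i j.1 := by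
  rw [hθ.gram_lift_word hm hy hy]
  rfl

theorem measurable_inputWord (hθ : IsSwitching P θ p) (w : List S) (t : ℤ) :
    Measurable (inputWord (switch θ) w t) :=
  Finset.measurable_prod _ fun _ _ => hθ.measurable_switch _ _

theorem abs_inputWord_le (w : List S) (t : ℤ) (ω : Ω) : |inputWord (switch θ) w t ω| ≤ 1 := by
  rw [inputWord, Finset.abs_prod]
  exact Finset.prod_le_one (fun _ _ => abs_nonneg _) fun _ _ => abs_switch_le _ _ _

theorem isL2_zFuture (hθ : IsSwitching P θ p) (hr : ∀ t, IsL2 P (r t)) (w : List S) (t : ℤ) :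
    IsL2 P (zFuture (switch θ) p r w t) := by
  intro i
  refine (hr (t + w.length) i).of_le_mul
    (((hθ.measurable_inputWord w (t + w.length - 1)).div_const _).aestronglyMeasurable.mul
      (hr (t + w.length) i).1) (c := 1 / √(weight p w)) (ae_of_all _ fun ω => ?_)
  change ‖inputWord (switch θ) w (t + w.length - 1) ω / √(weight p w) * r (t + w.length) ω i‖
    ≤ 1 / √(weight p w) * ‖r (t + w.length) ω i‖
  rw [norm_mul, Real.norm_eq_abs, abs_div, abs_of_pos (Real.sqrt_pos.2 (weight_pos hθ.pos w))]
  gcongr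
  exact abs_inputWord_le _ _ _

/-- The switching factors of the future output can be moved to the past one, which concatenates the
two words. This is the Hankel structure. -/
theorem gram_zFuture (hr : ∀ t, IsL2 P (r t)) (w v : List S) (t : ℤ) :
    gram (vecL2 P (zFuture (switch θ) p r w t)) ((hθ.shiftSystem hm).word (lift P r) v t)
      = gram (lift P r (t + w.length))
        ((hθ.shiftSystem hm).word (lift P r) (v ++ w) (t + w.length)) := by
  rw [hθ.word_lift hm hr, gram_vecL2 (hθ.isL2_zFuture hr w t) (hθ.isL2_zPast hm hr v t),
    hθ.gram_lift_word hm hr hr]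
  ext i j
  simp only [cov, Matrix.of_apply, zFuture_mul_zPast hθ.pos]

end IsSwitching

end Processes

/-! ### The representation of a realization -/

section Realizations

set_option linter.unusedSectionVars false

variable {Ω : Type*} [mΩ : MeasurableSpace Ω] {P : Measure Ω} [IsProbabilityMeasure P]
  {S : Type*} [Fintype S] [MeasurableSpace S] [MeasurableSingletonClass S]
  {θ : ℤ → Ω → S} {p : S → ℝ} {k d n : ℕ} {m : ℤ → MeasurableSpace Ω}

theorem sum_smul_kronecker (hp : ∀ σ, 0 < p σ) (A : S → Matrix (Fin n) (Fin n) ℝ) :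
    ∑ σ, p σ • ((A σ)ᵀ ⊗ₖ (A σ)ᵀ) = ∑ σ, (√(p σ) • A σ)ᵀ ⊗ₖ (√(p σ) • A σ)ᵀ := by
  refine Finset.sum_congr rfl fun σ _ => ?_
  rw [Matrix.transpose_smul, Matrix.smul_kronecker, Matrix.kronecker_smul, smul_smul,
    Real.mul_self_sqrt (hp σ).le]

theorem smul_mul_smul_transpose {a b : ℕ} {c : ℝ} (hc : 0 ≤ c) (A : Matrix (Fin a) (Fin b) ℝ)
    (X : Matrix (Fin b) (Fin b) ℝ) :
    (√c • A) * X * (√c • A)ᵀ = A * (c • X) * Aᵀ := by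
  rw [Matrix.transpose_smul, Matrix.smul_mul, Matrix.smul_mul, Matrix.mul_smul, smul_smul,
    Real.mul_self_sqrt hc, Matrix.mul_smul, Matrix.smul_mul]

/-- A realization, in terms of the shift system on `L²(P)`. -/
structure GBS.IsL2Realization (B : GBS Ω S n k d) (hθ : IsSwitching P θ p) (hm : IsPast P θ m)
    (y : ℤ → Ω → Fin d → ℝ) : Prop where
  noise_L2 : ∀ t, IsL2 P (B.v t)
  state_L2 : ∀ t, IsL2 P (B.x t)
  output_L2 : ∀ t, IsL2 P (y t)
  noise_mean : ∀ t i, ∫ ω, B.v t ω i ∂P = 0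
  adapted : (hθ.shiftSystem hm).Adapted (lift P B.v)
  white : (hθ.shiftSystem hm).White (lift P B.v)
  gram_noise : ∀ t, gram (lift P B.v t) (lift P B.v t) = gram (lift P B.v 0) (lift P B.v 0)
  state_mem : ∀ t i, lift P B.x t i ∈ (hθ.shiftSystem hm).pastSpan (lift P B.v) t
  state_eq : ∀ t, lift P B.x (t + 1) = (hθ.shiftSystem hm).next (fun σ => √(p σ) • B.A σ)
    (fun σ => √(p σ) • B.K σ) t (lift P B.x t) (lift P B.v t)
  output_eq : ∀ t, lift P y t = act B.C (lift P B.x t) + act B.D (lift P B.v t)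
  stable : IsStable (∑ σ, (√(p σ) • B.A σ)ᵀ ⊗ₖ (√(p σ) • B.A σ)ᵀ)

theorem GBS.IsJMLSIIDRealization.isL2Realization {B : GBS Ω S n k d} {y : ℤ → Ω → Fin d → ℝ}
    (hB : B.IsJMLSIIDRealization P θ p y) (hθ : IsSwitching P θ p) :
    B.IsL2Realization hθ (hB.1.noise_indep.isPast hθ hB.1.noise_meas) y := by
  obtain ⟨hJ, hR⟩ := hB
  have hm := hJ.noise_indep.isPast hθ hJ.noise_meas
  have hv : ∀ t, IsL2 P (B.v t) := fun t i => hJ.noise_wss.memLp () t i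
  have hx : ∀ t, IsL2 P (B.x t) := fun t i => by
    obtain ⟨g, _, hg⟩ := hJ.state_mem t i
    exact (memLp_congr_ae hg).1 (Lp.memLp g)
  have hy' : ∀ t, IsL2 P fun ω => B.C *ᵥ B.x t ω + B.D *ᵥ B.v t ω := fun t =>
    ((hx t).mulVec B.C).add ((hv t).mulVec B.D)
  have hy : ∀ t, IsL2 P (y t) := fun t =>
    (hy' t).congr (by filter_upwards [hR.output_eq t] with ω hω using hω.symm)
  exact
  { noise_L2 := hv
    state_L2 := hx
    output_L2 := hy
    noise_mean := fun t i => hJ.noise_wss.mean_zero () t i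
    adapted := (hθ.adapted_iff hm hv).2 (aestronglyMeasurable_pastSigma B.v)
    white := (hθ.white_iff hm hv).2 hJ.noise_white
    gram_noise := fun t => by
      rw [lift, gram_vecL2 (hv t) (hv t), lift, gram_vecL2 (hv 0) (hv 0)]
      have := hJ.noise_wss.cov_shift () () 0 0 t
      rwa [zero_add] at this
    state_mem := fun t i => (hθ.inHilbertSpan_iff hm hv t (hx t i)).1 (hJ.state_mem t i)
    state_eq := fun t => by
      refine Eq.trans ?_ (hθ.next_vecL2 hm (hx t) (hv t) B.A B.K t).symm
      exact (vecL2_eq_iff (hx (t + 1)) (hθ.isL2_next (hx t) (hv t) B.A B.K t)).2 (hR.state_eq t)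
    output_eq := fun t => by
      refine ((vecL2_eq_iff (hy t) (hy' t)).2 (hR.output_eq t)).trans ?_
      rw [vecL2_add ((hx t).mulVec _) ((hv t).mulVec _), vecL2_mulVec (hx t),
        vecL2_mulVec (hv t)]
      rfl
    stable := sum_smul_kronecker hθ.pos B.A ▸ hJ.stable }

namespace GBS.IsL2Realization

variable {B : GBS Ω S n k d} {y : ℤ → Ω → Fin d → ℝ} {hθ : IsSwitching P θ p} {hm : IsPast P θ m}
  (h : B.IsL2Realization hθ hm y)

include h

theorem inputCov_noise (σ : S) :
    inputCov P (switch θ) B.v σ = p σ • gram (lift P B.v 0) (lift P B.v 0) :=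
  hθ.inputCov_eq hm h.noise_L2 h.adapted σ

/-- The right-hand side of the equations depends on `σ` only through the factor `p σ`, so a solution
has the form `p σ • W` with a common `W`. This `W` solves the Lyapunov equation of the state
covariance, whose solution is unique by stability. -/
theorem lyapunov_iff (X : S → Matrix (Fin n) (Fin n) ℝ) :
    B.Lyapunov P (switch θ) p X ↔ X = fun σ => p σ • gram (lift P B.x 0) (lift P B.x 0) := by
  set Z := gram (lift P B.x 0) (lift P B.x 0) with hZ
  set Q := gram (lift P B.v 0) (lift P B.v 0) with hQ
  have h1 : Z = ∑ σ, (√(p σ) • B.A σ) * Z * (√(p σ) • B.A σ)ᵀ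
      + ∑ σ, (√(p σ) • B.K σ) * Q * (√(p σ) • B.K σ)ᵀ :=
    h.white.gram_state_lyapunov h.adapted h.gram_noise h.state_mem h.state_eq 0
  have h2 : ∀ W : Matrix (Fin n) (Fin n) ℝ, ∑ σ, (√(p σ) • B.A σ) * W * (√(p σ) • B.A σ)ᵀ
      + ∑ σ, (√(p σ) • B.K σ) * Q * (√(p σ) • B.K σ)ᵀ
      = ∑ σ, (B.A σ * (p σ • W) * (B.A σ)ᵀ
        + B.K σ * inputCov P (switch θ) B.v σ * (B.K σ)ᵀ) := by
    intro W
    rw [← Finset.sum_add_distrib]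
    refine Finset.sum_congr rfl fun σ _ => ?_
    rw [h.inputCov_noise, smul_mul_smul_transpose (hθ.pos σ).le,
      smul_mul_smul_transpose (hθ.pos σ).le]
  constructor
  · intro hX
    set W := ∑ τ, (B.A τ * X τ * (B.A τ)ᵀ
      + B.K τ * inputCov P (switch θ) B.v τ * (B.K τ)ᵀ) with hW
    have hXW : X = fun σ => p σ • W := funext hX
    have h3 : W = Z := by
      refine (h.stable.existsUnique_lyapunov _).unique ?_ h1
      rw [h2 W]
      conv_lhs => rw [hW, hXW]
    rw [hXW, h3]
  · rintro rfl σ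
    dsimp only
    rw [← h2, ← h1]

theorem existsUnique_lyapunov : ∃! X, B.Lyapunov P (switch θ) p X := by
  simp only [h.lyapunov_iff]
  exact ⟨_, rfl, fun _ h => h⟩

theorem represents {X : S → Matrix (Fin n) (Fin n) ℝ} (hX : B.Lyapunov P (switch θ) p X) :
    (B.rep P (switch θ) p X).Represents (outputSeries P (switch θ) p y) := by
  rw [h.lyapunov_iff] at hX
  subst hX
  rintro ⟨j, σ⟩ w
  ext i
  rw [hθ.outputSeries_eq hm h.output_L2, h.white.gram_output_word h.adapted h.gram_noise
    h.state_mem h.state_eq h.output_eq rfl]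
  have h1 : √(p σ) ≠ 0 := (Real.sqrt_pos.2 (hθ.pos σ)).ne'
  have h3 : 1 / √(p σ) * p σ = √(p σ) := by
    rw [one_div, inv_mul_eq_div, Real.div_sqrt]
  have h2 : ((1 / √(p σ)) • (B.A σ * (p σ • gram (lift P B.x 0) (lift P B.x 0)) * B.Cᵀ
      + B.K σ * inputCov P (switch θ) B.v σ * B.Dᵀ))
      = (√(p σ) • B.A σ) * gram (lift P B.x 0) (lift P B.x 0) * B.Cᵀ
        + (√(p σ) • B.K σ) * gram (lift P B.v 0) (lift P B.v 0) * B.Dᵀ := by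
    rw [h.inputCov_noise]
    simp only [Matrix.mul_smul, Matrix.smul_mul, smul_add, smul_smul, h3]
  simp only [GBS.rep, h2]
  rw [← Matrix.mul_assoc]
  rfl

theorem realizabilityConditions : RealizabilityConditions P θ p y := by
  have ha := h.adapted.output h.state_mem h.output_eq
  have hmean : ∀ t i, ∫ ω, y t ω i ∂P = 0 := by
    intro t i
    have h1 : ∀ i, ∫ ω, B.x t ω i ∂P = 0 := fun i =>
      hθ.integral_eq_zero_of_mem_pastSpan hm h.noise_L2 h.adapted h.noise_mean
        (h.state_L2 t i) (h.state_mem t i)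
    have h2 : y t =ᵐ[P] fun ω => B.C *ᵥ B.x t ω + B.D *ᵥ B.v t ω := by
      rw [← vecL2_eq_iff (h.output_L2 t) (((h.state_L2 t).mulVec B.C).add
        ((h.noise_L2 t).mulVec B.D)), vecL2_add ((h.state_L2 t).mulVec _)
        ((h.noise_L2 t).mulVec _), vecL2_mulVec (h.state_L2 t), vecL2_mulVec (h.noise_L2 t)]
      exact h.output_eq t
    have h3 : ∀ {a b : ℕ} (M : Matrix (Fin a) (Fin b) ℝ) {f : Ω → Fin b → ℝ}, IsL2 P f →
        (∀ i, ∫ ω, f ω i ∂P = 0) → ∀ i, ∫ ω, (M *ᵥ f ω) i ∂P = 0 := by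
      intro a b M f hf hf0 i
      simp only [Matrix.mulVec, dotProduct]
      rw [integral_finsetSum _ fun j _ => ((hf j).integrable one_le_two).const_mul _]
      simp [integral_const_mul, hf0]
    calc ∫ ω, y t ω i ∂P = ∫ ω, (B.C *ᵥ B.x t ω) i + (B.D *ᵥ B.v t ω) i ∂P :=
          integral_congr_ae (by filter_upwards [h2] with ω hω; rw [hω]; rfl)
      _ = 0 := by
          rw [integral_add (((h.state_L2 t).mulVec B.C i).integrable one_le_two)
            (((h.noise_L2 t).mulVec B.D i).integrable one_le_two), h3 _ (h.state_L2 t) h1,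
            h3 _ (h.noise_L2 t) (h.noise_mean t), add_zero]
  obtain ⟨X, hX, _⟩ := h.existsUnique_lyapunov
  have hrep := h.represents hX
  exact
  { wss := hθ.isZeroMeanWSS_zPast hm h.output_L2 ha hmean
      (h.white.stationary_output h.adapted h.gram_noise h.state_mem h.state_eq h.output_eq)
    -- The output is measurable, up to null sets, with respect to the past generated by noise and
    -- switching, and so inherits its independence of the future.
    indep := hm.indepOfFuture ((hθ.adapted_iff hm h.output_L2).1 ha)
    rational := ⟨n, _, hrep⟩
    squareSummable := hrep.isSquareSummable h.stable }

end GBS.IsL2Realization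

end Realizations

/-! ### Realizations in forward innovation form -/

section Construction

set_option linter.unusedSectionVars false

variable {Ω : Type*} [mΩ : MeasurableSpace Ω] {P : Measure Ω} [IsProbabilityMeasure P]
  {S : Type*} [Fintype S] [MeasurableSpace S] [MeasurableSingletonClass S]
  {θ : ℤ → Ω → S} {p : S → ℝ} {d n : ℕ} {m : ℤ → MeasurableSpace Ω}

theorem linProj_ae_eq {G : Set (Ω → ℝ)} {f : Ω → ℝ} (hf : MemLp f 2 P) {g : Lp ℝ 2 P}
    (hg : g ∈ hilbertSpan P G) (h : ∀ k ∈ hilbertSpan P G, inner ℝ (toL2 P f - g) k = 0) :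
    linProj P G f =ᵐ[P] g := by
  rw [linProj, dif_pos hf, ← toL2_eq hf,
    Submodule.eq_starProjection_of_mem_of_inner_eq_zero hg h]

theorem inputCov_congr {u : S → ℤ → Ω → ℝ} {r r' : ℤ → Ω → Fin d → ℝ} (h : r 0 =ᵐ[P] r' 0)
    (σ : S) : inputCov P u r σ = inputCov P u r' σ := by
  ext i j
  refine integral_congr_ae ?_
  filter_upwards [h] with ω hω
  simp only [hω]

theorem isUnit_of_rank_eq {M : Matrix (Fin d) (Fin d) ℝ} (h : M.rank = d) : IsUnit M := by
  rw [← Matrix.mulVec_surjective_iff_isUnit]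
  change Function.Surjective M.mulVecLin
  rw [← LinearMap.range_eq_top]
  exact Submodule.eq_top_of_finrank_eq (by simpa [Matrix.rank] using h)

/-- The process in `L²(P)` as a process of random vectors. -/
def unlift (r : ℤ → Fin n → Lp ℝ 2 P) (t : ℤ) (ω : Ω) : Fin n → ℝ := fun i => r t i ω

theorem isL2_unlift (r : ℤ → Fin n → Lp ℝ 2 P) (t : ℤ) : IsL2 P (unlift r t) := fun i =>
  Lp.memLp (r t i)

theorem vecL2_unlift (r : ℤ → Fin n → Lp ℝ 2 P) (t : ℤ) : vecL2 P (unlift r t) = r t := by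
  ext1 i
  exact toL2_coeFn (r t i)

theorem lift_unlift (r : ℤ → Fin n → Lp ℝ 2 P) : lift P (unlift r) = r := by
  ext1 t
  exact vecL2_unlift r t

theorem measurable_unlift (r : ℤ → Fin n → Lp ℝ 2 P) (t : ℤ) : Measurable (unlift r t) :=
  measurable_pi_iff.2 fun i => (Lp.stronglyMeasurable (r t i)).measurable

/-! ### The state obtained by projecting future outputs on the past. -/

namespace IsSwitching

variable (hθ : IsSwitching P θ p) (hm : IsPast P θ m) {y : ℤ → Ω → Fin d → ℝ}
  {R : Rep S (Fin d × S) d n}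

/-- The matrices `B_σ = [B_{1,σ}, …, B_{d,σ}]` of a representation. -/
def _root_.JumpLinear.Rep.inputMatrix (R : Rep S (Fin d × S) d n) (σ : S) :
    Matrix (Fin n) (Fin d) ℝ := Matrix.of fun i j => R.B (j, σ) i

theorem gram_output_word_of_represents (hy : ∀ t, IsL2 P (y t))
    (hst : (hθ.shiftSystem hm).Stationary (lift P y))
    (hR : R.Represents (outputSeries P (switch θ) p y)) (σ : S) (w : List S) (t : ℤ) :
    gram (lift P y t) ((hθ.shiftSystem hm).word (lift P y) (σ :: w) t)
      = R.C * (wordProd R.A w * R.inputMatrix σ) := by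
  rw [hst (σ :: w) t 0]
  ext i j
  have h1 := congrFun (hR (j, σ) w) i
  rw [hθ.outputSeries_eq hm hy] at h1
  rw [h1, ← Matrix.mul_assoc]
  rfl

/-- The stacked future outputs `Y_n(t)`. -/
def _root_.JumpLinear.futureVec (u : S → ℤ → Ω → ℝ) (p : S → ℝ) (y : ℤ → Ω → Fin d → ℝ) (n : ℕ)
    (t : ℤ) (ω : Ω) : ShortWord S n × Fin d → ℝ :=
  fun a => zFuture u p y (List.ofFn a.1.2) t ω a.2

theorem isL2_futureVec (hθ : IsSwitching P θ p) (hy : ∀ t, IsL2 P (y t)) (t : ℤ) :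
    IsL2 P (futureVec (switch θ) p y n t) := fun a => hθ.isL2_zFuture hy _ t a.2

theorem gram_futureVec_word (hy : ∀ t, IsL2 P (y t))
    (hst : (hθ.shiftSystem hm).Stationary (lift P y))
    (hR : R.Represents (outputSeries P (switch θ) p y)) (σ : S) (w : List S) (t : ℤ) :
    gram (vecL2 P (futureVec (switch θ) p y n t))
        ((hθ.shiftSystem hm).word (lift P y) (σ :: w) t)
      = R.obs * (wordProd R.A w * R.inputMatrix σ) := by
  ext a j
  have h1 := hθ.gram_zFuture hm hy (List.ofFn a.1.2) (σ :: w) t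
  rw [List.cons_append, hθ.gram_output_word_of_represents hm hy hst hR, wordProd_append,
    Matrix.mul_assoc, ← Matrix.mul_assoc] at h1
  exact congrFun (congrFun h1 a.2) j

/-- The state `E_l[O⁻¹ Y_n(t) | {z_w(t) : w ≠ ε}]`. -/
def projState (y : ℤ → Ω → Fin d → ℝ) (Oinv : Matrix (Fin n) (ShortWord S n × Fin d) ℝ) (t : ℤ)
    (i : Fin n) : Lp ℝ 2 P :=
  ((hθ.shiftSystem hm).pastSpan (lift P y) t).starProjection
    (vecL2 P (fun ω => Oinv *ᵥ futureVec (switch θ) p y n t ω) i)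

/-- Projection on the past does not change covariances with past words. Those of `Y_n(t)` are `O_R
A_w B_σ`, and the left inverse removes `O_R`. -/
theorem isStateFor_projState (hy : ∀ t, IsL2 P (y t))
    (ha : (hθ.shiftSystem hm).Adapted (lift P y))
    (hst : (hθ.shiftSystem hm).Stationary (lift P y))
    (hR : R.Represents (outputSeries P (switch θ) p y))
    {Oinv : Matrix (Fin n) (ShortWord S n × Fin d) ℝ} (hO : Oinv * R.obs = 1) :
    (hθ.shiftSystem hm).IsStateFor (lift P y) (hθ.projState hm y Oinv) R.A R.inputMatrix R.C where
  adapted := ha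
  stationary := hst
  mem _ _ := Submodule.starProjection_apply_mem _ _
  gram_state σ w t := by
    have h1 : gram (hθ.projState hm y Oinv t) ((hθ.shiftSystem hm).word (lift P y) (σ :: w) t)
        = gram (vecL2 P (fun ω => Oinv *ᵥ futureVec (switch θ) p y n t ω))
          ((hθ.shiftSystem hm).word (lift P y) (σ :: w) t) := by
      refine (sub_eq_zero.1 ?_).symm
      rw [← gram_sub_left]
      ext i j
      have hk := ShiftSystem.word_mem_pastSpan (Φ := hθ.shiftSystem hm) (r := lift P y)
        (List.cons_ne_nil σ w) t j
      exact Submodule.starProjection_inner_eq_zero _ _ hk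
    rw [h1, vecL2_mulVec (hθ.isL2_futureVec hy t), gram_act_left,
      hθ.gram_futureVec_word hm hy hst hR, ← Matrix.mul_assoc, hO, Matrix.one_mul]
  gram_output := hθ.gram_output_word_of_represents hm hy hst hR

end IsSwitching

/-! ### From the abstract state process back to a system of random vectors. -/

namespace ShiftSystem.IsStateFor

variable {hθ : IsSwitching P θ p} {hm : IsPast P θ m} {y : ℤ → Ω → Fin d → ℝ}
  {R : Rep S (Fin d × S) d n} {x : ℤ → Fin n → Lp ℝ 2 P}
  (h : (hθ.shiftSystem hm).IsStateFor (lift P y) x R.A R.inputMatrix R.C)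

/-- The system in forward innovation form with a given state process and gains. -/
def system (K : S → Matrix (Fin n) (Fin d) ℝ) : GBS Ω S n d d where
  A σ := (1 / √(p σ)) • R.A σ
  K σ := (1 / √(p σ)) • K σ
  C := R.C
  D := 1
  x := unlift x
  v := unlift h.innov

variable {K : S → Matrix (Fin n) (Fin d) ℝ}

theorem sqrt_smul_system_A (σ : S) : √(p σ) • (h.system K).A σ = R.A σ := by
  rw [system, smul_smul, mul_one_div_cancel (Real.sqrt_pos.2 (hθ.pos σ)).ne', one_smul]

theorem sqrt_smul_system_K (σ : S) : √(p σ) • (h.system K).K σ = K σ := by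
  rw [system, smul_smul, mul_one_div_cancel (Real.sqrt_pos.2 (hθ.pos σ)).ne', one_smul]

theorem unlift_innov_ae_eq (hy : ∀ t, IsL2 P (y t)) (t : ℤ) :
    unlift h.innov t =ᵐ[P] fun ω i => y t ω i - (act R.C (x t) i : Lp ℝ 2 P) ω := by
  have h1 : ∀ i, (h.innov t i : Ω → ℝ)
      =ᵐ[P] fun ω => y t ω i - (act R.C (x t) i : Lp ℝ 2 P) ω := fun i => by
    refine (Lp.coeFn_sub (lift P y t i) (act R.C (x t) i)).trans ?_
    filter_upwards [coeFn_toL2 (hy t i)] with ω hω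
    rw [Pi.sub_apply]
    exact congrArg (· - _) hω
  filter_upwards [ae_all_iff.2 h1] with ω hω
  exact funext hω

/-- `C x(t)` lies in the past of `y` and `y(t) - C x(t)` is orthogonal to it, so `C x(t)` is the
linear prediction of `y(t)`. -/
theorem noise_ae_eq_innovation (hy : ∀ t, IsL2 P (y t)) (t : ℤ) :
    unlift h.innov t =ᵐ[P] innovation P (switch θ) p y t := by
  have h1 : ∀ i, linProj P (pastVars (switch θ) p y t) (fun ω => y t ω i)
      =ᵐ[P] (act R.C (x t) i : Lp ℝ 2 P) := by
    intro i
    refine linProj_ae_eq (hy t i) ?_ fun f hf => ?_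
    · rw [hθ.hilbertSpan_pastVars hm hy]
      exact act_mem _ (h.mem t) i
    · rw [hθ.hilbertSpan_pastVars hm hy] at hf
      exact congrFun (congrFun (h.gram_innov_eq_zero (f := fun _ : Fin 1 => f) fun _ => hf) i) 0
  filter_upwards [ae_all_iff.2 h1, h.unlift_innov_ae_eq hy t] with ω hω1 hω2
  ext i
  rw [innovation, hω1 i, hω2]

variable (hK : ∀ σ, K σ * gram (h.innov 0) (h.innov 0)
    = R.inputMatrix σ - R.A σ * gram (x 0) (x 0) * R.Cᵀ)

include hK

theorem realizes_system (hy : ∀ t, IsL2 P (y t)) : (h.system K).Realizes P (switch θ) y where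
  state_eq t := by
    have h1 := isL2_unlift x t
    have h2 := isL2_unlift h.innov t
    refine (vecL2_eq_iff (isL2_unlift x (t + 1))
      (hθ.isL2_next h1 h2 (h.system K).A (h.system K).K t)).1 ?_
    rw [← hθ.next_vecL2 hm h1 h2]
    simp only [h.sqrt_smul_system_A, h.sqrt_smul_system_K]
    rw [vecL2_unlift, vecL2_unlift, vecL2_unlift]
    exact h.state_eq hK t
  output_eq t := by
    have h1 := isL2_unlift x t
    have h2 := isL2_unlift h.innov t
    refine (vecL2_eq_iff (hy t) ((h1.mulVec R.C).add (h2.mulVec 1))).1 ?_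
    rw [vecL2_add (h1.mulVec _) (h2.mulVec _), vecL2_mulVec h1]
    simp only [Matrix.one_mulVec]
    rw [vecL2_unlift]
    exact (h.output_eq t).trans (congrArg _ (vecL2_unlift h.innov t).symm)

theorem isJMLSIID_and_isRegular_system (hy : ∀ t, IsL2 P (y t))
    (hmean : ∀ t i, ∫ ω, y t ω i ∂P = 0)
    (hA : IsStable (∑ σ, (R.A σ)ᵀ ⊗ₖ (R.A σ)ᵀ)) :
    (h.system K).IsJMLSIID P θ p ∧ (h.system K).IsRegular P (switch θ) p := by
  have hL2 := isL2_unlift h.innov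
  have hL := lift_unlift h.innov
  have ha : (hθ.shiftSystem hm).Adapted (lift P (unlift h.innov)) := by
    rw [hL]
    exact h.innov_adapted
  have hw : (hθ.shiftSystem hm).White (lift P (unlift h.innov)) := by
    rw [hL]
    exact h.innov_white
  have hst : (hθ.shiftSystem hm).Stationary (lift P (unlift h.innov)) := by
    rw [hL]
    exact h.innov_white.stationary h.gram_innov_const
  have h0 : ∀ t i, ∫ ω, unlift h.innov t ω i ∂P = 0 := by
    intro t i
    have h1 : ∫ ω, (act R.C (x t) i : Lp ℝ 2 P) ω ∂P = 0 := by
      refine hθ.integral_eq_zero_of_mem_pastSpan hm hy h.adapted hmean (t := t) (Lp.memLp _) ?_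
      rw [toL2_coeFn]
      exact act_mem _ (h.mem t) i
    calc ∫ ω, unlift h.innov t ω i ∂P
        = ∫ ω, (y t ω i - (act R.C (x t) i : Lp ℝ 2 P) ω) ∂P :=
          integral_congr_ae (by filter_upwards [h.unlift_innov_ae_eq hy t] with ω hω; rw [hω])
      _ = 0 := by
          rw [integral_sub ((hy t i).integrable one_le_two)
            ((Lp.memLp _).integrable one_le_two), hmean, h1, sub_zero]
  have hmem : ∀ t i, InHilbertSpan P (pastVars (switch θ) p (h.system K).v t)
      (fun ω => (h.system K).x t ω i) := by
    intro t i
    refine (hθ.inHilbertSpan_iff hm hL2 t (isL2_unlift x t i)).2 ?_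
    change lift P (unlift x) t i ∈ _
    rw [hL, lift_unlift]
    exact h.mem_pastSpan_innov hK hA t i
  have hstable : IsStable (∑ σ, p σ • (((h.system K).A σ)ᵀ ⊗ₖ ((h.system K).A σ)ᵀ)) := by
    rw [sum_smul_kronecker hθ.pos]
    simp only [h.sqrt_smul_system_A]
    exact hA
  have hRC := hθ.isRC_of_white hm hL2 ha h0 hst
  refine ⟨?_, ?_⟩
  · exact
    { state_meas := measurable_unlift x
      noise_meas := measurable_unlift h.innov
      noise_wss :=
        { memLp := fun _ t i => hL2 t i
          mean_zero := fun _ t i => h0 t i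
          cov_shift := fun _ _ s t k => by
            have := hRC.wss.cov_shift [] [] s t k
            simp only [zPast_nil] at this
            exact this }
      noise_white := (hθ.white_iff hm hL2).1 hw
      noise_indep := hm.indepOfFuture ((hθ.adapted_iff hm hL2).1 ha)
      state_mem := hmem
      stable := hstable }
  · exact
    { noise_rc := hRC
      noise_orth := fun t w w' _ _ hww' => by
        have := hw.gram_word_ne ha w w' hww' t
        rwa [hθ.gram_word_lift hm hL2 hL2] at this
      state_mem := hmem
      stable := hstable }

omit hK in
-- By isometry `T_{σ,σ} = E[y yᵀ]`, and `y = C x + e` is an orthogonal decomposition. The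
-- denominator is therefore the innovation covariance weighted by `p σ`, which is also `E[e eᵀ
-- u_σ²]`.
theorem gainDenom_system (hy : ∀ t, IsL2 P (y t)) (σ : S) :
    (h.system K).gainDenom P (switch θ) p y σ = p σ • gram (h.innov 0) (h.innov 0) := by
  have hxa : (hθ.shiftSystem hm).Adapted (lift P (unlift x)) :=
    (lift_unlift x).symm ▸ h.state_mem_past
  have h1 : inputCov P (switch θ) (h.system K).x σ = p σ • gram (x 0) (x 0) := by
    refine (hθ.inputCov_eq hm (isL2_unlift x) hxa σ).trans ?_
    rw [lift_unlift]
  have h2 : cov P (zPast (switch θ) p y [σ] 0) (zPast (switch θ) p y [σ] 0)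
      = gram (lift P y 0) (lift P y 0) := by
    rw [← hθ.gram_word_lift hm hy hy]
    have h3 := ShiftSystem.gram_word_snoc_same h.adapted h.adapted [] [] σ (-1)
    rw [neg_add_cancel] at h3
    exact h3.trans (h.stationary [] (-1) 0)
  rw [GBS.gainDenom, h1, h2, h.gram_innov_self, smul_sub]
  simp [system]

theorem isBuiltFrom_system (hy : ∀ t, IsL2 P (y t))
    {Oinv : Matrix (Fin n) (ShortWord S n × Fin d) ℝ} (hx : x = hθ.projState hm y Oinv) :
    (h.system K).IsBuiltFrom P (switch θ) p y R Oinv where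
  A_eq _ := rfl
  C_eq := rfl
  state_eq t i := by
    refine (linProj_ae_eq ((hθ.isL2_futureVec hy t).mulVec Oinv i) (g := x t i) ?_
      fun f hf => ?_).symm
    · rw [hθ.hilbertSpan_pastVars hm hy]
      exact h.mem t i
    · rw [hθ.hilbertSpan_pastVars hm hy] at hf
      rw [hx]
      exact Submodule.starProjection_inner_eq_zero _ _ hf
  gain_eq σ := by
    have hxa : (hθ.shiftSystem hm).Adapted (lift P (unlift x)) :=
      (lift_unlift x).symm ▸ h.state_mem_past
    have h1 : inputCov P (switch θ) (h.system K).x σ = p σ • gram (x 0) (x 0) := by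
      refine (hθ.inputCov_eq hm (isL2_unlift x) hxa σ).trans ?_
      rw [lift_unlift]
    have h3 : 1 / √(p σ) * p σ = √(p σ) := by
      rw [one_div, inv_mul_eq_div, Real.div_sqrt]
    rw [h.gainDenom_system hy, h1]
    change ((1 / √(p σ)) • K σ) * _ = √(p σ) • R.inputMatrix σ - _ • (_ * _ * R.Cᵀ)
    rw [Matrix.smul_mul, Matrix.mul_smul, smul_smul, h3, hK, Matrix.mul_smul, Matrix.smul_mul,
      smul_smul, h3, smul_sub]
  fullRank hrank σ := by
    have ha : (hθ.shiftSystem hm).Adapted (lift P (unlift h.innov)) :=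
      (lift_unlift h.innov).symm ▸ h.innov_adapted
    have h1 := hrank σ
    rw [← inputCov_congr (h.noise_ae_eq_innovation hy 0),
      hθ.inputCov_eq hm (isL2_unlift h.innov) ha, lift_unlift] at h1
    rw [h.gainDenom_system hy]
    exact isUnit_of_rank_eq h1

end ShiftSystem.IsStateFor

theorem RealizabilityConditions.exists_minimal_rep {y : ℤ → Ω → Fin d → ℝ}
    (hc : RealizabilityConditions P θ p y) :
    ∃ (n : ℕ) (R : Rep S (Fin d × S) d n) (Oinv : Matrix (Fin n) (ShortWord S n × Fin d) ℝ),
      R.IsMinimal (outputSeries P (switch θ) p y) ∧ Oinv * R.obs = 1 := by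
  obtain ⟨n, R, hR⟩ := hc.rational.exists_minimal
  obtain ⟨Oinv, hO⟩ := Rep.exists_leftInverse_obs hR.obsMap_injective_and_range.1
  exact ⟨n, R, Oinv, hR, hO⟩

theorem RealizabilityConditions.exists_realization (hθ : IsSwitching P θ p)
    {y : ℤ → Ω → Fin d → ℝ} (hy : ∀ t, Measurable (y t))
    (hc : RealizabilityConditions P θ p y) {R : Rep S (Fin d × S) d n}
    {Oinv : Matrix (Fin n) (ShortWord S n × Fin d) ℝ}
    (hR : R.IsMinimal (outputSeries P (switch θ) p y)) (hO : Oinv * R.obs = 1) :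
    ∃ B : GBS Ω S n d d, B.IsMinimalJMLSIID P θ p y ∧
      B.IsForwardInnovation P (switch θ) p y ∧ B.IsBuiltFrom P (switch θ) p y R Oinv := by
  have hm := hc.indep.isPast hθ hy
  have hL2 : ∀ t, IsL2 P (y t) := fun t i => by
    have := hc.wss.memLp [] t i
    rwa [zPast_nil] at this
  have hmean : ∀ t i, ∫ ω, y t ω i ∂P = 0 := fun t i => by
    have := hc.wss.mean_zero [] t i
    rwa [zPast_nil] at this
  have h := hθ.isStateFor_projState hm hL2
    ((hθ.adapted_iff hm hL2).2 (aestronglyMeasurable_pastSigma y))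
    (hθ.stationary_of_isZeroMeanWSS hm hL2 hc.wss) hR.1 hO
  choose K hK using h.exists_gain
  obtain ⟨h1, h2⟩ := h.isJMLSIID_and_isRegular_system hK hL2 hmean
    (hR.isStable hc.squareSummable)
  refine ⟨h.system K, ⟨⟨h1, h.realizes_system hK hL2⟩, fun n' m' B' hB' => ?_⟩,
    ⟨rfl, h.noise_ae_eq_innovation hL2, h2⟩, h.isBuiltFrom_system hK hL2 rfl⟩
  -- A competing realization gives a representation of its own dimension, so minimality of `R`
  -- bounds that dimension from below.
  obtain ⟨X, hX, _⟩ := (hB'.isL2Realization hθ).existsUnique_lyapunov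
  exact hR.2 n' _ ((hB'.isL2Realization hθ).represents hX)

/-- A minimal representation can be realized in its own dimension, and every realization has a
representation in its own dimension; the two minimal dimensions coincide. -/
theorem GBS.IsJMLSIIDRealization.isMinimal_iff {k : ℕ} (hθ : IsSwitching P θ p)
    {y : ℤ → Ω → Fin d → ℝ} (hy : ∀ t, Measurable (y t)) {B : GBS Ω S n k d}
    (hB : B.IsJMLSIIDRealization P θ p y) {X : S → Matrix (Fin n) (Fin n) ℝ}
    (hX : B.Lyapunov P (switch θ) p X) :
    B.IsMinimalJMLSIID P θ p y ↔
      (B.rep P (switch θ) p X).IsMinimal (outputSeries P (switch θ) p y) := by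
  have h := hB.isL2Realization hθ
  constructor
  · intro hmin
    obtain ⟨n₀, R, Oinv, hR, hO⟩ := h.realizabilityConditions.exists_minimal_rep
    obtain ⟨B₀, hB₀, _⟩ := h.realizabilityConditions.exists_realization hθ hy hR hO
    exact ⟨h.represents hX, fun n' R' hR' => (hmin.2 _ _ B₀ hB₀.1).trans (hR.2 n' R' hR')⟩
  · refine fun hmin => ⟨hB, fun n' m' B' hB' => ?_⟩
    obtain ⟨X', hX', _⟩ := (hB'.isL2Realization hθ).existsUnique_lyapunov
    exact hmin.2 n' _ ((hB'.isL2Realization hθ).represents hX')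

end Construction

end JumpLinear

end

/-! ### Assembly of the theorem. -/

theorem mainTheorem9 {Ω : Type*} [MeasurableSpace Ω] (P : MeasureTheory.Measure Ω)
    [MeasureTheory.IsProbabilityMeasure P]
    {S : Type*} [Fintype S] [MeasurableSpace S] [MeasurableSingletonClass S]
    (θ : ℤ → Ω → S) (hθ : ∀ t, Measurable (θ t)) (hiid : ProbabilityTheory.iIndepFun θ P)
    (p : S → ℝ) (hp : ∀ σ, 0 < p σ) (hlaw : ∀ t σ, P.real {ω | θ t ω = σ} = p σ)
    {d : ℕ} (y : ℤ → Ω → Fin d → ℝ) (hy : ∀ t, Measurable (y t)) :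
    -- existence of a realization
    ((∃ (n m : ℕ) (B : JumpLinear.GBS Ω S n m d), B.IsJMLSIIDRealization P θ p y) ↔
      JumpLinear.RealizabilityConditions P θ p y) ∧
    -- minimal realization in forward innovation form, built from any minimal representation
    (JumpLinear.RealizabilityConditions P θ p y →
      (∃ (n : ℕ) (R : JumpLinear.Rep S (Fin d × S) d n)
        (Oinv : Matrix (Fin n) (JumpLinear.ShortWord S n × Fin d) ℝ),
        R.IsMinimal (JumpLinear.outputSeries P (JumpLinear.switch θ) p y) ∧ Oinv * R.obs = 1) ∧
      ∀ (n : ℕ) (R : JumpLinear.Rep S (Fin d × S) d n)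
        (Oinv : Matrix (Fin n) (JumpLinear.ShortWord S n × Fin d) ℝ),
        R.IsMinimal (JumpLinear.outputSeries P (JumpLinear.switch θ) p y) → Oinv * R.obs = 1 →
        ∃ B : JumpLinear.GBS Ω S n d d, B.IsMinimalJMLSIID P θ p y ∧
          B.IsForwardInnovation P (JumpLinear.switch θ) p y ∧
          B.IsBuiltFrom P (JumpLinear.switch θ) p y R Oinv) ∧
    -- the associated representation is well defined
    (∀ (n m : ℕ) (B : JumpLinear.GBS Ω S n m d), B.IsJMLSIIDRealization P θ p y →
      ∃! X, B.Lyapunov P (JumpLinear.switch θ) p X) ∧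
    -- a realization is minimal iff the associated representation is
    (∀ (n m : ℕ) (B : JumpLinear.GBS Ω S n m d), B.IsJMLSIIDRealization P θ p y →
      ∀ X, B.Lyapunov P (JumpLinear.switch θ) p X →
        (B.IsMinimalJMLSIID P θ p y ↔
          (B.rep P (JumpLinear.switch θ) p X).IsMinimal
            (JumpLinear.outputSeries P (JumpLinear.switch θ) p y))) ∧
    -- minimal realizations have isomorphic associated representations
    (∀ (n m n' m' : ℕ) (B : JumpLinear.GBS Ω S n m d) (B' : JumpLinear.GBS Ω S n' m' d),
      B.IsMinimalJMLSIID P θ p y → B'.IsMinimalJMLSIID P θ p y →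
      ∀ X X', B.Lyapunov P (JumpLinear.switch θ) p X → B'.Lyapunov P (JumpLinear.switch θ) p X' →
        (B.rep P (JumpLinear.switch θ) p X).Isomorphic
          (B'.rep P (JumpLinear.switch θ) p X')) := by
  have hs : JumpLinear.IsSwitching P θ p := ⟨hθ, hp, hlaw⟩
  refine ⟨⟨?_, fun hc => ?_⟩, fun hc => ⟨hc.exists_minimal_rep, fun n R Oinv hR hO =>
    hc.exists_realization hs hy hR hO⟩, fun n m B hB =>
      (hB.isL2Realization hs).existsUnique_lyapunov,
    fun n m B hB X hX => hB.isMinimal_iff hs hy hX, ?_⟩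
  · rintro ⟨n, m, B, hB⟩
    exact (hB.isL2Realization hs).realizabilityConditions
  · obtain ⟨n, R, Oinv, hR, hO⟩ := hc.exists_minimal_rep
    obtain ⟨B, hB, _⟩ := hc.exists_realization hs hy hR hO
    exact ⟨n, d, B, hB.1⟩
  · intro n m n' m' B B' hB hB' X X' hX hX'
    exact ((hB.1.isMinimal_iff hs hy hX).1 hB).isomorphic ((hB'.1.isMinimal_iff hs hy hX').1 hB')
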